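/- Let $n\ge 0$. For a finite field $\mathbb F_s$ with $s$ elements let $V=\mathbb F_s^n$, $G=GL_n(\mathbb F_s)$, and let $\mathcal F$ be the set of complete flags in $V$. The space $\mathbb C(\mathcal F\times\mathcal F\times V)^G$ of $G$-invariant functions is an algebra under the convolution $$(\alpha*\beta)(F,F',v)=\sum_{H\in\mathcal F,\;u\in V}\alpha(F,H,u)\,\beta(H,F',v-u).$$ It is spanned by the characteristic functions $T_{w,\beta}$ ($w\in S_n$, $\beta\subseteq\{1,\dots,n\}$) of the $G$-orbits, where the orbit labelled $(w,\beta)$ consists of the triples $(F,F',v)$ for which there is a basis $e_1,\dots,e_n$ of $V$ with $F_i=\langle e_1,\dots,e_i\rangle$, $F'_j=\langle e_{w(1)},\dots,e_{w(j)}\rangle$ and $v=\sum_{i\in\beta}e_i$ (different labels may give the same orbit). The structure constants of the products of the $T_{w,\beta}$ are polynomials in $s$. Let the mirabolic Hecke algebra $R_n$ be the corresponding $\mathbb C[\mathbf q,\mathbf q^{-1}]$-algebra, i.e. the $\mathbb C[\mathbf q,\mathbf q^{-1}]$-subalgebra generated by the families $T_{w,\beta}$ in the product, over all prime powers $s$,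 of these convolution algebras, where $\mathbf q$ acts on the factor of index $s$ as the scalar $s$. For $q\in\mathbb C^\times$ let $\mathcal R_n(q)=R_n/(\mathbf q-q)$ be its specialization. Then for every $q\in\mathbb C^\times$, the algebra $\mathcal R_n(q)$ is semisimple if and only if $[n]_q!\neq 0$, where $$[n]_q!=\prod_{k=1}^n[k]_q,\qquad [k]_q=1+q+\dots+q^{k-1}.$$ -/

import Mathlib

open scoped LaurentPolynomial

noncomputable section

namespace Mirabolic

/-- The vector space `V = K ^ n`. -/
abbrev Vec (K : Type) (n : ℕ) : Type := Fin n → K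

/-- Complete flags `0 = F 0 ⊂ F 1 ⊂ ... ⊂ F n = V` in `V = K ^ n`, i.e. the points of `G/B`
for `G = GL_n(K)`. -/
structure CompleteFlag (K : Type) [Field K] (n : ℕ) where
  /-- the `i`-th step of the flag -/
  step : Fin (n + 1) → Submodule K (Vec K n)
  mono : Monotone step
  finrank_step : ∀ i, Module.finrank K (step i) = (i : ℕ)

theorem CompleteFlag.step_injective (K : Type) [Field K] (n : ℕ) :
    Function.Injective (CompleteFlag.step : CompleteFlag K n → _) := by
  rintro ⟨a, _, _⟩ ⟨b, _, _⟩ h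
  cases h
  rfl

instance (K : Type) [Field K] [Finite K] (n : ℕ) : Finite (CompleteFlag K n) :=
  Finite.of_injective _ (CompleteFlag.step_injective K n)

instance (K : Type) [Field K] [Finite K] (n : ℕ) : Fintype (CompleteFlag K n) :=
  Fintype.ofFinite _

instance (K : Type) [Field K] (n : ℕ) : DecidableEq (CompleteFlag K n) :=
  Classical.decEq _

/-- The `ℂ`-algebra of all functions `α (F, F', v)` on `G/B × G/B × V`. A function is stored as the
matrix, indexed by pairs of flags, whose `(F, F')` entry is the element `∑ v, α (F, F', v) • [v]` of
the group algebra of `(V, +)`. The product of matrices over the group algebra is then the mirabolic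
convolution product; see `FunctionAlgebra.mul_value`. -/
abbrev FunctionAlgebra (K : Type) [Field K] (n : ℕ) : Type :=
  Matrix (CompleteFlag K n) (CompleteFlag K n) (AddMonoidAlgebra ℂ (Vec K n))

/-- The value `α (F, F', v)`. -/
def FunctionAlgebra.value {K : Type} [Field K] {n : ℕ} (α : FunctionAlgebra K n)
    (F F' : CompleteFlag K n) (v : Vec K n) : ℂ :=
  (α F F').coeff v

/-- The product in `FunctionAlgebra K n` is the convolution
`(α * β)(F, F', v) = ∑_{H, u} α (F, H, u) β (H, F', v - u)`. -/
theorem FunctionAlgebra.mul_value {K : Type} [Field K] [Fintype K] {n : ℕ}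
    (α β : FunctionAlgebra K n) (F F' : CompleteFlag K n) (v : Vec K n) :
    FunctionAlgebra.value (α * β) F F' v =
      ∑ H : CompleteFlag K n, ∑ u : Vec K n, α.value F H u * β.value H F' (v - u) := by
  classical
  have key : ∀ x y : AddMonoidAlgebra ℂ (Vec K n),
      (x * y).coeff v = ∑ u : Vec K n, x.coeff u * y.coeff (v - u) := by
    intro x y
    rw [AddMonoidAlgebra.coeff_mul_antidiag x y v
      (Finset.univ.image fun u : Vec K n => (u, v - u))]
    · rw [Finset.sum_image]
      intro a _ b _ h
      exact congrArg Prod.fst h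
    · rintro ⟨a, b⟩
      simp only [Finset.mem_image, Finset.mem_univ, true_and, Prod.mk.injEq]
      constructor
      · rintro ⟨u, rfl, rfl⟩
        simp
      · intro h
        exact ⟨a, rfl, by rw [← h]; simp⟩
  simp only [FunctionAlgebra.value, Matrix.mul_apply]
  rw [AddMonoidAlgebra.coeff_sum, Finsupp.finsetSum_apply]
  exact Finset.sum_congr rfl fun H _ => key _ _

/-- The `G`-orbit labelled by a permutation `w` and a set `β` in `G/B × G/B × V`: the triples
`(F, F', v)` for which there is a basis `e` of `V` with `F i = ⟨e 1, ..., e i⟩`,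
`F' j = ⟨e (w 1), ..., e (w j)⟩` and `v = ∑_{i ∈ β} e i`. Every orbit is of this form. -/
def orbit (K : Type) [Field K] {n : ℕ} (w : Equiv.Perm (Fin n)) (β : Finset (Fin n)) :
    Set (CompleteFlag K n × CompleteFlag K n × Vec K n) :=
  {x | ∃ e : Module.Basis (Fin n) K (Vec K n),
    (∀ i : Fin (n + 1), x.1.step i = Submodule.span K (e '' {k | (k : ℕ) < (i : ℕ)})) ∧
    (∀ j : Fin (n + 1),
      x.2.1.step j = Submodule.span K ((fun k => e (w k)) '' {k | (k : ℕ) < (j : ℕ)})) ∧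
    x.2.2 = ∑ i ∈ β, e i}

open Classical in
/-- The characteristic function `T_{w,β}` of an orbit. -/
def orbitFun (K : Type) [Field K] [Finite K] {n : ℕ} (w : Equiv.Perm (Fin n))
    (β : Finset (Fin n)) : FunctionAlgebra K n := fun F F' =>
  .ofCoeff (Finsupp.equivFunOnFinite.symm fun v => if (F, F', v) ∈ orbit K w β then 1 else 0)

/-- The prime powers `p ^ k`, `k ≥ 1`. -/
structure PrimePower where
  /-- the prime -/
  p : ℕ
  /-- the exponent -/
  k : ℕ
  prime : p.Prime
  ne_zero : k ≠ 0

instance (s : PrimePower) : Fact s.p.Prime := ⟨s.prime⟩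

/-- The finite field with `p ^ k` elements. -/
abbrev PrimePower.Fq (s : PrimePower) : Type := GaloisField s.p s.k

/-- The number of elements `p ^ k`, as a unit of `ℂ`. -/
def PrimePower.size (s : PrimePower) : ℂˣ :=
  Units.mk0 ((s.p : ℂ) ^ s.k) (pow_ne_zero _ (Nat.cast_ne_zero.mpr s.prime.ne_zero))

/-- Families of functions on `G/B × G/B × V`, one for every finite field `F_s`, with the
convolution product for each `s`. -/
def Family (n : ℕ) : Type := (s : PrimePower) → FunctionAlgebra s.Fq n

instance (n : ℕ) : Ring (Family n) :=
  inferInstanceAs (Ring ((s : PrimePower) → FunctionAlgebra s.Fq n))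

/-- The scalar family of a Laurent polynomial `f(𝐪)`: its component for the field with `s` elements
is the scalar `f(s)`. -/
def Family.scalar (n : ℕ) : ℂ[T;T⁻¹] →+* Family n :=
  RingHom.pi fun s => (algebraMap ℂ (FunctionAlgebra s.Fq n)).comp
    (LaurentPolynomial.eval₂ (RingHom.id ℂ) s.size)

theorem Family.scalar_commutes (n : ℕ) (f : ℂ[T;T⁻¹]) (x : Family n) :
    Family.scalar n f * x = x * Family.scalar n f := by
  funext s
  exact Algebra.commutes (A := FunctionAlgebra s.Fq n)
    (LaurentPolynomial.eval₂ (RingHom.id ℂ) s.size f) (x s)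

/-- `ℂ[𝐪, 𝐪⁻¹]` acts on families through `Family.scalar`. -/
instance (n : ℕ) : Algebra ℂ[T;T⁻¹] (Family n) :=
  RingHom.toAlgebra' (Family.scalar n) (Family.scalar_commutes n)

/-- The family of the characteristic functions `T_{w,β}` over all finite fields. -/
def generic {n : ℕ} (w : Equiv.Perm (Fin n)) (β : Finset (Fin n)) : Family n :=
  fun s => orbitFun s.Fq w β

/-- The mirabolic Hecke algebra `R_n` over `ℂ[𝐪, 𝐪⁻¹]`: the algebra generated by the elements
`T_{w,β}`, with relations those that hold for the convolution product over every finite field when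
`𝐪` is its number of elements. Since the structure constants of the products of the `T_{w,β}` are
polynomials in the number of elements of the field, this is the `ℂ[𝐪, 𝐪⁻¹]`-span of
the `T_{w,β}`, with these polynomials as structure constants. -/
def HeckeAlgebra (n : ℕ) : Subalgebra ℂ[T;T⁻¹] (Family n) :=
  Algebra.adjoin ℂ[T;T⁻¹] (Set.range fun x : Equiv.Perm (Fin n) × Finset (Fin n) => generic x.1 x.2)

/-- The two-sided ideal `(𝐪 - q)` of `R_n`. -/
def specializationIdeal (n : ℕ) (q : ℂ) : TwoSidedIdeal (HeckeAlgebra n) :=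
  TwoSidedIdeal.span {algebraMap ℂ[T;T⁻¹] (HeckeAlgebra n)
    (LaurentPolynomial.T 1 - LaurentPolynomial.C q)}

/-- The specialized mirabolic Hecke algebra `R_n(q) = R_n / (𝐪 - q)`. -/
abbrev SpecializedHeckeAlgebra (n : ℕ) (q : ℂ) : Type :=
  (specializationIdeal n q).ringCon.Quotient

/-- `[k]_q = 1 + q + ... + q ^ (k - 1)`. -/
def qNumber (q : ℂ) (k : ℕ) : ℂ := ∑ i ∈ Finset.range k, q ^ i

/-- `[n]_q! = [1]_q [2]_q ... [n]_q`. -/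
def qFactorial (q : ℂ) (n : ℕ) : ℂ := ∏ k ∈ Finset.Icc 1 n, qNumber q k

end Mirabolic

end

/-! Write `T i` for the function of pairs of flags differing exactly at step `i + 1`, and `E l` for
the diagonal idempotent that averages over the `l`-th step of the flag. These elements satisfy the
relations collected in `IsMirabolicSystem` (`isMirabolicSystem_stepMat`) and generate the mirabolic
Hecke algebra (`heckeAlgebra_eq_adjoin`). Everything about semisimplicity is deduced from the
relations and generation, apart from one nonvanishing statement.

If [n]_q! ≠ 0, every left ideal is shown to have an equivariant projection, by induction on n. The
idempotent `E n` is central, all `E l` act as 1 on its image, and the `T i` generate there a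
quotient of the Iwahori-Hecke algebra. That part is settled by a Maschke theorem,
`IsHeckeSystem.exists_projection`: a projection equivariant for all but the first generator is
averaged over shuffles of strands, and the average acts on the submodule as [n]_q. The complement 1
- `E n` is the sum of the idempotents `gap E j` = `E j` - `E (j + 1)`. Up to the factor q^j, `raise`
and `lower` identify `gap E j` with a subidempotent `cornerE` of `gap E 0`, so the complement is
controlled by the corner at `gap E 0`. This corner again carries a mirabolic system, with n lowered
by one (`IsMirabolicSystem.corner`), and an equivariant projection p for it extends to ∑ q^(-j)
`raise j` p `lower j` (`commute_sum_raise_lower`). Because the unit of the corner is `gap E 0`, the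
relations are stated with `E 0` in place of 1.

If [n]_q! = 0, let X be the sum of all `T_w`, multiplied by `E n`. Every generator multiplies X by a
scalar, and X² = [n]_q! X = 0. So X spans a left ideal of square zero, which a semisimple ring does
not allow unless X = 0 (`symmetrizer_mul_eq_zero`). But X survives specialization: were it divisible
by 𝐪 - q, comparing diagonal entries over all finite fields would give a Laurent polynomial c with
(s - q) c(s) = 1 for every prime power s, hence identically, which fails at s = q
(`specialize_symmetrizer_ne_zero`). -/

namespace Mirabolic

/-! ### Elements satisfying the relations of the Iwahori-Hecke algebra of type `A` -/

section Hecke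

variable {k R : Type*} [CommRing k] [Ring R] [Algebra k R]

/-- Elements `T 0, ..., T (n - 2)` satisfying the relations of the generators of the
Iwahori-Hecke algebra of the symmetric group on `n` letters. -/
structure IsHeckeSystem (n : ℕ) (q : k) (T : ℕ → R) : Prop where
  quad : ∀ i, i + 1 < n → T i * T i = (q - 1) • T i + q • (1 : R)
  braid : ∀ i, i + 2 < n → T i * T (i + 1) * T i = T (i + 1) * T i * T (i + 1)
  comm : ∀ i j, i + 1 < j → j + 1 < n → T i * T j = T j * T i

/-- `[m]_q` over a general ring of scalars. -/
def qNum (q : k) (m : ℕ) : k := ∑ i ∈ Finset.range m, q ^ i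

/-- `[m]_q!` over a general ring of scalars. -/
def qFac (q : k) (m : ℕ) : k := ∏ i ∈ Finset.range m, qNum q (i + 1)

theorem qNum_succ (q : k) (m : ℕ) : qNum q (m + 1) = 1 + q * qNum q m := by
  simp only [qNum, Finset.sum_range_succ', pow_succ', ← Finset.mul_sum, pow_zero]
  ring

theorem qFac_succ (q : k) (m : ℕ) : qFac q (m + 1) = qFac q m * qNum q (m + 1) :=
  Finset.prod_range_succ _ _

/-- The product `T a * T (a + 1) * ... * T (a + r - 1)`. -/
def ascProd (T : ℕ → R) : ℕ → ℕ → R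
  | _, 0 => 1
  | a, r + 1 => T a * ascProd T (a + 1) r

/-- The product `T (a + r - 1) * ... * T (a + 1) * T a`. -/
def descProd (T : ℕ → R) : ℕ → ℕ → R
  | _, 0 => 1
  | a, r + 1 => descProd T (a + 1) r * T a

/-- The sum of the products `T a * ... * T (a + j - 1)` over `j ≤ r`. -/
def ascSum (T : ℕ → R) : ℕ → ℕ → R
  | _, 0 => 1
  | a, r + 1 => 1 + T a * ascSum T (a + 1) r

/-- The sum of the standard basis of the Hecke algebra on the strands `a, ..., a + r - 1`. -/
def symmetrizer (T : ℕ → R) : ℕ → ℕ → R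
  | _, 0 => 1
  | a, r + 1 => symmetrizer T (a + 1) r * ascSum T a r

theorem ascProd_succ_right (T : ℕ → R) (a r : ℕ) :
    ascProd T a (r + 1) = ascProd T a r * T (a + r) := by
  induction r generalizing a with
  | zero => simp [ascProd]
  | succ r ih =>
    rw [ascProd, ih (a + 1), ascProd, ← mul_assoc]
    congr 2; omega

theorem descProd_succ_left (T : ℕ → R) (a r : ℕ) :
    descProd T a (r + 1) = T (a + r) * descProd T a r := by
  induction r generalizing a with
  | zero => simp [descProd]
  | succ r ih =>
    rw [descProd, ih (a + 1), descProd, mul_assoc]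
    congr 2; omega

theorem ascSum_succ_right (T : ℕ → R) (a r : ℕ) :
    ascSum T a (r + 1) = ascSum T a r + ascProd T a (r + 1) := by
  induction r generalizing a with
  | zero => simp [ascSum, ascProd]
  | succ r ih =>
    rw [ascSum, ih (a + 1), ascSum, ascProd.eq_2 T a (r + 1), mul_add, add_assoc]

theorem commute_ascProd {T : ℕ → R} {y : R} (a r : ℕ)
    (h : ∀ j, a ≤ j → j < a + r → Commute y (T j)) : Commute y (ascProd T a r) := by
  induction r generalizing a with
  | zero => exact Commute.one_right _
  | succ r ih =>
    exact (h a le_rfl (by omega)).mul_right (ih (a + 1) fun j h1 h2 => h j (by omega) (by omega))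

theorem commute_descProd {T : ℕ → R} {y : R} (a r : ℕ)
    (h : ∀ j, a ≤ j → j < a + r → Commute y (T j)) : Commute y (descProd T a r) := by
  induction r generalizing a with
  | zero => exact Commute.one_right _
  | succ r ih =>
    exact (ih (a + 1) fun j h1 h2 => h j (by omega) (by omega)).mul_right (h a le_rfl (by omega))

theorem commute_ascSum {T : ℕ → R} {y : R} (a r : ℕ)
    (h : ∀ j, a ≤ j → j < a + r → Commute y (T j)) : Commute y (ascSum T a r) := by
  induction r generalizing a with
  | zero => exact Commute.one_right _
  | succ r ih =>
    exact (Commute.one_right _).add_right ((h a le_rfl (by omega)).mul_right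
      (ih (a + 1) fun j h1 h2 => h j (by omega) (by omega)))

theorem commute_symmetrizer {T : ℕ → R} {y : R} (a r : ℕ)
    (h : ∀ j, a ≤ j → j + 1 < a + r → Commute y (T j)) : Commute y (symmetrizer T a r) := by
  induction r generalizing a with
  | zero => exact Commute.one_right _
  | succ r ih =>
    exact (ih (a + 1) fun j h1 h2 => h j (by omega) (by omega)).mul_right
      (commute_ascSum a r fun j h1 h2 => h j h1 (by omega))

theorem ascSum_mul {T : ℕ → R} {q : k} {y : R} (a r : ℕ)
    (h : ∀ j, a ≤ j → j < a + r → T j * y = q • y) : ascSum T a r * y = qNum q (r + 1) • y := by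
  induction r generalizing a with
  | zero => simp [ascSum, qNum]
  | succ r ih =>
    rw [ascSum, add_mul, mul_assoc, ih (a + 1) fun j h1 h2 => h j (by omega) (by omega),
      mul_smul_comm, h a le_rfl (by omega), qNum_succ q (r + 1), one_mul]
    module

/-- On a common q-eigenvector, `T_w` acts by q^ℓ(w). These powers add up to [r]_q!, with one factor
[k]_q for each `ascSum` in the symmetrizer. -/
theorem symmetrizer_mul {T : ℕ → R} {q : k} {y : R} (a r : ℕ)
    (h : ∀ j, a ≤ j → j + 1 < a + r → T j * y = q • y) :
    symmetrizer T a r * y = qFac q r • y := by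
  induction r generalizing a with
  | zero => simp [symmetrizer, qFac]
  | succ r ih =>
    rw [symmetrizer, mul_assoc, ascSum_mul a r fun j h1 h2 => h j h1 (by omega), mul_smul_comm,
      ih (a + 1) fun j h1 h2 => h j (by omega) (by omega), smul_smul, qFac_succ, mul_comm]

/-- An element which intertwines `T j` with `T (j + 1)` shifts the symmetrizer. -/
theorem mul_ascSum_shift {T : ℕ → R} {c : R} (a r : ℕ)
    (h : ∀ j, a ≤ j → j < a + r → c * T j = T (j + 1) * c) :
    c * ascSum T a r = ascSum T (a + 1) r * c := by
  induction r generalizing a with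
  | zero => simp [ascSum]
  | succ r ih =>
    rw [ascSum, ascSum, mul_add, ← mul_assoc, h a le_rfl (by omega), mul_assoc,
      ih (a + 1) fun j h1 h2 => h j (by omega) (by omega), add_mul, mul_one, one_mul, mul_assoc]

theorem mul_symmetrizer_shift {T : ℕ → R} {c : R} (a r : ℕ)
    (h : ∀ j, a ≤ j → j + 1 < a + r → c * T j = T (j + 1) * c) :
    c * symmetrizer T a r = symmetrizer T (a + 1) r * c := by
  induction r generalizing a with
  | zero => simp [symmetrizer]
  | succ r ih =>
    rw [symmetrizer, symmetrizer, ← mul_assoc, ih (a + 1) fun j h1 h2 => h j (by omega) (by omega),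
      mul_assoc, mul_ascSum_shift a r fun j h1 h2 => h j h1 (by omega), mul_assoc]

/-- Passing to the opposite ring exchanges ascending and descending products; mirror images of
lemmas are obtained in this way. -/
theorem unop_ascProd_op (T : ℕ → R) (a r : ℕ) :
    (ascProd (fun i => MulOpposite.op (T i)) a r).unop = descProd T a r := by
  induction r generalizing a with
  | zero => rfl
  | succ r ih => rw [ascProd, descProd, MulOpposite.unop_mul, ih, MulOpposite.unop_op]

/-- The symmetrizer with the factors of all products reversed. -/
def symmetrizer' (T : ℕ → R) (a r : ℕ) : R :=
  (symmetrizer (fun i => MulOpposite.op (T i)) a r).unop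

namespace IsHeckeSystem

variable {n : ℕ} {q : k} {T : ℕ → R}

theorem op (hT : IsHeckeSystem n q T) : IsHeckeSystem n q fun i => MulOpposite.op (T i) where
  quad i hi := by
    rw [← MulOpposite.op_mul, hT.quad i hi]; rfl
  braid i hi := by
    simp only [← MulOpposite.op_mul, ← mul_assoc, hT.braid i hi]
  comm i j h1 h2 := by
    simp only [← MulOpposite.op_mul, hT.comm i j h1 h2]

theorem commute (hT : IsHeckeSystem n q T) {i j : ℕ} (hi : i + 1 < n) (hj : j + 1 < n)
    (h : i + 1 < j ∨ j + 1 < i) : Commute (T i) (T j) := by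
  rcases h with h | h
  · exact hT.comm i j h hj
  · exact (hT.comm j i h hi).symm

theorem shift {n : ℕ} (hT : IsHeckeSystem (n + 1) q T) : IsHeckeSystem n q fun i => T (i + 1) where
  quad i hi := hT.quad (i + 1) (by omega)
  braid i hi := hT.braid (i + 1) (by omega)
  comm i j h1 h2 := hT.comm (i + 1) (j + 1) (by omega) (by omega)

/-- The summands of `ascSum T a r` are the minimal coset representatives for the subgroup of the
block that fixes its first strand. Generators with i > a are handled by induction, with `x * T a` in
the role of `x`; the essential case is i = a. -/
theorem mul_ascSum_mul (hT : IsHeckeSystem n q T) (r : ℕ) : ∀ (a : ℕ) (x : R), a + r < n →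
    (∀ j, a < j → j < a + r → x * T j = q • x) →
    ∀ i, a ≤ i → i < a + r → x * ascSum T a r * T i = q • (x * ascSum T a r) := by
  induction r with
  | zero => intro a x _ _ i h1 h2; omega
  | succ r ih =>
    intro a x han hx i h1 h2
    rcases h1.eq_or_lt with rfl | h1
    · cases r with
      | zero =>
        simp only [ascSum, mul_one, mul_add, add_mul, mul_assoc, hT.quad a (by omega),
          mul_smul_comm, smul_add]
        module
      | succ r =>
        have hc : Commute (T a) (ascSum T (a + 2) r) :=
          commute_ascSum _ _ fun j h3 h4 => hT.commute (by omega) (by omega) (by omega)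
        -- The braid relation turns `T a * T (a + 1) * T a` into a word beginning with `T (a + 1)`,
        -- which `x` absorbs.
        have hb : x * (T a * (T (a + 1) * (T a * ascSum T (a + 2) r))) =
            q • (x * (T a * (T (a + 1) * ascSum T (a + 2) r))) := by
          have := hT.braid a (by omega)
          have h3 := hx (a + 1) (by omega) (by omega)
          calc _ = x * (T a * T (a + 1) * T a) * ascSum T (a + 2) r := by simp only [mul_assoc]
            _ = (x * T (a + 1)) * T a * T (a + 1) * ascSum T (a + 2) r := by
              rw [this]; simp only [mul_assoc]
            _ = _ := by rw [h3]; simp only [smul_mul_assoc, mul_assoc]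
        have e : ascSum T a (r + 1 + 1) = 1 + T a * (1 + T (a + 1) * ascSum T (a + 2) r) := rfl
        rw [e]
        simp only [mul_one, mul_add, add_mul, mul_assoc, ← hc.eq, hb, hT.quad a (by omega),
          mul_smul_comm, smul_add]
        module
    · have := ih (a + 1) (x * T a) (by omega) (fun j h3 h4 => by
        rw [mul_assoc, (hT.commute (i := a) (j := j) (by omega) (by omega) (by omega)).eq,
          ← mul_assoc, hx j (by omega) (by omega), smul_mul_assoc]) i (by omega) (by omega)
      rw [ascSum, mul_add, add_mul, ← mul_assoc, this, mul_one, hx i h1 h2, smul_add]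

theorem symmetrizer_mul_gen (hT : IsHeckeSystem n q T) (a r : ℕ) (har : a + r ≤ n) (i : ℕ)
    (h1 : a ≤ i) (h2 : i + 1 < a + r) : symmetrizer T a r * T i = q • symmetrizer T a r := by
  induction r generalizing a i with
  | zero => omega
  | succ r ih =>
    exact hT.mul_ascSum_mul r a _ (by omega)
      (fun j h3 h4 => ih (a + 1) (by omega) j (by omega) (by omega)) i h1 (by omega)

theorem gen_mul_symmetrizer' (hT : IsHeckeSystem n q T) (a r : ℕ) (har : a + r ≤ n) (i : ℕ)
    (h1 : a ≤ i) (h2 : i + 1 < a + r) : T i * symmetrizer' T a r = q • symmetrizer' T a r := by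
  have := congrArg MulOpposite.unop (hT.op.symmetrizer_mul_gen a r har i h1 h2)
  simpa [symmetrizer'] using this

end IsHeckeSystem

theorem mul_symmetrizer' {T : ℕ → R} {q : k} {y : R} (a r : ℕ)
    (h : ∀ j, a ≤ j → j + 1 < a + r → y * T j = q • y) :
    y * symmetrizer' T a r = qFac q r • y := by
  have := congrArg MulOpposite.unop (symmetrizer_mul (T := fun i => MulOpposite.op (T i)) (q := q)
    (y := MulOpposite.op y) a r fun j h1 h2 => by
      rw [← MulOpposite.op_mul, h j h1 h2]; rfl)
  simpa [symmetrizer'] using this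

namespace IsHeckeSystem

variable {n : ℕ} {q : k} {T : ℕ → R}

/-- Both sides are the product `symmetrizer * symmetrizer'`: each factor can be evaluated on the
other, as it is an eigenvector of all generators. Once [r]_q! is invertible the two symmetrizers
agree, so the symmetrizer absorbs generators on both sides. -/
theorem smul_symmetrizer'_eq (hT : IsHeckeSystem n q T) (a r : ℕ) (har : a + r ≤ n) :
    qFac q r • symmetrizer' T a r = qFac q r • symmetrizer T a r := by
  rw [← symmetrizer_mul a r (hT.gen_mul_symmetrizer' a r har),
    mul_symmetrizer' a r (hT.symmetrizer_mul_gen a r har)]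

theorem symmetrizer'_mul_symmetrizer {k : Type*} [Field k] [Algebra k R] {q : k}
    (hT : IsHeckeSystem n q T) (a r : ℕ) (har : a + r ≤ n) (hr : qFac q r ≠ 0) :
    symmetrizer' T a r * symmetrizer T a r = qFac q r • symmetrizer T a r := by
  have h : symmetrizer' T a r = symmetrizer T a r :=
    smul_right_injective R hr (hT.smul_symmetrizer'_eq a r har)
  have h2 := symmetrizer_mul a r (hT.gen_mul_symmetrizer' a r har)
  rwa [h] at h2 ⊢

/-- The braid `ascProd T a r` carries one strand across a block of r strands, so the generators
inside the block are shifted by one place. -/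
theorem gen_succ_mul_ascProd (hT : IsHeckeSystem n q T) (r : ℕ) : ∀ (a : ℕ), a + r < n →
    ∀ j, a ≤ j → j + 1 < a + r → ascProd T a r * T j = T (j + 1) * ascProd T a r := by
  induction r with
  | zero => intros; omega
  | succ r ih =>
    intro a han j h1 h2
    rcases h1.eq_or_lt with rfl | h1
    · obtain ⟨r, rfl⟩ : ∃ r', r = r' + 1 := ⟨r - 1, by omega⟩
      have hc : Commute (T a) (ascProd T (a + 2) r) :=
        commute_ascProd _ _ fun j h3 h4 => hT.commute (by omega) (by omega) (by omega)
      have e : ascProd T a (r + 1 + 1) = T a * (T (a + 1) * ascProd T (a + 2) r) := rfl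
      have := hT.braid a (by omega)
      rw [e]
      calc _ = T a * T (a + 1) * T a * ascProd T (a + 2) r := by
            simp only [mul_assoc, hc.eq]
        _ = _ := by rw [this]; simp only [mul_assoc]
    · have := ih (a + 1) (by omega) j h1 (by omega)
      rw [ascProd, mul_assoc, this, ← mul_assoc, (hT.commute (i := a) (j := j + 1) (by omega)
        (by omega) (by omega)).eq, mul_assoc]

theorem descProd_mul_gen_succ (hT : IsHeckeSystem n q T) (a r : ℕ) (har : a + r < n)
    (j : ℕ) (h1 : a ≤ j) (h2 : j + 1 < a + r) :
    T j * descProd T a r = descProd T a r * T (j + 1) := by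
  have := congrArg MulOpposite.unop (hT.op.gen_succ_mul_ascProd r a har j h1 h2)
  simpa [unop_ascProd_op] using this

/-- The two expressions for the product going up from `a` to `a + r` and back. -/
theorem ascProd_mul_descProd (hT : IsHeckeSystem n q T) (a r : ℕ) (har : a + r + 1 < n) :
    ascProd T a (r + 1) * descProd T a r = descProd T (a + 1) r * ascProd T a (r + 1) := by
  induction r generalizing a with
  | zero => simp [descProd]
  | succ r ih =>
    have h1 := ih (a + 1) (by omega)
    have hc : Commute (T a) (descProd T (a + 2) r) :=
      commute_descProd _ _ fun j h3 h4 => hT.commute (by omega) (by omega) (by omega)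
    have hc' : Commute (T a) (ascProd T (a + 2) r) :=
      commute_ascProd _ _ fun j h3 h4 => hT.commute (by omega) (by omega) (by omega)
    have hb := hT.braid a (by omega)
    have e1 : ascProd T (a + 1) (r + 1) = T (a + 1) * ascProd T (a + 2) r := rfl
    have e2 : descProd T (a + 1) (r + 1) = descProd T (a + 2) r * T (a + 1) := rfl
    rw [e2, ascProd, descProd]
    calc T a * ascProd T (a + 1) (r + 1) * (descProd T (a + 1) r * T a)
        = T a * (ascProd T (a + 1) (r + 1) * descProd T (a + 1) r) * T a := by
          simp only [mul_assoc]
      _ = T a * descProd T (a + 2) r * T (a + 1) * (ascProd T (a + 2) r * T a) := by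
          rw [h1, e1]; simp only [mul_assoc]
      _ = descProd T (a + 2) r * (T a * T (a + 1) * T a) * ascProd T (a + 2) r := by
          rw [hc.eq, ← hc'.eq]; simp only [mul_assoc]
      _ = _ := by rw [hb, e1]; simp only [mul_assoc]

theorem mul_descProd {x : R} (a r : ℕ) (hx : ∀ j, a ≤ j → j < a + r → x * T j = q • x) :
    x * descProd T a r = q ^ r • x := by
  induction r generalizing a with
  | zero => simp [descProd]
  | succ r ih =>
    rw [descProd, ← mul_assoc, ih (a + 1) fun j h1 h2 => hx j (by omega) (by omega),
      smul_mul_assoc, hx a le_rfl (by omega), smul_smul, pow_succ]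

/-- The key identity: the Jucys-Murphy type product `ascProd * descProd`, symmetrized. -/
theorem mul_ascProd_mul_descProd (hT : IsHeckeSystem n q T) {x : R} (a r : ℕ)
    (har : a + r < n) (hx : ∀ j, a < j → j < a + r → x * T j = q • x) :
    q • (x * (ascProd T a r * descProd T a r)) =
      q ^ r • (x - (1 - q) • (x * ascSum T a r)) := by
  induction r with
  | zero => simp only [ascProd, descProd, ascSum, mul_one, pow_zero]; module
  | succ r ih =>
    have h1 := ih (by omega) fun j h1 h2 => hx j h1 (by omega)
    -- Rewritten with the descending product in front, the word starts with r generators that `x`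
    -- absorbs, at the price of q^r.
    have h2 : x * (ascProd T a (r + 1) * descProd T a r) = q ^ r • (x * ascProd T a (r + 1)) := by
      rw [hT.ascProd_mul_descProd a r (by omega), ← mul_assoc,
        mul_descProd (a + 1) r fun j h3 h4 => hx j (by omega) (by omega), smul_mul_assoc]
    -- Expanding the square of `T (a + r)` in the middle gives a recursion: its linear term supplies
    -- the new summand of `ascSum`, its constant term is the case r.
    have h3 : ascProd T a (r + 1) * descProd T a (r + 1) =
        (q - 1) • (ascProd T a (r + 1) * descProd T a r) +
          q • (ascProd T a r * descProd T a r) := by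
      rw [descProd_succ_left, ascProd_succ_right]
      have := hT.quad (a + r) (by omega)
      calc _ = ascProd T a r * (T (a + r) * T (a + r)) * descProd T a r := by
            simp only [mul_assoc]
        _ = _ := by
          rw [this]
          simp only [mul_add, add_mul, mul_smul_comm, smul_mul_assoc, mul_one]
    rw [h3, mul_add, mul_smul_comm, mul_smul_comm, h2, h1, ascSum_succ_right, mul_add]
    simp only [pow_succ]
    module

/-- Conjugating by a generator and summing gives an element commuting with the generator. -/
theorem commute_add_conj (hT : IsHeckeSystem n q T) (i : ℕ) (hi : i + 1 < n) (y : R) :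
    Commute (T i) (q • y + T i * y * T i) := by
  have := hT.quad i hi
  rw [Commute, SemiconjBy]
  have e1 : T i * (T i * y * T i) = (T i * T i) * y * T i := by simp only [mul_assoc]
  have e2 : (T i * y * T i) * T i = T i * y * (T i * T i) := by simp only [mul_assoc]
  rw [mul_add, add_mul, e1, e2, this]
  simp only [mul_add, add_mul, mul_smul_comm, smul_mul_assoc, mul_one, one_mul,
    sub_smul, sub_mul, mul_sub]
  module

end IsHeckeSystem

end Hecke


/-! ### A Maschke theorem for Hecke algebras -/

section Maschke

/-! ### Averaging over shuffles of strands -/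

section Shuffle

variable {k R : Type*} [Field k] [Ring R] [Algebra k R]

/-- A weighted sum over all ways of moving `m` further strands through the strands on which the
elements `Y r` live. -/
def shuffleSum (T : ℕ → R) (q : k) (Y : ℕ → R) : ℕ → ℕ → R
  | 0, r => Y r
  | m + 1, r => (q * q⁻¹ ^ r) • (ascProd T m r * shuffleSum T q Y m r * descProd T m r) +
      (if r = 0 then 1 else 1 - q) • shuffleSum T q Y m (r + 1)

variable {n : ℕ} {q : k} {T : ℕ → R} {Y : ℕ → R}

/-- `shuffleSum T q Y m r` sees three blocks: the first m strands, the next r, and the rest. It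
commutes with the generators inside each block. This is the last block, where every factor of the
recursion acts on far strands. -/
theorem commute_shuffleSum_of_le (hT : IsHeckeSystem n q T)
    (hY : ∀ r i, r ≤ i → i + 1 < n → Commute (T i) (Y r)) (m r i : ℕ) (h1 : m + r ≤ i)
    (h2 : i + 1 < n) : Commute (T i) (shuffleSum T q Y m r) := by
  induction m generalizing r with
  | zero => exact hY r i (by omega) h2
  | succ m ih =>
    refine Commute.add_right (Commute.smul_right (((commute_ascProd _ _ fun j h3 h4 =>
      hT.commute h2 (by omega) (by omega)).mul_right (ih r (by omega))).mul_right
      (commute_descProd _ _ fun j h3 h4 => hT.commute h2 (by omega) (by omega))) _)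
      (Commute.smul_right (ih (r + 1) (by omega)) _)

/-- For the middle block: conjugation by `ascProd` and `descProd` moves the block of r strands from
m to m + 1, and shifts its generators accordingly. -/
theorem commute_shuffleSum_of_mem (hT : IsHeckeSystem n q T)
    (hY : ∀ r i, i + 1 < r → r ≤ n → Commute (T i) (Y r)) (m r i : ℕ) (h1 : m ≤ i)
    (h2 : i + 1 < m + r) (hn : m + r ≤ n) : Commute (T i) (shuffleSum T q Y m r) := by
  induction m generalizing r i with
  | zero => exact hY r i (by omega) (by omega)
  | succ m ih =>
    refine Commute.add_right (Commute.smul_right ?_ _)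
      (Commute.smul_right (ih (r + 1) i (by omega) (by omega) (by omega)) _)
    obtain ⟨i, rfl⟩ : ∃ j, i = j + 1 := ⟨i - 1, by omega⟩
    have e1 := hT.gen_succ_mul_ascProd r m (by omega) i (by omega) (by omega)
    have e2 := hT.descProd_mul_gen_succ m r (by omega) i (by omega) (by omega)
    have e3 := ih r i (by omega) (by omega) (by omega)
    calc _ = T (i + 1) * ascProd T m r * shuffleSum T q Y m r * descProd T m r := by
          simp only [mul_assoc]
      _ = ascProd T m r * (T i * shuffleSum T q Y m r) * descProd T m r := by
          rw [← e1]; simp only [mul_assoc]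
      _ = ascProd T m r * shuffleSum T q Y m r * (T i * descProd T m r) := by
          rw [e3.eq]; simp only [mul_assoc]
      _ = _ := by rw [e2]; simp only [mul_assoc]

/-- Two neighbouring strands are carried together across r others, and their mutual crossing slides
along from one end to the other. -/
theorem IsHeckeSystem.gen_mul_ascProd_mul_ascProd (hT : IsHeckeSystem n q T) (a r : ℕ)
    (har : a + r + 1 < n) :
    T a * (ascProd T (a + 1) r * ascProd T a r) =
      ascProd T (a + 1) r * ascProd T a r * T (a + r) := by
  -- The shift lemma is applied to each factor of `ascProd T b m` in turn.
  have h : ∀ m b, a ≤ b → b + m ≤ a + r → ascProd T a (r + 1) * ascProd T b m =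
      ascProd T (b + 1) m * ascProd T a (r + 1) := by
    intro m
    induction m with
    | zero => intros; simp [ascProd]
    | succ m ih =>
      intro b h1 h2
      rw [ascProd.eq_2 T b m, ← mul_assoc,
        hT.gen_succ_mul_ascProd (r + 1) a (by omega) b h1 (by omega),
        mul_assoc, ih (b + 1) (by omega) (by omega), ← mul_assoc]
      rfl
  rw [← mul_assoc, ← ascProd.eq_2, h r a le_rfl le_rfl, ascProd_succ_right, mul_assoc]

theorem IsHeckeSystem.descProd_mul_descProd_mul_gen (hT : IsHeckeSystem n q T) (a r : ℕ)
    (har : a + r + 1 < n) :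
    descProd T a r * descProd T (a + 1) r * T a =
      T (a + r) * (descProd T a r * descProd T (a + 1) r) := by
  have := congrArg MulOpposite.unop (hT.op.gen_mul_ascProd_mul_ascProd a r har)
  simpa [unop_ascProd_op] using this

/-- For the first block, the new case is the crossing of the last two strands moved into it. The
weights in `shuffleSum` are dictated by this case: unfolding two levels, the mixed terms must
combine into q y + `T i` y `T i`, which commutes with `T i` by `commute_add_conj`. -/
theorem commute_shuffleSum_of_lt (hT : IsHeckeSystem n q T) (hq : q ≠ 0)
    (hY : ∀ r i, r ≤ i → i + 1 < n → Commute (T i) (Y r))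
    (hY' : ∀ r i, i + 1 < r → r ≤ n → Commute (T i) (Y r)) (m r i : ℕ)
    (h : i + 1 < m) (hn : m + r ≤ n) : Commute (T i) (shuffleSum T q Y m r) := by
  induction m generalizing r with
  | zero => omega
  | succ m ih =>
    rcases (Nat.lt_succ_iff.mp h).lt_or_eq with h1 | rfl
    · exact Commute.add_right (Commute.smul_right (((commute_ascProd _ _ fun j h3 h4 =>
        hT.commute (by omega) (by omega) (by omega)).mul_right (ih r h1 (by omega))).mul_right
        (commute_descProd _ _ fun j h3 h4 => hT.commute (by omega) (by omega) (by omega))) _)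
        (Commute.smul_right (ih (r + 1) h1 (by omega)) _)
    · clear ih
      have c1 : Commute (T i) (ascProd T (i + 1) r * (ascProd T i r * shuffleSum T q Y i r *
          descProd T i r) * descProd T (i + 1) r) := by
        have e := commute_shuffleSum_of_le hT hY i r (i + r) le_rfl (by omega)
        have e1 := hT.gen_mul_ascProd_mul_ascProd i r (by omega)
        have e2 := hT.descProd_mul_descProd_mul_gen i r (by omega)
        calc _ = T i * (ascProd T (i + 1) r * ascProd T i r) * shuffleSum T q Y i r *
              (descProd T i r * descProd T (i + 1) r) := by simp only [mul_assoc]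
          _ = ascProd T (i + 1) r * ascProd T i r * (T (i + r) * shuffleSum T q Y i r) *
              (descProd T i r * descProd T (i + 1) r) := by rw [e1]; simp only [mul_assoc]
          _ = ascProd T (i + 1) r * ascProd T i r * shuffleSum T q Y i r *
              (T (i + r) * (descProd T i r * descProd T (i + 1) r)) := by
            rw [e.eq]; simp only [mul_assoc]
          _ = _ := by rw [← e2]; simp only [mul_assoc]
      have c2 := commute_shuffleSum_of_mem hT hY' i (r + 1 + 1) i le_rfl (by omega) (by omega)
      have c3 := hT.commute_add_conj i (by omega)
        (ascProd T (i + 1) r * shuffleSum T q Y i (r + 1) * descProd T (i + 1) r)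
      -- Both strands cross the block, neither does, or exactly one does. The two words of the last
      -- kind differ by conjugation with `T i`, and q q^(-(r+1)) = q^(-r) gives their coefficients
      -- the ratio q : 1.
      have key : shuffleSum T q Y (i + 1 + 1) r =
          (q * q⁻¹ ^ r * (q * q⁻¹ ^ r)) • (ascProd T (i + 1) r * (ascProd T i r *
            shuffleSum T q Y i r * descProd T i r) * descProd T (i + 1) r) +
          ((if r = 0 then 1 else 1 - q) * (1 - q)) • shuffleSum T q Y i (r + 1 + 1) +
          ((if r = 0 then 1 else 1 - q) * q⁻¹ ^ r) •
            (q • (ascProd T (i + 1) r * shuffleSum T q Y i (r + 1) * descProd T (i + 1) r) +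
              T i * (ascProd T (i + 1) r * shuffleSum T q Y i (r + 1) * descProd T (i + 1) r) *
                T i) := by
        have hq' : q * q⁻¹ ^ (r + 1) = q⁻¹ ^ r := by
          rw [pow_succ', ← mul_assoc, mul_inv_cancel₀ hq, one_mul]
        rw [shuffleSum, shuffleSum.eq_2 T q Y r i, shuffleSum.eq_2 T q Y (r + 1) i, hq',
          if_neg (Nat.succ_ne_zero r), ascProd.eq_2 T i r, descProd.eq_2 T i r]
        simp only [mul_add, add_mul, mul_smul_comm, smul_mul_assoc, mul_assoc]
        module
      rw [key]
      exact ((c1.smul_right _).add_right (c2.smul_right _)).add_right (c3.smul_right _)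

end Shuffle

/-! ### Equivariant projections for Hecke algebras -/

variable {k V : Type*} [Field k] [AddCommGroup V] [Module k V]

theorem ascProd_apply_mem {T : ℕ → Module.End k V} {N : Submodule k V} (a r : ℕ)
    (h : ∀ i, a ≤ i → i < a + r → ∀ v ∈ N, T i v ∈ N) : ∀ v ∈ N, ascProd T a r v ∈ N := by
  induction r generalizing a with
  | zero => exact fun v hv => hv
  | succ r ih =>
    exact fun v hv => h a le_rfl (by omega) _
      (ih (a + 1) (fun i h1 h2 => h i (by omega) (by omega)) v hv)

theorem descProd_apply_mem {T : ℕ → Module.End k V} {N : Submodule k V} (a r : ℕ)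
    (h : ∀ i, a ≤ i → i < a + r → ∀ v ∈ N, T i v ∈ N) : ∀ v ∈ N, descProd T a r v ∈ N := by
  induction r generalizing a with
  | zero => exact fun v hv => hv
  | succ r ih =>
    exact fun v hv => ih (a + 1) (fun i h1 h2 => h i (by omega) (by omega)) _
      (h a le_rfl (by omega) v hv)

theorem ascSum_apply_mem {T : ℕ → Module.End k V} {N : Submodule k V} (a r : ℕ)
    (h : ∀ i, a ≤ i → i < a + r → ∀ v ∈ N, T i v ∈ N) : ∀ v ∈ N, ascSum T a r v ∈ N := by
  induction r generalizing a with
  | zero => exact fun v hv => hv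
  | succ r ih =>
    exact fun v hv => N.add_mem hv (h a le_rfl (by omega) _
      (ih (a + 1) (fun i h1 h2 => h i (by omega) (by omega)) v hv))

theorem symmetrizer_apply_mem {T : ℕ → Module.End k V} {N : Submodule k V} (a r : ℕ)
    (h : ∀ i, a ≤ i → i + 1 < a + r → ∀ v ∈ N, T i v ∈ N) :
    ∀ v ∈ N, symmetrizer T a r v ∈ N := by
  induction r generalizing a with
  | zero => exact fun v hv => hv
  | succ r ih =>
    exact fun v hv => ih (a + 1) (fun i h1 h2 => h i (by omega) (by omega)) _
      (ascSum_apply_mem a r (fun i h1 h2 => h i h1 (by omega)) v hv)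

theorem shuffleSum_apply_mem {T Y : ℕ → Module.End k V} {q : k} {N : Submodule k V} {n : ℕ}
    (hN : ∀ i, i + 1 < n → ∀ v ∈ N, T i v ∈ N) (hY : ∀ r, r ≤ n → ∀ v, Y r v ∈ N) (m r : ℕ)
    (hn : m + r ≤ n) (v : V) : shuffleSum T q Y m r v ∈ N := by
  induction m generalizing r v with
  | zero => exact hY r (by omega) v
  | succ m ih =>
    exact N.add_mem (N.smul_mem _ (ascProd_apply_mem m r (fun i h1 h2 => hN i (by omega)) _
      (ih r (by omega) _))) (N.smul_mem _ (ih (r + 1) (by omega) v))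

/-- On N the recursion closes up. By `mul_ascProd_mul_descProd` the conjugated term is a symmetrizer
minus (1 - q) times the next larger one, and the second term of the recursion restores the
difference. For r = 0 what remains is [m+1]_q = 1 + q [m]_q. -/
theorem shuffleSum_apply {T Y : ℕ → Module.End k V} {q : k} (hq : q ≠ 0) {N : Submodule k V}
    {n : ℕ} (hT : IsHeckeSystem n q T) (hN : ∀ i, i + 1 < n → ∀ v ∈ N, T i v ∈ N)
    (hY0 : Y 0 = 0) (hY : ∀ r, r + 1 ≤ n → ∀ v ∈ N, Y (r + 1) v = symmetrizer T 0 (r + 1) v)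
    (m r : ℕ) (hn : m + r ≤ n) (v : V) (hv : v ∈ N) :
    shuffleSum T q Y m r v = if r = 0 then qNum q m • v else symmetrizer T m r v := by
  induction m generalizing r v with
  | zero =>
    cases r with
    | zero => simp [shuffleSum, hY0, qNum]
    | succ r => simpa [shuffleSum] using hY r (by omega) v hv
  | succ m ih =>
    cases r with
    | zero =>
      have h1 := ih 0 (by omega) v hv
      have h2 := ih 1 (by omega) v hv
      simp only [shuffleSum, ascProd, descProd, LinearMap.add_apply, LinearMap.smul_apply,
        one_mul, mul_one, if_true, pow_zero, one_smul, zero_add, h2, h1, qNum_succ,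
        symmetrizer, ascSum, if_neg one_ne_zero, Module.End.one_apply]
      module
    | succ r =>
      have hd := descProd_apply_mem (T := T) (N := N) m (r + 1)
        (fun i h1 h2 => hN i (by omega)) v hv
      have h1 := ih (r + 1) (by omega) _ hd
      have h2 := ih (r + 1 + 1) (by omega) v hv
      rw [if_neg (Nat.succ_ne_zero _)] at h1 h2
      have h3 := mul_symmetrizer_shift (T := T) (c := ascProd T m (r + 1)) m (r + 1)
        (fun j h4 h5 => hT.gen_succ_mul_ascProd (r + 1) m (by omega) j h4 h5)
      have h4 := hT.mul_ascProd_mul_descProd (x := symmetrizer T (m + 1) (r + 1)) m (r + 1)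
        (by omega) (fun j h4 h5 => hT.symmetrizer_mul_gen (m + 1) (r + 1) (by omega) j h4
          (by omega))
      have h5 : (q * q⁻¹ ^ (r + 1)) • (symmetrizer T (m + 1) (r + 1) *
          (ascProd T m (r + 1) * descProd T m (r + 1))) =
          symmetrizer T (m + 1) (r + 1) - (1 - q) • symmetrizer T m (r + 1 + 1) := by
        rw [mul_comm, mul_smul, h4, smul_smul, ← mul_pow, inv_mul_cancel₀ hq, one_pow, one_smul]
        rfl
      have h6 := LinearMap.congr_fun h5 v
      have h7 := LinearMap.congr_fun h3 (descProd T m (r + 1) v)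
      simp only [LinearMap.smul_apply, LinearMap.sub_apply, Module.End.mul_apply] at h6 h7
      simp only [shuffleSum, LinearMap.add_apply, LinearMap.smul_apply, Module.End.mul_apply,
        if_neg (Nat.succ_ne_zero _), h1, h2, h7, h6]
      module

/-- A subspace that is stable under the generators of a Hecke algebra with `[n]_q! ≠ 0` has an
equivariant projection. -/
theorem IsHeckeSystem.exists_projection {q : k} (hq : q ≠ 0) {N : Submodule k V} (n : ℕ)
    (hn : ∀ m, m < n → qNum q (m + 1) ≠ 0) (T : ℕ → Module.End k V) (hT : IsHeckeSystem n q T)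
    (hN : ∀ i, i + 1 < n → ∀ v ∈ N, T i v ∈ N) :
    ∃ P : Module.End k V, (∀ v, P v ∈ N) ∧ (∀ v ∈ N, P v = v) ∧
      ∀ i, i + 1 < n → Commute (T i) P := by
  induction n generalizing T with
  | zero =>
    obtain ⟨f, hf⟩ := N.exists_isCompl
    obtain ⟨P, hP⟩ := N.subtype.exists_leftInverse_of_injective N.ker_subtype
    exact ⟨N.subtype ∘ₗ P, fun v => (P v).2, fun v hv => congrArg Subtype.val
      (LinearMap.congr_fun hP ⟨v, hv⟩), fun i hi => absurd hi (by omega)⟩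
  | succ n ih =>
    -- The induction hypothesis is applied to the generators `T 1, T 2, ...`, so `p` need not
    -- commute with `T 0`.
    obtain ⟨p, p_mem, p_apply, p_comm⟩ := ih (fun m hm => hn m (by omega)) _ hT.shift
      fun i hi => hN (i + 1) (by omega)
    have hfac : ∀ r, r ≤ n + 1 → qFac q r ≠ 0 := fun r hr =>
      Finset.prod_ne_zero_iff.mpr fun i hi => hn i (by have := Finset.mem_range.mp hi; omega)
    -- Symmetrizing `p` over the first r strands makes it commute with their generators while
    -- keeping those with index at least r. On N the product of symmetrizers is [r]_q! times one of
    -- them, which explains the normalization. The value `Y 0 = 0` fits both [0]_q = 0 and the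
    -- demand that `Y 0` commute with every generator.
    let Y : ℕ → Module.End k V := fun r => if r = 0 then 0 else
      (qFac q r)⁻¹ • (symmetrizer' T 0 r * p * symmetrizer T 0 r)
    have heq : ∀ r, r ≤ n + 1 → symmetrizer' T 0 r = symmetrizer T 0 r := fun r hr =>
      smul_right_injective _ (hfac r hr) (hT.smul_symmetrizer'_eq 0 r (by omega))
    have hY1 : ∀ r i, r ≤ i → i + 1 < n + 1 → Commute (T i) (Y r) := by
      intro r i h1 h2
      by_cases h0 : r = 0
      · simp [Y, h0]
      · have hc : Commute (T i) (symmetrizer T 0 r) := commute_symmetrizer _ _ fun j h3 h4 =>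
          hT.commute h2 (by omega) (by omega)
        obtain ⟨i, rfl⟩ : ∃ j, i = j + 1 := ⟨i - 1, by omega⟩
        simp only [Y, if_neg h0, heq r (by omega)]
        exact ((hc.mul_right (p_comm i (by omega))).mul_right hc).smul_right _
    have hY2 : ∀ r i, i + 1 < r → r ≤ n + 1 → Commute (T i) (Y r) := by
      intro r i h1 h2
      have e1 := hT.gen_mul_symmetrizer' 0 r (by omega) i (by omega) (by omega)
      have e2 := hT.symmetrizer_mul_gen 0 r (by omega) i (by omega) (by omega)
      simp only [Y, if_neg (show r ≠ 0 by omega)]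
      refine Commute.smul_right ?_ _
      rw [Commute, SemiconjBy, ← mul_assoc, ← mul_assoc, e1, mul_assoc _ _ (T i), e2]
      simp only [smul_mul_assoc, mul_smul_comm]
    have hY3 : ∀ r, r + 1 ≤ n + 1 → ∀ v ∈ N, Y (r + 1) v = symmetrizer T 0 (r + 1) v := by
      intro r hr v hv
      have h1 := symmetrizer_apply_mem (T := T) (N := N) 0 (r + 1)
        (fun i _ h2 => hN i (by omega)) v hv
      have h2 := hT.symmetrizer'_mul_symmetrizer 0 (r + 1) (by omega) (hfac (r + 1) hr)
      have h3 := LinearMap.congr_fun h2 v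
      simp only [Module.End.mul_apply, LinearMap.smul_apply] at h3
      simp only [Y, if_neg (Nat.succ_ne_zero r), LinearMap.smul_apply, Module.End.mul_apply,
        p_apply _ h1, h3, smul_smul, inv_mul_cancel₀ (hfac (r + 1) hr), one_smul]
    have hY4 : ∀ r, r ≤ n + 1 → ∀ v, Y r v ∈ N := by
      intro r hr v
      by_cases h0 : r = 0
      · simp [Y, h0]
      · simp only [Y, if_neg h0, heq r hr]
        exact N.smul_mem _ (symmetrizer_apply_mem (T := T) (N := N) 0 r
          (fun i _ h2 => hN i (by omega)) _ (p_mem _))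
    -- With all strands in the first block, the shuffle sum commutes with every generator and is
    -- multiplication by [n+1]_q on N.
    refine ⟨(qNum q (n + 1))⁻¹ • shuffleSum T q Y (n + 1) 0, fun v => N.smul_mem _
      (shuffleSum_apply_mem hN hY4 (n + 1) 0 le_rfl v), fun v hv => ?_, fun i hi =>
      Commute.smul_right (commute_shuffleSum_of_lt hT hq hY1 hY2 (n + 1) 0 i hi le_rfl) _⟩
    rw [LinearMap.smul_apply, shuffleSum_apply hq hT hN (by simp [Y]) hY3 (n + 1) 0 le_rfl v hv,
      if_pos rfl, smul_smul, inv_mul_cancel₀ (hn n (by omega)), one_smul]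

end Maschke


/-! ### Elements satisfying the relations of the mirabolic Hecke algebra -/

section System

/-- Elements `T i` and idempotents `E l` satisfying the relations of the mirabolic Hecke algebra,
where `E 0` plays the role of the unit element. -/
structure IsMirabolicSystem {k R : Type*} [CommRing k] [Ring R] [Algebra k R] (n : ℕ) (q : k)
    (T E : ℕ → R) : Prop where
  E_mul : ∀ l m, l ≤ m → m ≤ n → E l * E m = E m
  mul_E : ∀ l m, l ≤ m → m ≤ n → E m * E l = E m
  E_zero_mul : ∀ i, i + 1 < n → E 0 * T i = T i
  comm_E : ∀ i l, i + 1 < n → l ≤ n → l ≠ i + 1 → Commute (T i) (E l)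
  quad : ∀ i, i + 1 < n → T i * T i = (q - 1) • T i + q • E 0
  braid : ∀ i, i + 2 < n → T i * T (i + 1) * T i = T (i + 1) * T i * T (i + 1)
  comm : ∀ i j, i + 1 < j → j + 1 < n → T i * T j = T j * T i
  E_mul_T_mul_E : ∀ i, i + 1 < n → E (i + 1) * T i * E (i + 1) = T i * E (i + 2)
  add_mul_E_mul_add : ∀ i, i + 1 < n → (E 0 + T i) * E (i + 1) * (E 0 + T i) =
    (E i + q • E (i + 2)) * (E 0 + T i)

/-- The projection `E j - E (j + 1)`. -/
def gap {R : Type*} [Ring R] (E : ℕ → R) (j : ℕ) : R := E j - E (j + 1)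

/-- The element `gap E j * T (j - 1) * gap E (j - 1) * ... * T 0 * gap E 0`. -/
def raise {R : Type*} [Ring R] (T E : ℕ → R) : ℕ → R
  | 0 => gap E 0
  | j + 1 => gap E (j + 1) * T j * raise T E j

/-- The element `gap E 0 * T 0 * ... * gap E (j - 1) * T (j - 1) * gap E j`. -/
def lower {R : Type*} [Ring R] (T E : ℕ → R) : ℕ → R
  | 0 => gap E 0
  | j + 1 => lower T E j * T j * gap E (j + 1)

theorem unop_gap_op {R : Type*} [Ring R] (E : ℕ → R) (j : ℕ) :
    (gap (fun i => MulOpposite.op (E i)) j).unop = gap E j := rfl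

theorem unop_raise_op {R : Type*} [Ring R] (T E : ℕ → R) (j : ℕ) :
    (raise (fun i => MulOpposite.op (T i)) (fun i => MulOpposite.op (E i)) j).unop =
      lower T E j := by
  induction j with
  | zero => rfl
  | succ j ih =>
    rw [raise, lower, MulOpposite.unop_mul, MulOpposite.unop_mul, ih, MulOpposite.unop_op,
      unop_gap_op, mul_assoc]

theorem exists_raise_eq {R : Type*} [Ring R] (T E : ℕ → R) (l j : ℕ) (h : l ≤ j) :
    (l = j) ∨ ∃ x, raise T E j = x * raise T E l := by
  induction j with
  | zero => left; omega
  | succ j ih =>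
    rcases h.eq_or_lt with rfl | h
    · exact Or.inl rfl
    · right
      rcases ih (by omega) with rfl | ⟨x, hx⟩
      · exact ⟨_, rfl⟩
      · exact ⟨gap E (j + 1) * T j * x, by rw [raise, hx, mul_assoc _ x]⟩

theorem commute_E_zero_add {R : Type*} [Ring R] {T E : ℕ → R} {i : ℕ} {x : R} (hx : Commute (T i) x)
    (h1 : E 0 * x = x) (h2 : x * E 0 = x) : Commute (E 0 + T i) x :=
  Commute.add_left (h1.trans h2.symm) hx

namespace IsMirabolicSystem

section CommRing

variable {k R : Type*} [CommRing k] [Ring R] [Algebra k R] {n : ℕ} {q : k} {T E : ℕ → R}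

theorem map {k' R' : Type*} [CommRing k'] [Ring R'] [Algebra k' R'] {q' : k'}
    (h : IsMirabolicSystem n q T E) (f : R →+* R') (hf : ∀ x, f (q • x) = q' • f x) :
    IsMirabolicSystem n q' (fun i => f (T i)) fun l => f (E l) where
  E_mul l m h1 h2 := by rw [← map_mul, h.E_mul l m h1 h2]
  mul_E l m h1 h2 := by rw [← map_mul, h.mul_E l m h1 h2]
  E_zero_mul i hi := by rw [← map_mul, h.E_zero_mul i hi]
  comm_E i l h1 h2 h3 := (h.comm_E i l h1 h2 h3).map f
  quad i hi := by
    rw [← map_mul, h.quad i hi, map_add, sub_smul, map_sub, hf, hf, one_smul, sub_smul, one_smul]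
  braid i hi := by simp only [← map_mul, h.braid i hi]
  comm i j h1 h2 := by simp only [← map_mul, h.comm i j h1 h2]
  E_mul_T_mul_E i hi := by simp only [← map_mul, h.E_mul_T_mul_E i hi]
  add_mul_E_mul_add i hi := by
    simp only [← map_mul, ← map_add, h.add_mul_E_mul_add i hi, ← hf]

/-- The two relations that look one-sided are self-opposite because their right-hand sides are
products of commuting factors. Statements about `raise` thereby yield statements about `lower`. -/
theorem op (h : IsMirabolicSystem n q T E) :
    IsMirabolicSystem n q (fun i => MulOpposite.op (T i)) fun l => MulOpposite.op (E l) where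
  E_mul l m h1 h2 := congrArg MulOpposite.op (h.mul_E l m h1 h2)
  mul_E l m h1 h2 := congrArg MulOpposite.op (h.E_mul l m h1 h2)
  E_zero_mul i hi := congrArg MulOpposite.op
    ((h.comm_E i 0 hi (by omega) (by omega)).eq.trans (h.E_zero_mul i hi))
  comm_E i l h1 h2 h3 := (h.comm_E i l h1 h2 h3).op
  quad i hi := congrArg MulOpposite.op (h.quad i hi)
  braid i hi := by
    simpa only [MulOpposite.op_mul, mul_assoc] using congrArg MulOpposite.op (h.braid i hi)
  comm i j h1 h2 := congrArg MulOpposite.op (h.comm i j h1 h2).symm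
  E_mul_T_mul_E i hi := by
    simpa only [MulOpposite.op_mul, mul_assoc] using congrArg MulOpposite.op
      ((h.E_mul_T_mul_E i hi).trans (h.comm_E i (i + 2) hi (by omega) (by omega)).eq)
  add_mul_E_mul_add i hi := by
    have h0 := h.add_mul_E_mul_add i hi
    have h1 := h.comm_E i i hi (by omega) (by omega)
    have h2 := h.comm_E i (i + 2) hi (by omega) (by omega)
    have h3 : Commute (E i + q • E (i + 2)) (E 0 + T i) := by
      refine Commute.add_right ?_ (h1.symm.add_left (h2.symm.smul_left q))
      refine Commute.add_left ?_ (Commute.smul_left ?_ q)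
      · exact (h.mul_E 0 i (by omega) (by omega)).trans (h.E_mul 0 i (by omega) (by omega)).symm
      · exact (h.mul_E 0 _ (by omega) (by omega)).trans (h.E_mul 0 _ (by omega) (by omega)).symm
    have := congrArg MulOpposite.op (h0.trans h3.eq)
    simpa only [MulOpposite.op_mul, mul_assoc, MulOpposite.op_add, MulOpposite.op_smul] using this

variable (h : IsMirabolicSystem n q T E)
include h

theorem mul_E_zero {i : ℕ} (hi : i + 1 < n) : T i * E 0 = T i :=
  (h.comm_E i 0 hi (by omega) (by omega)).eq.trans (h.E_zero_mul i hi)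

theorem commute {i j : ℕ} (hi : i + 1 < n) (hj : j + 1 < n)
    (hij : i + 1 < j ∨ j + 1 < i) : Commute (T i) (T j) := by
  rcases hij with h1 | h1
  · exact h.comm i j h1 hj
  · exact (h.comm j i h1 hi).symm

theorem gap_mul_self {j : ℕ} (hj : j < n) : gap E j * gap E j = gap E j := by
  simp only [gap, mul_sub, sub_mul, h.E_mul j j le_rfl hj.le, h.E_mul j (j + 1) (by omega) hj,
    h.mul_E j (j + 1) (by omega) hj, h.E_mul (j + 1) (j + 1) le_rfl hj]
  abel

theorem gap_mul_gap {i j : ℕ} (hi : i < n) (hj : j < n) (hij : i ≠ j) :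
    gap E i * gap E j = 0 := by
  rcases lt_or_gt_of_ne hij with h1 | h1
  · simp only [gap, mul_sub, sub_mul, h.E_mul i j (by omega) (by omega),
      h.E_mul i (j + 1) (by omega) (by omega), h.E_mul (i + 1) j (by omega) (by omega),
      h.E_mul (i + 1) (j + 1) (by omega) (by omega)]
    abel
  · simp only [gap, mul_sub, sub_mul, h.mul_E j i (by omega) (by omega),
      h.mul_E j (i + 1) (by omega) (by omega), h.mul_E (j + 1) i (by omega) (by omega),
      h.mul_E (j + 1) (i + 1) (by omega) (by omega)]
    abel

theorem E_mul_gap {l j : ℕ} (hl : l ≤ n) (hj : j < n) :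
    E l * gap E j = if l ≤ j then gap E j else 0 := by
  split_ifs with h1
  · rw [gap, mul_sub, h.E_mul l j h1 hj.le, h.E_mul l (j + 1) (by omega) (by omega)]
  · rw [gap, mul_sub, h.mul_E j l (by omega) hl, h.mul_E (j + 1) l (by omega) hl, sub_self]

theorem gap_mul_E {l j : ℕ} (hl : l ≤ n) (hj : j < n) :
    gap E j * E l = if l ≤ j then gap E j else 0 := by
  split_ifs with h1
  · rw [gap, sub_mul, h.mul_E l j h1 hj.le, h.mul_E l (j + 1) (by omega) (by omega)]
  · rw [gap, sub_mul, h.E_mul j l (by omega) hl, h.E_mul (j + 1) l (by omega) hl, sub_self]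

theorem commute_gap {i j : ℕ} (hi : i + 1 < n) (hj : j < n) (h1 : j ≠ i) (h2 : j ≠ i + 1) :
    Commute (T i) (gap E j) :=
  (h.comm_E i j hi hj.le h2).sub_right (h.comm_E i (j + 1) hi hj (by omega))

theorem commute_gap_add_gap {i : ℕ} (hi : i + 1 < n) :
    Commute (T i) (gap E i + gap E (i + 1)) := by
  rw [gap, gap, sub_add_sub_cancel]
  exact (h.comm_E i i hi (by omega) (by omega)).sub_right
    (h.comm_E i (i + 2) hi (by omega) (by omega))

/-- All four terms of the expansion equal `T i * E (i + 2)`. -/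
theorem gap_T_gap {i : ℕ} (hi : i + 1 < n) : gap E (i + 1) * T i * gap E (i + 1) = 0 := by
  have h1 := h.comm_E i (i + 2) hi (by omega) (by omega)
  have e1 : E (i + 1) * T i * E (i + 2) = T i * E (i + 2) := by
    rw [mul_assoc, h1.eq, ← mul_assoc, h.E_mul (i + 1) (i + 2) (by omega) (by omega)]
  have e2 : E (i + 2) * T i * E (i + 1) = T i * E (i + 2) := by
    rw [← h1.eq, mul_assoc, h.mul_E (i + 1) (i + 2) (by omega) (by omega)]
  have e3 : E (i + 2) * T i * E (i + 2) = T i * E (i + 2) := by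
    rw [← h1.eq, mul_assoc, h.E_mul (i + 2) (i + 2) (by omega) (by omega)]
  simp only [gap, mul_sub, sub_mul, h.E_mul_T_mul_E i hi]
  rw [e1, e2, e3]
  abel

/-- `T i` commutes with `gap E i + gap E (i + 1)`, and its diagonal block at `gap E (i + 1)`
vanishes, so only the block towards `gap E i` is left. -/
theorem gap_succ_mul_T {i : ℕ} (hi : i + 1 < n) :
    gap E (i + 1) * T i * gap E i = gap E (i + 1) * T i := by
  have h1 : gap E (i + 1) * (gap E i + gap E (i + 1)) = gap E (i + 1) := by
    rw [mul_add, h.gap_mul_gap hi (by omega) (by omega), h.gap_mul_self hi, zero_add]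
  have h2 := (h.commute_gap_add_gap hi).eq
  calc _ = gap E (i + 1) * (T i * (gap E i + gap E (i + 1))) := by
        rw [mul_add, mul_add, ← mul_assoc, ← mul_assoc, h.gap_T_gap hi, add_zero]
    _ = _ := by rw [h2, ← mul_assoc, h1]

theorem T_mul_gap_succ {i : ℕ} (hi : i + 1 < n) :
    gap E i * (T i * gap E (i + 1)) = T i * gap E (i + 1) := by
  have := congrArg MulOpposite.unop (h.op.gap_succ_mul_T hi)
  simpa [unop_gap_op] using this

theorem gap_mul_T_add {i : ℕ} (hi : i + 1 < n) :
    gap E i * T i * gap E i + gap E i * T i * gap E (i + 1) = gap E i * T i := by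
  have h1 : gap E i * (gap E i + gap E (i + 1)) = gap E i := by
    rw [mul_add, h.gap_mul_gap (by omega) hi (by omega), h.gap_mul_self (by omega), add_zero]
  rw [← mul_add, mul_assoc, (h.commute_gap_add_gap hi).eq, ← mul_assoc, h1]

/-- The middle idempotent can be dropped; in the quadratic relation the linear term dies by
`gap_T_gap`. -/
theorem gap_succ_T_gap_T_gap_succ {i : ℕ} (hi : i + 1 < n) :
    gap E (i + 1) * T i * gap E i * T i * gap E (i + 1) = q • gap E (i + 1) := by
  rw [h.gap_succ_mul_T hi, mul_assoc _ (T i) (T i), h.quad i hi, mul_add, add_mul, mul_smul_comm,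
    smul_mul_assoc, h.gap_T_gap hi, smul_zero, zero_add, mul_smul_comm,
    h.gap_mul_E (by omega) hi, if_pos (by omega), smul_mul_assoc, h.gap_mul_self hi]

theorem E_zero_add_sq {i : ℕ} (hi : i + 1 < n) :
    (E 0 + T i) * (E 0 + T i) = (1 + q) • (E 0 + T i) := by
  simp only [mul_add, add_mul, h.quad i hi, h.E_zero_mul i hi, h.mul_E_zero hi,
    h.E_mul 0 0 le_rfl (by omega)]
  module

/-- Since (`E 0` + `T i`)² = (1 + q)(`E 0` + `T i`), subtracting the `E (i + 2)` part changes its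
coefficient from q to -1. -/
theorem add_gap_add {i : ℕ} (hi : i + 1 < n) :
    (E 0 + T i) * gap E (i + 1) * (E 0 + T i) =
      (gap E i + gap E (i + 1)) * (E 0 + T i) := by
  have h1 := commute_E_zero_add (h.comm_E i (i + 2) hi (by omega) (by omega))
    (h.E_mul 0 (i + 2) (by omega) (by omega)) (h.mul_E 0 (i + 2) (by omega) (by omega))
  have h2 : (E 0 + T i) * E (i + 2) * (E 0 + T i) = (1 + q) • (E (i + 2) * (E 0 + T i)) := by
    rw [h1.eq, mul_assoc, h.E_zero_add_sq hi, mul_smul_comm]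
  rw [gap, mul_sub, sub_mul, h.add_mul_E_mul_add i hi, h2, gap, sub_add_sub_cancel, sub_mul,
    add_mul, smul_mul_assoc]
  module

theorem gap_T_gap_succ_T_gap {i : ℕ} (hi : i + 1 < n) :
    gap E i * T i * gap E (i + 1) * T i * gap E i = gap E i + gap E i * T i * gap E i := by
  have h0 : gap E i * (E 0 + T i) * gap E (i + 1) = gap E i * T i * gap E (i + 1) := by
    rw [mul_add, add_mul, h.gap_mul_E (by omega) (by omega), if_pos (by omega),
      h.gap_mul_gap (by omega) hi (by omega), zero_add]
  have h0' : gap E (i + 1) * (E 0 + T i) * gap E i = gap E (i + 1) * T i * gap E i := by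
    rw [mul_add, add_mul, h.gap_mul_E (by omega) (by omega), if_pos (by omega),
      h.gap_mul_gap hi (by omega) (by omega), zero_add]
  have h1 := congrArg (fun x => gap E i * x * gap E i) (h.add_gap_add hi)
  have h2 : gap E i * (gap E i + gap E (i + 1)) = gap E i := by
    rw [mul_add, h.gap_mul_gap (by omega) hi (by omega), h.gap_mul_self (by omega), add_zero]
  calc _ = gap E i * T i * (gap E (i + 1) * gap E (i + 1)) * T i * gap E i := by
        rw [h.gap_mul_self hi]
    _ = gap E i * (E 0 + T i) * gap E (i + 1) * (gap E (i + 1) * (E 0 + T i) * gap E i) := by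
        rw [h0, h0']; simp only [mul_assoc]
    _ = gap E i * ((E 0 + T i) * (gap E (i + 1) * gap E (i + 1)) * (E 0 + T i)) * gap E i := by
        simp only [mul_assoc]
    _ = gap E i * ((gap E i + gap E (i + 1)) * (E 0 + T i)) * gap E i := by
        rw [h.gap_mul_self hi]; exact h1
    _ = _ := by
        rw [← mul_assoc, h2, mul_add, add_mul, h.gap_mul_E (by omega) (by omega),
          if_pos (by omega), h.gap_mul_self (by omega)]

/-- The sum of the two gaps commutes with `E 0 + T i` and contributes the factor 1 + q; taking away
`add_gap_add` leaves q for `gap E i` alone. -/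
theorem gap_T_gap_mul_add {i : ℕ} (hi : i + 1 < n) :
    gap E i * T i * gap E i * (E 0 + T i) = (q - 1) • (gap E i * (E 0 + T i)) := by
  have h1 : (E 0 + T i) * (gap E i + gap E (i + 1)) * (E 0 + T i) =
      (1 + q) • ((gap E i + gap E (i + 1)) * (E 0 + T i)) := by
    have e1 : E 0 * (gap E i + gap E (i + 1)) = gap E i + gap E (i + 1) := by
      simp [mul_add, h.E_mul_gap (l := 0) (j := i) (by omega) (by omega),
        h.E_mul_gap (l := 0) (j := i + 1) (by omega) (by omega)]
    have e2 : (gap E i + gap E (i + 1)) * E 0 = gap E i + gap E (i + 1) := by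
      simp [add_mul, h.gap_mul_E (l := 0) (j := i) (by omega) (by omega),
        h.gap_mul_E (l := 0) (j := i + 1) (by omega) (by omega)]
    rw [(commute_E_zero_add (h.commute_gap_add_gap hi) e1 e2).eq, mul_assoc,
      h.E_zero_add_sq hi, mul_smul_comm]
  have h2 : (E 0 + T i) * gap E i * (E 0 + T i) =
      q • ((gap E i + gap E (i + 1)) * (E 0 + T i)) := by
    rw [mul_add (E 0 + T i), add_mul ((E 0 + T i) * gap E i), h.add_gap_add hi] at h1
    rw [← eq_sub_iff_add_eq] at h1
    rw [h1]; module
  have h3 := congrArg (fun x => gap E i * x) h2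
  have h4 : gap E i * (gap E i + gap E (i + 1)) = gap E i := by
    rw [mul_add, h.gap_mul_gap (by omega) hi (by omega), h.gap_mul_self (by omega), add_zero]
  have h5 : gap E i * ((E 0 + T i) * gap E i * (E 0 + T i)) =
      gap E i * (E 0 + T i) + gap E i * T i * gap E i * (E 0 + T i) := by
    have : gap E i * (E 0 + T i) * gap E i = gap E i + gap E i * T i * gap E i := by
      rw [mul_add, add_mul, h.gap_mul_E (by omega) (by omega), if_pos (by omega),
        h.gap_mul_self (by omega)]
    rw [← mul_assoc, ← mul_assoc, this, add_mul]
  simp only [h5, mul_smul_comm, ← mul_assoc, h4] at h3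
  rw [← eq_sub_iff_add_eq'] at h3
  rw [h3]; module

/-! #### The elements `raise` and `lower` -/

theorem gap_mul_raise {j : ℕ} (hj : j < n) : gap E j * raise T E j = raise T E j := by
  cases j with
  | zero => exact h.gap_mul_self hj
  | succ j => rw [raise, ← mul_assoc, ← mul_assoc, h.gap_mul_self hj]

theorem raise_mul_gap_zero {j : ℕ} (hj : j < n) : raise T E j * gap E 0 = raise T E j := by
  induction j with
  | zero => exact h.gap_mul_self hj
  | succ j ih => rw [raise, mul_assoc, ih (by omega)]

theorem lower_mul_gap {j : ℕ} (hj : j < n) : lower T E j * gap E j = lower T E j := by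
  have := congrArg MulOpposite.unop (h.op.gap_mul_raise hj)
  simpa [unop_raise_op, unop_gap_op] using this

theorem gap_zero_mul_lower {j : ℕ} (hj : j < n) : gap E 0 * lower T E j = lower T E j := by
  have := congrArg MulOpposite.unop (h.op.raise_mul_gap_zero hj)
  simpa [unop_raise_op, unop_gap_op] using this

/-- With its counterpart `cornerE`, this makes `gap E j` equivalent to a subidempotent of `gap E 0`:
`raise` and `lower` are mutually inverse up to q^j. -/
theorem raise_mul_lower {j : ℕ} (hj : j < n) :
    raise T E j * lower T E j = q ^ j • gap E j := by
  induction j with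
  | zero => simpa [raise, lower] using h.gap_mul_self hj
  | succ j ih =>
    have := ih (by omega)
    calc _ = gap E (j + 1) * T j * (raise T E j * lower T E j) * T j * gap E (j + 1) := by
          simp only [raise, lower, mul_assoc]
      _ = q ^ j • (gap E (j + 1) * T j * gap E j * T j * gap E (j + 1)) := by
          rw [this]; simp only [mul_smul_comm, smul_mul_assoc]
      _ = _ := by rw [h.gap_succ_T_gap_T_gap_succ hj, smul_smul, pow_succ]

theorem commute_raise {i j : ℕ} (hi : i + 1 < n) (hij : j < i) :
    Commute (T i) (raise T E j) := by
  induction j with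
  | zero => exact h.commute_gap hi (by omega) (by omega) (by omega)
  | succ j ih =>
    exact ((h.commute_gap hi (by omega) (by omega) (by omega)).mul_right
      (h.commute hi (by omega) (by omega))).mul_right (ih (by omega))

theorem commute_lower {i j : ℕ} (hi : i + 1 < n) (hij : j < i) :
    Commute (T i) (lower T E j) := by
  have := congrArg MulOpposite.unop (h.op.commute_raise hi hij).eq
  exact (by simpa [unop_raise_op] using this.symm : T i * lower T E j = lower T E j * T i)

/-- `raise` behaves like the braid that moves the first strand to place j: the strands it passes are
renumbered. The case j = i + 2 is the braid relation, once the inner `gap` has been dropped by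
`gap_succ_mul_T`. -/
theorem T_mul_raise {i j : ℕ} (hij : i + 1 < j) (hj : j < n) :
    T i * raise T E j = raise T E j * T (i + 1) := by
  induction j with
  | zero => omega
  | succ j ih =>
    rcases (Nat.lt_succ_iff.mp hij).lt_or_eq with h1 | rfl
    · have c1 := h.commute_gap (i := i) (j := j + 1) (by omega) hj (by omega) (by omega)
      have c2 := h.commute (i := i) (j := j) (by omega) (by omega) (by omega)
      rw [raise, ← mul_assoc, ← mul_assoc, c1.eq, mul_assoc _ (T i), c2.eq, ← mul_assoc,
        mul_assoc _ (T i), ih h1 (by omega), ← mul_assoc]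
    · have c1 := h.commute_gap (i := i) (j := i + 1 + 1) (by omega) hj (by omega) (by omega)
      have c2 := h.commute_raise (i := i + 1) (j := i) (by omega) (by omega)
      calc _ = T i * gap E (i + 1 + 1) * T (i + 1) * gap E (i + 1) * T i * raise T E i := by
            simp only [raise, mul_assoc]
        _ = gap E (i + 1 + 1) * (T i * T (i + 1) * T i) * raise T E i := by
            rw [mul_assoc (T i), mul_assoc (T i), h.gap_succ_mul_T (i := i + 1) hj, ← mul_assoc,
              c1.eq]
            simp only [mul_assoc]
        _ = gap E (i + 1 + 1) * T (i + 1) * gap E (i + 1) * T i * (T (i + 1) * raise T E i) := by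
            rw [h.braid i (by omega), h.gap_succ_mul_T (i := i + 1) hj]
            simp only [mul_assoc]
        _ = _ := by rw [c2.eq]; simp only [raise, mul_assoc]

theorem T_mul_raise_self {i : ℕ} (hi : i + 1 < n) :
    T i * raise T E i = raise T E (i + 1) + gap E i * T i * raise T E i := by
  have h1 : (gap E i + gap E (i + 1)) * raise T E i = raise T E i := by
    nth_rewrite 1 [← h.gap_mul_raise (j := i) (by omega)]
    rw [← mul_assoc, add_mul, h.gap_mul_self (by omega), h.gap_mul_gap hi (by omega) (by omega),
      add_zero, h.gap_mul_raise (by omega)]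
  have h2 := (h.commute_gap_add_gap hi).eq
  calc _ = (gap E i + gap E (i + 1)) * T i * raise T E i := by
        rw [← h2, mul_assoc, h1]
    _ = _ := by rw [add_mul, add_mul, raise, add_comm]

theorem T_mul_raise_succ {i : ℕ} (hi : i + 1 < n) :
    T i * raise T E (i + 1) = raise T E i + gap E i * T i * raise T E i := by
  have h1 := h.gap_mul_raise (j := i) (by omega)
  calc _ = gap E i * (T i * gap E (i + 1)) * T i * (gap E i * raise T E i) := by
        rw [h.T_mul_gap_succ hi, h1, raise]; simp only [mul_assoc]
    _ = (gap E i * T i * gap E (i + 1) * T i * gap E i) * raise T E i := by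
        simp only [mul_assoc]
    _ = _ := by
        rw [h.gap_T_gap_succ_T_gap hi, add_mul, mul_assoc _ (gap E i) (raise T E i), h1]

/-- This expresses each corner idempotent through the previous one and a single `T i`, which drives
all computations in the corner. -/
theorem lower_succ_mul_raise_succ {i : ℕ} (hi : i + 1 < n) :
    lower T E (i + 1) * raise T E (i + 1) =
      lower T E i * raise T E i + lower T E i * T i * raise T E i := by
  have h1 := h.lower_mul_gap (j := i) (by omega)
  calc _ = lower T E i * (T i * (gap E (i + 1) * gap E (i + 1) * T i * raise T E i)) := by
        simp only [raise, lower, mul_assoc]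
    _ = lower T E i * (T i * raise T E (i + 1)) := by rw [h.gap_mul_self hi, raise]
    _ = _ := by
      rw [h.T_mul_raise_succ hi, mul_add, mul_assoc (gap E i), ← mul_assoc _ (gap E i), h1,
        mul_assoc]

theorem commute_lower_mul_raise {i l : ℕ} (hi : i + 2 < n) (hl : l < n) (hil : l ≠ i + 1) :
    Commute (T (i + 1)) (lower T E l * raise T E l) := by
  rcases lt_or_gt_of_ne hil with h1 | h1
  · exact (h.commute_lower hi h1).mul_right (h.commute_raise hi h1)
  · have e1 := h.T_mul_raise h1 hl
    have e2 : lower T E l * T i = T (i + 1) * lower T E l := by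
      have := congrArg MulOpposite.unop (h.op.T_mul_raise h1 hl)
      simpa [unop_raise_op] using this
    rw [Commute, SemiconjBy, ← mul_assoc, ← e2, mul_assoc, e1, mul_assoc]

end CommRing

end IsMirabolicSystem

end System


/-! ### The corner of a mirabolic system and equivariant projections -/

section Corner

variable {k : Type*} [Field k]

namespace IsMirabolicSystem

/-- The idempotents of the system in the corner of `gap E 0`. -/
def cornerE {R : Type*} [Ring R] [Algebra k R] (q : k) (T E : ℕ → R) (l : ℕ) : R :=
  q⁻¹ ^ l • (lower T E l * raise T E l)

section Ring

variable {R : Type*} [Ring R] [Algebra k R] {n : ℕ} {q : k} {T E : ℕ → R}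
variable (h : IsMirabolicSystem n q T E) (hq : q ≠ 0)
include h hq

theorem raise_mul_cornerE {l j : ℕ} (hlj : l ≤ j) (hj : j < n) :
    raise T E j * cornerE q T E l = raise T E j := by
  have h1 : raise T E l * (lower T E l * raise T E l) = q ^ l • raise T E l := by
    rw [← mul_assoc, h.raise_mul_lower (by omega), smul_mul_assoc, h.gap_mul_raise (by omega)]
  rcases exists_raise_eq T E l j hlj with rfl | ⟨x, hx⟩
  · rw [cornerE, mul_smul_comm, h1, smul_smul, ← mul_pow, inv_mul_cancel₀ hq, one_pow, one_smul]
  · rw [hx, mul_assoc, cornerE, mul_smul_comm, h1, smul_smul, ← mul_pow, inv_mul_cancel₀ hq,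
      one_pow, one_smul]

omit h hq in
theorem unop_cornerE_op (l : ℕ) :
    (cornerE q (fun i => MulOpposite.op (T i)) (fun i => MulOpposite.op (E i)) l).unop =
      cornerE q T E l := by
  have h1 := unop_raise_op T E l
  have h2 := unop_raise_op (fun i => MulOpposite.op (T i)) (fun i => MulOpposite.op (E i)) l
  have h3 : (lower (fun i => MulOpposite.op (T i)) (fun i => MulOpposite.op (E i)) l).unop =
      raise T E l := by
    clear h1 h2
    induction l with
    | zero => rfl
    | succ l ih => rw [raise, lower, MulOpposite.unop_mul, MulOpposite.unop_mul, ih,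
        MulOpposite.unop_op, unop_gap_op, mul_assoc]
  rw [cornerE, cornerE, MulOpposite.unop_smul, MulOpposite.unop_mul, h1, h3]

theorem cornerE_mul_lower {l j : ℕ} (hlj : l ≤ j) (hj : j < n) :
    cornerE q T E l * lower T E j = lower T E j := by
  have := congrArg MulOpposite.unop (h.op.raise_mul_cornerE hq hlj hj)
  simpa [unop_raise_op, unop_cornerE_op] using this

omit hq in
theorem cornerE_zero (hn : 0 < n) : cornerE q T E 0 = gap E 0 := by
  simp [cornerE, raise, lower, h.gap_mul_self hn]

/-- The recursion `lower_succ_mul_raise_succ`, solved for its last term: the diagonal block of `T i`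
at `gap E i` becomes right multiplication by corner idempotents. -/
theorem gap_T_raise {i : ℕ} (hi : i + 1 < n) : gap E i * T i * raise T E i =
    raise T E i * (q • cornerE q T E (i + 1) - cornerE q T E i) := by
  have h1 := h.lower_succ_mul_raise_succ hi
  have h2 : q ^ i • (raise T E i * (q • cornerE q T E (i + 1))) =
      raise T E i * (lower T E (i + 1) * raise T E (i + 1)) := by
    rw [cornerE, smul_smul, mul_smul_comm, smul_smul, ← mul_assoc, ← pow_succ, ← mul_pow,
      mul_inv_cancel₀ hq, one_pow, one_smul]
  have h3 : raise T E i * (lower T E (i + 1) * raise T E (i + 1)) =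
      q ^ i • (raise T E i + gap E i * T i * raise T E i) := by
    rw [h1, mul_add, mul_assoc (lower T E i), ← mul_assoc, ← mul_assoc (raise T E i),
      h.raise_mul_lower (by omega), smul_mul_assoc, smul_mul_assoc, h.gap_mul_raise (by omega),
      smul_add, mul_assoc]
  have h4 := smul_right_injective R (pow_ne_zero i hq) (h2.trans h3)
  rw [mul_sub, h4, h.raise_mul_cornerE hq le_rfl (by omega)]
  abel

omit h hq in
-- This is the last mirabolic relation for the corner, before normalization. Two steps of the
-- recursion put every term in the form `lower T E i` · word · `raise T E i`, and 1 + `T (i + 1)`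
-- commutes with both ends.
theorem add_lower_mul_raise_add {n : ℕ} (h : IsMirabolicSystem (n + 1) q T E) {i : ℕ}
    (hi : i + 1 < n) :
    (1 + T (i + 1)) * (lower T E (i + 1) * raise T E (i + 1)) * (1 + T (i + 1)) =
      (q • (lower T E i * raise T E i) + lower T E (i + 2) * raise T E (i + 2)) *
        (1 + T (i + 1)) := by
  have cA : Commute (1 + T (i + 1)) (raise T E i) :=
    (Commute.one_left _).add_left (h.commute_raise (by omega) (by omega))
  have cB : Commute (1 + T (i + 1)) (lower T E i) :=
    (Commute.one_left _).add_left (h.commute_lower (by omega) (by omega))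
  have e1 := h.lower_succ_mul_raise_succ (i := i) (by omega)
  have e2 := h.lower_succ_mul_raise_succ (i := i + 1) (by omega)
  have hA := h.gap_mul_raise (j := i) (by omega)
  have hB := h.lower_mul_gap (j := i) (by omega)
  have hE : ∀ j, j < n + 1 → gap E j * E 0 = gap E j := fun j hj => by
    rw [h.gap_mul_E (by omega) hj, if_pos (by omega)]
  have hBE : lower T E i * E 0 = lower T E i := by rw [← hB, mul_assoc, hE i (by omega)]
  have hgSA : gap E (i + 1 + 1) * T i * raise T E i = 0 := by
    rw [← (h.commute_gap (i := i) (j := i + 1 + 1) (by omega) (by omega) (by omega)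
      (by omega)).eq, ← hA, mul_assoc, ← mul_assoc (gap E (i + 1 + 1)),
      h.gap_mul_gap (by omega) (by omega) (by omega), zero_mul, mul_zero]
  have hTf : gap E (i + 1) * T (i + 1) * gap E (i + 1) * T i * raise T E i =
      gap E (i + 1) * T (i + 1) * T i * raise T E i := by
    have h1 := h.gap_mul_T_add (i := i + 1) (by omega)
    have h2 : gap E (i + 1) * T (i + 1) * gap E (i + 1 + 1) * T i * raise T E i = 0 := by
      rw [mul_assoc _ _ (T i), mul_assoc _ _ (raise T E i), hgSA, mul_zero]
    rw [← add_zero (_ * raise T E i), ← h2, ← add_mul, ← add_mul, h1]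
  have hSf : lower T E i * T i * gap E (i + 1) =
      lower T E i * T i - lower T E i * T i * gap E i := by
    have := congrArg (fun x => lower T E i * x) (h.gap_mul_T_add (i := i) (by omega))
    simp only [mul_add, ← mul_assoc, hB] at this
    exact eq_sub_of_add_eq' this
  have e3 : lower T E (i + 1) * T (i + 1) * raise T E (i + 1) =
      lower T E i * T i * T (i + 1) * T i * raise T E i -
        lower T E i * T i * gap E i * T (i + 1) * T i * raise T E i := by
    calc _ = lower T E i * T i * (gap E (i + 1) * T (i + 1) * gap E (i + 1) * T i *
          raise T E i) := by simp only [raise, lower, mul_assoc]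
      _ = lower T E i * T i * gap E (i + 1) * (T (i + 1) * T i * raise T E i) := by
          rw [hTf]; simp only [mul_assoc]
      _ = _ := by rw [hSf, sub_mul]; simp only [mul_assoc]
  -- What remains is to reduce words in `T i` and `T (i + 1)` that end in 1 + `T (i + 1)`: `f1` and
  -- `f2` use the quadratic and braid relations, `f3` also uses `gap_T_gap_mul_add`.
  have f1 : lower T E i * ((1 + T (i + 1)) * (1 + T (i + 1))) =
      (1 + q) • (lower T E i * (1 + T (i + 1))) := by
    simp only [mul_add, add_mul, mul_one, one_mul, h.quad (i + 1) (by omega), mul_smul_comm, hBE]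
    module
  have f2 : T i * T (i + 1) * T i * (1 + T (i + 1)) =
      q • (T (i + 1) * T i * (1 + T (i + 1))) := by
    have h2 : T i * E 0 = T i := h.mul_E_zero (by omega)
    rw [h.braid i (by omega)]
    simp only [mul_add, mul_one, mul_assoc, h.quad (i + 1) (by omega), mul_smul_comm, h2]
    module
  have f3 : lower T E i * T i * gap E i * T (i + 1) * T i * (1 + T (i + 1)) =
      (q - 1) • (lower T E i * T (i + 1) * T i * (1 + T (i + 1))) := by
    have g1 : T (i + 1) * T i * (1 + T (i + 1)) = (1 + T i) * T (i + 1) * T i := by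
      rw [mul_add, add_mul, add_mul, ← h.braid i (by omega)]
      simp only [mul_one, one_mul]
    have g2 : lower T E i * T i * gap E i * (1 + T i) =
        (q - 1) • (lower T E i * (1 + T i)) := by
      have := congrArg (fun x => lower T E i * x) (h.gap_T_gap_mul_add (i := i) (by omega))
      simp only [mul_add, ← mul_assoc, hB, mul_smul_comm, hBE] at this
      rw [mul_assoc _ (gap E i) (E 0), hE i (by omega)] at this
      simpa only [mul_add, mul_one] using this
    calc _ = lower T E i * T i * gap E i * (T (i + 1) * T i * (1 + T (i + 1))) := by
          simp only [mul_assoc]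
      _ = (lower T E i * T i * gap E i * (1 + T i)) * T (i + 1) * T i := by
          rw [g1]; simp only [mul_assoc]
      _ = (q - 1) • (lower T E i * ((1 + T i) * T (i + 1) * T i)) := by
          rw [g2]; simp only [smul_mul_assoc, mul_assoc]
      _ = _ := by rw [← g1]; simp only [mul_assoc]
  have f4 : (1 + T (i + 1)) * T i * (1 + T (i + 1)) =
      T i * (1 + T (i + 1)) + T (i + 1) * T i * (1 + T (i + 1)) := by
    rw [add_mul 1 (T (i + 1)), add_mul _ _ (1 + T (i + 1)), one_mul]
  rw [e2, e1, e3]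
  generalize 1 + T (i + 1) = u at *
  calc _ = u * lower T E i * (raise T E i * u) +
        u * lower T E i * (T i * (raise T E i * u)) := by
        simp only [mul_add, add_mul, mul_assoc]
    _ = lower T E i * (u * u) * raise T E i + lower T E i * (u * T i * u) * raise T E i := by
        rw [← cA.eq, cB.eq]; simp only [mul_assoc]
    _ = (1 + q) • (lower T E i * u * raise T E i) + lower T E i * T i * u * raise T E i +
        (lower T E i * (T (i + 1) * T i * u)) * raise T E i := by
        rw [f1, f4]
        simp only [mul_add, add_mul, smul_mul_assoc, mul_assoc, add_assoc]
    _ = (1 + q) • (lower T E i * u * raise T E i) +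
        lower T E i * T i * u * raise T E i +
        (lower T E i * (T i * T (i + 1) * T i * u)) * raise T E i -
        lower T E i * T i * gap E i * T (i + 1) * T i * u * raise T E i := by
        rw [f2, f3]
        simp only [mul_smul_comm, smul_mul_assoc, mul_assoc]
        module
    _ = _ := by
        simp only [add_mul, sub_mul, smul_mul_assoc, mul_assoc, ← cA.eq]
        module

omit h in
include hq in
/-- The elements `T (i + 1)` and `cornerE` are a mirabolic system with unit element `gap E 0`. -/
theorem corner {n : ℕ} (h : IsMirabolicSystem (n + 1) q T E) :
    IsMirabolicSystem n q (fun i => T (i + 1) * gap E 0) (cornerE q T E) := by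
  have cg : ∀ i, i + 1 < n → Commute (T (i + 1)) (gap E 0) := fun i hi =>
    h.commute_gap (by omega) (by omega) (by omega) (by omega)
  have gg := h.gap_mul_self (j := 0) (by omega)
  have e0 := h.cornerE_zero (by omega)
  have ge : ∀ l, l ≤ n → gap E 0 * cornerE q T E l = cornerE q T E l := fun l hl => by
    rw [cornerE, mul_smul_comm, ← mul_assoc, h.gap_zero_mul_lower (by omega)]
  have eg : ∀ l, l ≤ n → cornerE q T E l * gap E 0 = cornerE q T E l := fun l hl => by
    rw [cornerE, smul_mul_assoc, mul_assoc, h.raise_mul_gap_zero (by omega)]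
  have cE : ∀ i l, i + 1 < n → l ≤ n → l ≠ i + 1 →
      Commute (T (i + 1) * gap E 0) (cornerE q T E l) := fun i l h1 h2 h3 =>
    ((h.commute_lower_mul_raise (by omega) (by omega) h3).smul_right _).mul_left
      ((ge l h2).trans (eg l h2).symm)
  refine ⟨?_, ?_, ?_, cE, ?_, ?_, ?_, ?_, ?_⟩
  · intro l m h1 h2
    rw [cornerE.eq_1 q T E m, mul_smul_comm, ← mul_assoc, h.cornerE_mul_lower hq h1 (by omega)]
  · intro l m h1 h2
    rw [cornerE.eq_1 q T E m, smul_mul_assoc, mul_assoc, h.raise_mul_cornerE hq h1 (by omega)]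
  · intro i hi
    rw [e0, (cg i hi).eq, ← mul_assoc, gg]
  · intro i hi
    have := h.quad (i + 1) (by omega)
    rw [e0, mul_assoc, ← mul_assoc (gap E 0), ← (cg i hi).eq, mul_assoc, gg, ← mul_assoc, this,
      add_mul, smul_mul_assoc, smul_mul_assoc, h.E_mul_gap (by omega) (by omega),
      if_pos (by omega)]
  · intro i hi
    have c1 := (cg i (by omega)).eq
    have c2 := (cg (i + 1) (by omega)).eq
    have := h.braid (i + 1) (by omega)
    calc _ = T (i + 1) * (gap E 0 * T (i + 1 + 1)) * (gap E 0 * T (i + 1)) * gap E 0 := by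
          simp only [mul_assoc]
      _ = T (i + 1) * T (i + 1 + 1) * (gap E 0 * T (i + 1)) * gap E 0 * gap E 0 := by
          rw [← c1, ← c2]; simp only [mul_assoc, c1]
      _ = T (i + 1) * T (i + 1 + 1) * T (i + 1) * gap E 0 := by
          rw [← c1]; simp only [mul_assoc, gg]
      _ = T (i + 1 + 1) * T (i + 1) * T (i + 1 + 1) * gap E 0 := by rw [this]
      _ = T (i + 1 + 1) * T (i + 1) * (gap E 0 * T (i + 1 + 1)) * gap E 0 * gap E 0 := by
          rw [← c2]; simp only [mul_assoc, gg]
      _ = T (i + 1 + 1) * (gap E 0 * T (i + 1)) * (gap E 0 * T (i + 1 + 1)) * gap E 0 := by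
          rw [← c1, ← c2]; simp only [mul_assoc, c2]
      _ = _ := by simp only [mul_assoc]
  · intro i j h1 h2
    have c1 := (cg i (by omega)).eq
    have c2 := (cg j (by omega)).eq
    rw [mul_assoc, ← mul_assoc (gap E 0), ← c2, mul_assoc, gg, ← mul_assoc,
      h.comm (i + 1) (j + 1) (by omega) (by omega), mul_assoc (T (j + 1)) (gap E 0),
      ← mul_assoc (gap E 0), ← c1, mul_assoc (T (i + 1)), gg, ← mul_assoc]
  · intro i hi
    -- `raise T E i` moves past `T (i + 1)` and meets `lower T E i`; their product q^i `gap E i` is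
    -- then absorbed, and the braid relation applies.
    have hmid : gap E (i + 1) * T i * raise T E i * T (i + 1) * (lower T E i * T i * gap E (i + 1))
        = q ^ i • (gap E (i + 1) * T (i + 1) * T i * T (i + 1) * gap E (i + 1)) := by
      have c1 := (h.commute_raise (i := i + 1) (j := i) (by omega) (by omega)).eq
      calc _ = gap E (i + 1) * T i * T (i + 1) * (raise T E i * lower T E i) *
            (T i * gap E (i + 1)) := by
            rw [mul_assoc _ (raise T E i), ← c1]; simp only [mul_assoc]
        _ = q ^ i • (gap E (i + 1) * T i * T (i + 1) *
              (gap E i * (T i * gap E (i + 1)))) := by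
            rw [h.raise_mul_lower (by omega)]
            simp only [mul_smul_comm, smul_mul_assoc, mul_assoc]
        _ = q ^ i • (gap E (i + 1) * (T i * T (i + 1) * T i) * gap E (i + 1)) := by
            rw [h.T_mul_gap_succ (by omega)]; simp only [mul_assoc]
        _ = _ := by rw [h.braid i (by omega)]; simp only [mul_assoc]
    have hz : gap E (i + 1) * T (i + 1) * (T i * gap E (i + 1)) = 0 := by
      rw [← h.T_mul_gap_succ (by omega), mul_assoc, ← mul_assoc (T (i + 1)),
        (h.commute_gap (i := i + 1) (j := i) (by omega) (by omega) (by omega) (by omega)).eq,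
        mul_assoc (gap E i), ← mul_assoc (gap E (i + 1)),
        h.gap_mul_gap (by omega) (by omega) (by omega), zero_mul]
    -- Split the right end by `gap E (i + 1) + gap E (i + 2)`, which commutes with `T (i + 1)`. The
    -- first part dies by `hz`; the inserted `gap E (i + 2)` exposes the factors of `lower T E (i +
    -- 2)` and `raise T E (i + 2)`.
    have hmid2 : gap E (i + 1) * T (i + 1) * T i * T (i + 1) * gap E (i + 1) =
        gap E (i + 1) * T (i + 1) * gap E (i + 2) * T i * (gap E (i + 2) * T (i + 1) *
          gap E (i + 1)) := by
      have c1 := h.commute_gap (i := i) (j := i + 2) (by omega) (by omega) (by omega) (by omega)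
      have c2 := (h.commute_gap_add_gap (i := i + 1) (by omega)).eq
      have e1 : (gap E (i + 1) + gap E (i + 1 + 1)) * gap E (i + 1) = gap E (i + 1) := by
        rw [add_mul, h.gap_mul_self (by omega), h.gap_mul_gap (by omega) (by omega) (by omega),
          add_zero]
      calc _ = gap E (i + 1) * T (i + 1) * T i *
            (T (i + 1) * (gap E (i + 1) + gap E (i + 1 + 1)) * gap E (i + 1)) := by
            rw [mul_assoc (T (i + 1)), e1]; simp only [mul_assoc]
        _ = gap E (i + 1) * T (i + 1) * (T i * gap E (i + 1)) * (T (i + 1) * gap E (i + 1)) +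
            gap E (i + 1) * T (i + 1) * (T i * gap E (i + 2)) * (T (i + 1) * gap E (i + 1)) := by
            rw [c2, add_mul, add_mul, mul_add]; simp only [mul_assoc]
        _ = gap E (i + 1) * T (i + 1) * (T i * (gap E (i + 2) * gap E (i + 2))) *
            (T (i + 1) * gap E (i + 1)) := by
            rw [hz, zero_mul, zero_add, h.gap_mul_self (by omega)]
        _ = gap E (i + 1) * T (i + 1) * (T i * gap E (i + 2) * gap E (i + 2)) *
            (T (i + 1) * gap E (i + 1)) := by simp only [mul_assoc]
        _ = _ := by rw [c1.eq]; simp only [mul_assoc]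
    have key : lower T E (i + 1) * raise T E (i + 1) * T (i + 1) *
        (lower T E (i + 1) * raise T E (i + 1)) =
        q ^ i • (lower T E (i + 2) * raise T E (i + 2) * T (i + 1)) := by
      calc _ = lower T E (i + 1) * (gap E (i + 1) * T i * raise T E i * T (i + 1) *
            (lower T E i * T i * gap E (i + 1))) * raise T E (i + 1) := by
            simp only [raise, lower, mul_assoc]
        _ = q ^ i • ((lower T E (i + 1) * gap E (i + 1)) * T (i + 1) * gap E (i + 2) *
            (T i * (gap E (i + 2) * T (i + 1) * (gap E (i + 1) * raise T E (i + 1))))) := by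
            rw [hmid, hmid2]; simp only [mul_smul_comm, smul_mul_assoc, mul_assoc]
        _ = q ^ i • (lower T E (i + 2) * (T i * raise T E (i + 2))) := by
            rw [h.lower_mul_gap (by omega), h.gap_mul_raise (by omega)]; rfl
        _ = _ := by rw [h.T_mul_raise (by omega) (by omega), mul_assoc]
    have hc := (cE i (i + 2) hi (by omega) (by omega)).eq
    calc _ = cornerE q T E (i + 1) * T (i + 1) * (gap E 0 * cornerE q T E (i + 1)) := by
          simp only [mul_assoc]
      _ = (q⁻¹ ^ (i + 1) * q⁻¹ ^ (i + 1)) • (lower T E (i + 1) * raise T E (i + 1) * T (i + 1) *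
          (lower T E (i + 1) * raise T E (i + 1))) := by
          rw [ge _ (by omega), cornerE]
          simp only [mul_smul_comm, smul_mul_assoc, smul_smul]
      _ = q⁻¹ ^ (i + 2) • (lower T E (i + 2) * raise T E (i + 2) * T (i + 1)) := by
          rw [key, smul_smul]
          have : q⁻¹ ^ (i + 1) * q⁻¹ ^ (i + 1) * q ^ i = q⁻¹ ^ (i + 2) * (q⁻¹ * q) ^ i := by ring
          rw [this, inv_mul_cancel₀ hq, one_pow, mul_one]
      _ = cornerE q T E (i + 2) * T (i + 1) := by rw [cornerE, smul_mul_assoc]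
      _ = cornerE q T E (i + 2) * (T (i + 1) * gap E 0) := by
          rw [(cg i hi).eq, ← mul_assoc, eg _ (by omega)]
      _ = _ := hc.symm
  · intro i hi
    have h1 : ∀ l, l ≤ n → (gap E 0 + T (i + 1) * gap E 0) * cornerE q T E l =
        (1 + T (i + 1)) * cornerE q T E l := fun l hl => by
      rw [add_mul, mul_assoc, ge l hl, add_mul, one_mul]
    have h2 : ∀ l, l ≤ n → cornerE q T E l * (gap E 0 + T (i + 1) * gap E 0) =
        cornerE q T E l * (1 + T (i + 1)) := fun l hl => by
      rw [(cg i hi).eq, mul_add, ← mul_assoc, eg l hl, mul_add, mul_one]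
    have h3 := congrArg (fun x => q⁻¹ ^ (i + 1) • x) (h.add_lower_mul_raise_add hi)
    rw [e0, h1 _ (by omega), mul_assoc, h2 _ (by omega), add_mul (cornerE q T E i),
      h2 _ (by omega), smul_mul_assoc, h2 _ (by omega)]
    have h4 : q⁻¹ ^ (i + 1) * q = q⁻¹ ^ i := by
      rw [pow_succ, mul_assoc, inv_mul_cancel₀ hq, mul_one]
    have h5 : q * q⁻¹ ^ (i + 2) = q⁻¹ ^ (i + 1) := by
      rw [pow_succ', ← mul_assoc, mul_inv_cancel₀ hq, one_mul]
    simp only [cornerE, add_mul, smul_add, smul_mul_assoc, mul_smul_comm, smul_smul, h4, h5,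
      mul_assoc] at h3 ⊢
    exact h3

end Ring

end IsMirabolicSystem

end Corner


/-! ### Equivariant projections for mirabolic systems -/

section Projection

variable {k : Type*} [Field k]

namespace IsMirabolicSystem

/-- The extra summand lets each generator act as the scalar q off the image of `E 0`, so the
relations hold with the true unit 1 and the Maschke theorem applies. -/
theorem isHeckeSystem {R : Type*} [Ring R] [Algebra k R] {n : ℕ} {q : k} {T E : ℕ → R}
    (h : IsMirabolicSystem n q T E) : IsHeckeSystem n q fun i => T i + q • (1 - E 0) := by
  have z1 : ∀ i, i + 1 < n → T i * (1 - E 0) = 0 := fun i hi => by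
    rw [mul_sub, h.mul_E_zero hi, mul_one, sub_self]
  have z2 : ∀ i, i + 1 < n → (1 - E 0) * T i = 0 := fun i hi => by
    rw [sub_mul, h.E_zero_mul i hi, one_mul, sub_self]
  have z3 : (1 - E 0) * (1 - E 0) = 1 - E 0 := by
    simp only [mul_sub, sub_mul, h.E_mul 0 0 le_rfl (by omega), mul_one, one_mul]
    abel
  have e : ∀ i j, i + 1 < n → j + 1 < n →
      (T i + q • (1 - E 0)) * (T j + q • (1 - E 0)) = T i * T j + (q * q) • (1 - E 0) := by
    intro i j hi hj
    rw [add_mul, mul_add, mul_add, mul_smul_comm, z1 i hi, smul_mul_assoc, z2 j hj,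
      smul_mul_assoc, mul_smul_comm, z3]
    module
  have e3 : ∀ i j, i + 1 < n → j + 1 < n →
      (T i + q • (1 - E 0)) * (T j + q • (1 - E 0)) * (T i + q • (1 - E 0)) =
        T i * T j * T i + (q * q * q) • (1 - E 0) := by
    intro i j hi hj
    rw [e i j hi hj, add_mul, mul_add, mul_add, mul_smul_comm, mul_assoc (T i) (T j) (1 - E 0),
      z1 j hj, smul_mul_assoc, z2 i hi, smul_mul_assoc, mul_smul_comm, z3]
    simp only [mul_zero]
    module
  refine ⟨fun i hi => ?_, fun i hi => ?_, fun i j h1 h2 => ?_⟩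
  · rw [e i i hi hi, h.quad i hi]
    module
  · rw [e3 i (i + 1) (by omega) (by omega), e3 (i + 1) i (by omega) (by omega), h.braid i hi]
  · rw [e i j (by omega) h2, e j i h2 (by omega), h.comm i j h1 h2]

variable {V : Type*} [AddCommGroup V] [Module k V] {q : k} {N : Submodule k V}

/-- The equivariant projection on the part where all idempotents act as the identity. -/
theorem exists_projection_top (hq : q ≠ 0) {n : ℕ} (hn : ∀ m, m < n → qNum q (m + 1) ≠ 0)
    {T E : ℕ → Module.End k V} (h : IsMirabolicSystem n q T E)
    (hT : ∀ i, i + 1 < n → ∀ v ∈ N, T i v ∈ N) (hE : ∀ l, l ≤ n → ∀ v ∈ N, E l v ∈ N) :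
    ∃ P : Module.End k V, (∀ v, P v ∈ N) ∧ (∀ v ∈ N, P v = E n v) ∧
      (∀ i, i + 1 < n → Commute (T i) P) ∧ ∀ l, l ≤ n → Commute (E l) P := by
  obtain ⟨P, P_mem, P_apply, P_comm⟩ := h.isHeckeSystem.exists_projection hq (N := N) n hn _
    fun i hi v hv => N.add_mem (hT i hi v hv)
      (N.smul_mem _ (N.sub_mem hv (hE 0 (by omega) v hv)))
  have hz1 : E n * (1 - E 0) = 0 := by
    rw [mul_sub, h.mul_E 0 n (by omega) le_rfl, mul_one, sub_self]
  have hz2 : (1 - E 0) * E n = 0 := by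
    rw [sub_mul, h.E_mul 0 n (by omega) le_rfl, one_mul, sub_self]
  -- Compression by `E n` makes the result commute with every `E l`, since each of them is absorbed
  -- by `E n`; it also hides the correction term q(1 - `E 0`).
  refine ⟨E n * P * E n, fun v => hE n le_rfl _ (P_mem _), fun v hv => ?_, fun i hi => ?_,
    fun l hl => ?_⟩
  · have := LinearMap.congr_fun (h.E_mul n n le_rfl le_rfl) v
    simp only [Module.End.mul_apply] at this ⊢
    rw [P_apply _ (hE n le_rfl v hv), this]
  · have c1 := (h.comm_E i n hi le_rfl (by omega)).eq
    have c2 := (P_comm i hi).eq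
    have c3 : E n * (T i + q • (1 - E 0)) = E n * T i := by
      rw [mul_add, mul_smul_comm, hz1, smul_zero, add_zero]
    have c4 : (T i + q • (1 - E 0)) * E n = T i * E n := by
      rw [add_mul, smul_mul_assoc, hz2, smul_zero, add_zero]
    calc T i * (E n * P * E n) = (E n * T i) * P * E n := by
          rw [← c1]; simp only [mul_assoc]
      _ = E n * ((T i + q • (1 - E 0)) * P) * E n := by
          rw [← c3]; simp only [mul_assoc]
      _ = E n * P * ((T i + q • (1 - E 0)) * E n) := by
          rw [c2]; simp only [mul_assoc]
      _ = _ := by rw [c4, c1]; simp only [mul_assoc]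
  · rw [Commute, SemiconjBy, mul_assoc (E n), ← mul_assoc (E l), h.E_mul l n hl le_rfl,
      mul_assoc (E n), mul_assoc P, h.mul_E l n hl le_rfl]

theorem lower_apply_mem {n : ℕ} {T E : ℕ → Module.End k V}
    (hT : ∀ i, i + 1 < n → ∀ v ∈ N, T i v ∈ N) (hE : ∀ l, l ≤ n → ∀ v ∈ N, E l v ∈ N)
    {j : ℕ} (hj : j < n) : ∀ v ∈ N, lower T E j v ∈ N := by
  have hg : ∀ j, j < n → ∀ v ∈ N, gap E j v ∈ N := fun j hj v hv =>
    N.sub_mem (hE j hj.le v hv) (hE (j + 1) hj v hv)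
  induction j with
  | zero => exact hg 0 hj
  | succ j ih => exact fun v hv => ih (by omega) _ (hT j hj _ (hg (j + 1) hj v hv))

theorem raise_apply_mem {n : ℕ} {T E : ℕ → Module.End k V}
    (hT : ∀ i, i + 1 < n → ∀ v ∈ N, T i v ∈ N) (hE : ∀ l, l ≤ n → ∀ v ∈ N, E l v ∈ N)
    {j : ℕ} (hj : j < n) : ∀ v ∈ N, raise T E j v ∈ N := by
  have hg : ∀ j, j < n → ∀ v ∈ N, gap E j v ∈ N := fun j hj v hv =>
    N.sub_mem (hE j hj.le v hv) (hE (j + 1) hj v hv)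
  induction j with
  | zero => exact hg 0 hj
  | succ j ih => exact fun v hv => hg (j + 1) hj _ (hT j hj _ (ih (by omega) v hv))

theorem sum_gap {R : Type*} [Ring R] (E : ℕ → R) (n : ℕ) :
    ∑ j ∈ Finset.range n, gap E j = E 0 - E n :=
  Finset.sum_range_sub' E n

/-- An element commuting with the corner yields one commuting with the whole system. -/
theorem commute_sum_raise_lower {R : Type*} [Ring R] [Algebra k R] (hq : q ≠ 0) {n : ℕ}
    {T E : ℕ → R} (h : IsMirabolicSystem (n + 1) q T E) {p : R}
    (hT : ∀ i, i + 1 < n → Commute (T (i + 1) * gap E 0) p)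
    (hE : ∀ l, l ≤ n → Commute (cornerE q T E l) p) (i : ℕ) (hi : i < n) :
    Commute (T i) (∑ j ∈ Finset.range (n + 1), q⁻¹ ^ j • (raise T E j * p * lower T E j)) := by
  have hsub : ({i, i + 1} : Finset ℕ) ⊆ Finset.range (n + 1) := by
    intro j hj
    simp only [Finset.mem_insert, Finset.mem_singleton] at hj
    simp only [Finset.mem_range]
    omega
  -- Every summand with j different from i and i + 1 commutes with `T i` on its own: `T i` crosses
  -- `raise` and turns into a corner generator, which commutes with `p`. Only the pair i, i + 1 is
  -- mixed.
  rw [← Finset.sum_sdiff hsub, Finset.sum_pair (by omega : i ≠ i + 1)]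
  refine Commute.add_right (Commute.sum_right _ _ _ fun j hj => Commute.smul_right ?_ _) ?_
  · simp only [Finset.mem_sdiff, Finset.mem_range, Finset.mem_insert, Finset.mem_singleton,
      not_or] at hj
    obtain ⟨hj, h1, h2⟩ := hj
    obtain ⟨m, hm, e1, e2⟩ : ∃ m, m + 1 < n ∧ T i * raise T E j = raise T E j * T (m + 1) ∧
        lower T E j * T i = T (m + 1) * lower T E j := by
      rcases lt_or_gt_of_ne h1 with h3 | h3
      · obtain ⟨m, rfl⟩ : ∃ m, i = m + 1 := ⟨i - 1, by omega⟩
        exact ⟨m, hi, (h.commute_raise (by omega) h3).eq, (h.commute_lower (by omega) h3).symm.eq⟩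
      · refine ⟨i, by omega, h.T_mul_raise (by omega) hj, ?_⟩
        have := congrArg MulOpposite.unop (h.op.T_mul_raise (i := i) (j := j) (by omega) hj)
        simpa [unop_raise_op] using this
    have c1 := (h.commute_gap (i := m + 1) (j := 0) (by omega) (by omega) (by omega)
      (by omega)).eq
    have e3 := h.raise_mul_gap_zero hj
    have e4 := h.gap_zero_mul_lower hj
    calc T i * (raise T E j * p * lower T E j)
        = (raise T E j * gap E 0) * T (m + 1) * p * lower T E j := by
          rw [e3, ← e1]; simp only [mul_assoc]
      _ = raise T E j * ((T (m + 1) * gap E 0) * p) * lower T E j := by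
          rw [c1]; simp only [mul_assoc]
      _ = raise T E j * p * (T (m + 1) * (gap E 0 * lower T E j)) := by
          rw [(hT m hm).eq]; simp only [mul_assoc]
      _ = _ := by rw [e4, ← e2]; simp only [mul_assoc]
  · have r1 := h.T_mul_raise_self (i := i) (by omega)
    have r2 := h.T_mul_raise_succ (i := i) (by omega)
    have r3 := h.gap_T_raise hq (i := i) (by omega)
    have r4 := h.raise_mul_cornerE hq (le_refl i) (by omega)
    have r5 := h.raise_mul_cornerE hq (le_refl (i + 1)) (by omega)
    have l1 : lower T E i * T i = lower T E (i + 1) + lower T E i * T i * gap E i := by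
      have := congrArg MulOpposite.unop (h.op.T_mul_raise_self (i := i) (by omega))
      simpa [unop_raise_op, unop_gap_op, mul_assoc] using this
    have l2 : lower T E (i + 1) * T i = lower T E i + lower T E i * T i * gap E i := by
      have := congrArg MulOpposite.unop (h.op.T_mul_raise_succ (i := i) (by omega))
      simpa [unop_raise_op, unop_gap_op, mul_assoc] using this
    have l3 : lower T E i * T i * gap E i =
        (q • cornerE q T E (i + 1) - cornerE q T E i) * lower T E i := by
      have := congrArg MulOpposite.unop (h.op.gap_T_raise hq (i := i) (by omega))
      simpa [unop_raise_op, unop_gap_op, unop_cornerE_op, mul_assoc] using this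
    have l4 := h.cornerE_mul_lower hq (le_refl i) (by omega)
    have l5 := h.cornerE_mul_lower hq (le_refl (i + 1)) (by omega)
    have c1 := (hE i (by omega)).eq
    have c2 := (hE (i + 1) (by omega)).eq
    have hq1 : q⁻¹ ^ (i + 1) * q = q⁻¹ ^ i := by
      rw [pow_succ, mul_assoc, inv_mul_cancel₀ hq, mul_one]
    -- The off-diagonal terms `raise (i + 1) p lower i` and `raise i p lower (i + 1)` arise from
    -- both summands, once with an extra q; the weights q^(-i) and q^(-(i+1)) balance this.
    have t1 : T i * (raise T E i * p * lower T E i) = raise T E (i + 1) * p * lower T E i +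
        q • (raise T E i * cornerE q T E (i + 1) * p * lower T E i) -
        raise T E i * p * lower T E i := by
      rw [← mul_assoc, ← mul_assoc, r1, r3, mul_sub, r4, mul_smul_comm]
      simp only [add_mul, sub_mul, smul_mul_assoc]
      abel
    have t2 : raise T E i * p * lower T E i * T i = raise T E i * p * lower T E (i + 1) +
        q • (raise T E i * cornerE q T E (i + 1) * p * lower T E i) -
        raise T E i * p * lower T E i := by
      rw [mul_assoc, l1, l3, sub_mul, l4, smul_mul_assoc, mul_assoc (raise T E i) _ p, c2]
      simp only [mul_add, mul_sub, mul_smul_comm, mul_assoc]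
      abel
    have t3 : T i * (raise T E (i + 1) * p * lower T E (i + 1)) =
        q • (raise T E i * p * lower T E (i + 1)) := by
      rw [← mul_assoc, ← mul_assoc, r2, r3, mul_sub, r4, mul_smul_comm]
      rw [add_sub_cancel, smul_mul_assoc, smul_mul_assoc, mul_assoc (raise T E i), c2,
        mul_assoc, mul_assoc p, l5, mul_assoc]
    have t4 : raise T E (i + 1) * p * lower T E (i + 1) * T i =
        q • (raise T E (i + 1) * p * lower T E i) := by
      rw [mul_assoc, l2, l3, sub_mul, l4, add_sub_cancel, smul_mul_assoc, mul_smul_comm,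
        mul_assoc, ← mul_assoc p, ← c2, ← mul_assoc, ← mul_assoc, r5]
    rw [Commute, SemiconjBy, mul_add, add_mul, mul_smul_comm, mul_smul_comm, smul_mul_assoc,
      smul_mul_assoc, t1, t2, t3, t4, smul_smul, smul_smul, hq1]
    module

/-- A subspace that is stable under a mirabolic system with `[n]_q! ≠ 0` has an equivariant
projection. -/
theorem exists_projection (hq : q ≠ 0) (n : ℕ) (hn : ∀ m, m < n → qNum q (m + 1) ≠ 0)
    (T E : ℕ → Module.End k V) (h : IsMirabolicSystem n q T E)
    (hT : ∀ i, i + 1 < n → ∀ v ∈ N, T i v ∈ N) (hE : ∀ l, l ≤ n → ∀ v ∈ N, E l v ∈ N) :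
    ∃ P : Module.End k V, (∀ v, P v ∈ N) ∧ (∀ v ∈ N, P v = E 0 v) ∧
      (∀ i, i + 1 < n → Commute (T i) P) ∧ ∀ l, l ≤ n → Commute (E l) P := by
  induction n generalizing T E with
  | zero => exact h.exists_projection_top hq hn hT hE
  | succ n ih =>
    have hg : ∀ v ∈ N, gap E 0 v ∈ N := fun v hv =>
      N.sub_mem (hE 0 (by omega) v hv) (hE 1 (by omega) v hv)
    obtain ⟨p, p_mem, p_apply, p_T, p_E⟩ := ih (fun m hm => hn m (by omega)) _ _
      (corner hq h) (fun i hi v hv => hT (i + 1) (by omega) _ (hg v hv))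
      (fun l hl v hv => N.smul_mem _ (lower_apply_mem hT hE (by omega) _
        (raise_apply_mem hT hE (by omega) v hv)))
    obtain ⟨P, P_mem, P_apply, P_T, P_E⟩ := h.exists_projection_top hq hn hT hE
    -- `P` takes care of the `E (n + 1)` part. On N the j-th summand is `gap E j` by
    -- `raise_mul_lower`, and these telescope to `E 0 - E (n + 1)`.
    refine ⟨P + ∑ j ∈ Finset.range (n + 1), q⁻¹ ^ j • (raise T E j * p * lower T E j),
      fun v => ?_, fun v hv => ?_, fun i hi => ?_, fun l hl => ?_⟩
    · rw [LinearMap.add_apply, LinearMap.sum_apply]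
      exact N.add_mem (P_mem v) (N.sum_mem fun j hj => N.smul_mem _ (raise_apply_mem hT hE
        (Finset.mem_range.mp hj) _ (p_mem _)))
    · have h1 : ∀ j ∈ Finset.range (n + 1),
          (q⁻¹ ^ j • (raise T E j * p * lower T E j)) v = gap E j v := by
        intro j hj
        have hj := Finset.mem_range.mp hj
        have e1 := LinearMap.congr_fun (h.raise_mul_lower hj) v
        have e2 := LinearMap.congr_fun (h.gap_zero_mul_lower hj) v
        simp only [Module.End.mul_apply, LinearMap.smul_apply] at e1 e2 ⊢
        rw [p_apply _ (lower_apply_mem hT hE hj v hv), h.cornerE_zero (by omega), e2, e1,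
          smul_smul, ← mul_pow, inv_mul_cancel₀ hq, one_pow, one_smul]
      rw [LinearMap.add_apply, LinearMap.sum_apply, Finset.sum_congr rfl h1, P_apply v hv,
        ← LinearMap.sum_apply, sum_gap, LinearMap.sub_apply, add_sub_cancel]
    · exact (P_T i hi).add_right (h.commute_sum_raise_lower hq p_T p_E i (by omega))
    · refine (P_E l hl).add_right (Commute.sum_right _ _ _ fun j hj => Commute.smul_right ?_ _)
      have hj := Finset.mem_range.mp hj
      have e1 : E l * raise T E j = if l ≤ j then raise T E j else 0 := by
        rw [← h.gap_mul_raise hj, ← mul_assoc, h.E_mul_gap hl hj]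
        split_ifs <;> simp
      have e2 : lower T E j * E l = if l ≤ j then lower T E j else 0 := by
        rw [← h.lower_mul_gap hj, mul_assoc, h.gap_mul_E hl hj]
        split_ifs <;> simp
      rw [Commute, SemiconjBy, ← mul_assoc, ← mul_assoc, e1, mul_assoc _ _ (E l), e2]
      split_ifs <;> simp

end IsMirabolicSystem

end Projection


/-! ### Complete flags, adapted bases and relative positions -/

section Flags

variable {K : Type} [Field K] {n : ℕ}

namespace CompleteFlag

/-- The steps of a complete flag, indexed by natural numbers. -/
def level (F : CompleteFlag K n) (j : ℕ) : Submodule K (Vec K n) :=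
  F.step ⟨min j n, by omega⟩

theorem level_mono (F : CompleteFlag K n) {i j : ℕ} (h : i ≤ j) : F.level i ≤ F.level j :=
  F.mono (by simp only [Fin.mk_le_mk]; omega)

theorem finrank_level (F : CompleteFlag K n) {j : ℕ} (h : j ≤ n) :
    Module.finrank K (F.level j) = j := by
  rw [level, F.finrank_step]
  exact min_eq_left h

theorem step_eq_level (F : CompleteFlag K n) (i : Fin (n + 1)) : F.step i = F.level i := by
  rw [level]
  congr 1
  ext
  simp only
  omega

theorem ext_level {F H : CompleteFlag K n} (h : ∀ j, j ≤ n → F.level j = H.level j) : F = H := by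
  apply step_injective K n
  funext i
  rw [step_eq_level, step_eq_level, h i (by omega)]

theorem level_zero (F : CompleteFlag K n) : F.level 0 = ⊥ :=
  Submodule.finrank_eq_zero.mp (F.finrank_level (Nat.zero_le n))

theorem level_last (F : CompleteFlag K n) : F.level n = ⊤ :=
  Submodule.eq_top_of_finrank_eq (by rw [F.finrank_level le_rfl]; simp)

theorem level_eq_of_le {F : CompleteFlag K n} {j : ℕ} (hj : j ≤ n) {U : Submodule K (Vec K n)}
    (h : U ≤ F.level j) (hU : Module.finrank K U = j) : U = F.level j :=
  Submodule.eq_of_le_of_finrank_eq h (by rw [hU, F.finrank_level hj])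

theorem level_sup_span {F : CompleteFlag K n} {j : ℕ} (hj : j < n) {v : Vec K n}
    {U : Submodule K (Vec K n)} (hU : Module.finrank K U = j + 1) (h1 : F.level j ≤ U)
    (h2 : v ∈ U) (h3 : v ∉ F.level j) : F.level j ⊔ Submodule.span K {v} = U := by
  refine Submodule.eq_of_le_of_finrank_eq (sup_le h1 ?_) ?_
  · exact (Submodule.span_singleton_le_iff_mem _ _).mpr h2
  · rw [Submodule.finrank_sup_span_singleton h3, F.finrank_level hj.le, hU]

theorem exists_mem_level (F : CompleteFlag K n) {j : ℕ} (hj : j < n) :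
    ∃ v ∈ F.level (j + 1), v ∉ F.level j := by
  by_contra! hc
  have h := Submodule.finrank_mono (show F.level (j + 1) ≤ F.level j from hc)
  rw [F.finrank_level hj, F.finrank_level hj.le] at h
  omega

end CompleteFlag

open CompleteFlag Module

/-- The complete flag spanned by a basis. -/
def flag (e : Basis (Fin n) K (Vec K n)) : CompleteFlag K n where
  step i := Submodule.span K (e '' {k | (k : ℕ) < (i : ℕ)})
  mono i j h := Submodule.span_mono (Set.image_mono fun k (hk : (k : ℕ) < i) =>
    lt_of_lt_of_le hk h)
  finrank_step i := by
    rw [Set.image_eq_range]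
    refine (finrank_span_eq_card (e.linearIndependent.comp _ Subtype.val_injective)).trans ?_
    rw [Fintype.card_subtype]
    have := i.2
    simp [Fin.card_filter_val_lt]
    omega

theorem mem_span_image_iff (e : Basis (Fin n) K (Vec K n)) (s : Set (Fin n)) (v : Vec K n) :
    v ∈ Submodule.span K (e '' s) ↔ ∀ k, e.repr v k ≠ 0 → k ∈ s := by
  rw [e.mem_span_image]
  simp [Set.subset_def]

theorem mem_flag_level (e : Basis (Fin n) K (Vec K n)) (j : ℕ) (v : Vec K n) :
    v ∈ (flag e).level j ↔ ∀ k : Fin n, e.repr v k ≠ 0 → (k : ℕ) < j := by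
  rw [level, flag]
  simp only [mem_span_image_iff, Set.mem_ofPred_eq]
  exact forall_congr' fun k => imp_congr_right fun _ => by have := k.2; omega

theorem mem_flag_reindex_level (e : Basis (Fin n) K (Vec K n)) (w : Equiv.Perm (Fin n)) (j : ℕ)
    (v : Vec K n) : v ∈ (flag (e.reindex w.symm)).level j ↔
      ∀ k : Fin n, e.repr v k ≠ 0 → (w.symm k : ℕ) < j := by
  rw [mem_flag_level]
  constructor
  · intro h k hk
    exact h _ (by simpa [Basis.repr_reindex_apply] using hk)
  · intro h k hk
    simpa using h (w k) (by simpa [Basis.repr_reindex_apply] using hk)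

theorem basis_mem_flag_level (e : Basis (Fin n) K (Vec K n)) (k : Fin n) (j : ℕ) :
    e k ∈ (flag e).level j ↔ (k : ℕ) < j := by
  rw [mem_flag_level]
  simp only [Basis.repr_self, Finsupp.single_apply]
  constructor
  · intro h; exact h k (by simp)
  · intro h l hl
    have : k = l := by by_contra hne; simp [hne] at hl
    omega

theorem basis_mem_flag_reindex_level (e : Basis (Fin n) K (Vec K n)) (w : Equiv.Perm (Fin n))
    (k : Fin n) (j : ℕ) :
    e k ∈ (flag (e.reindex w.symm)).level j ↔ (w.symm k : ℕ) < j := by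
  rw [← basis_mem_flag_level (e.reindex w.symm) (w.symm k) j]
  simp

theorem flag_eq_of_mem {e : Basis (Fin n) K (Vec K n)} {F : CompleteFlag K n}
    (h : ∀ k : Fin n, e k ∈ F.level (k + 1)) : flag e = F := by
  refine ext_level fun j hj => level_eq_of_le hj ?_ ((flag e).finrank_level hj)
  intro v hv
  rw [mem_flag_level] at hv
  rw [← e.sum_repr v]
  refine Submodule.sum_mem _ fun k _ => ?_
  by_cases h0 : e.repr v k = 0
  · simp [h0]
  · exact Submodule.smul_mem _ _ (F.level_mono (hv k h0) (h k))

theorem exists_basis_of_mem {F : CompleteFlag K n} (e : Fin n → Vec K n)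
    (h1 : ∀ k : Fin n, e k ∈ F.level (k + 1)) (h2 : ∀ k : Fin n, e k ∉ F.level k) :
    ∃ b : Basis (Fin n) K (Vec K n), ⇑b = e := by
  have h : ∀ j, j ≤ n → F.level j ≤ Submodule.span K (Set.range e) := by
    intro j
    induction j with
    | zero => intro _; rw [F.level_zero]; exact bot_le
    | succ j ih =>
      intro hj
      have := level_sup_span (F := F) (j := j) hj (F.finrank_level hj) (F.level_mono (by omega))
        (h1 ⟨j, hj⟩) (h2 ⟨j, hj⟩)
      rw [← this]
      exact sup_le (ih (by omega)) (Submodule.span_mono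
        (Set.singleton_subset_iff.mpr ⟨_, rfl⟩))
  have htop : ⊤ ≤ Submodule.span K (Set.range e) := by
    rw [← F.level_last]
    exact h n le_rfl
  exact ⟨basisOfTopLeSpanOfCardEqFinrank e htop (by simp),
    coe_basisOfTopLeSpanOfCardEqFinrank e htop (by simp)⟩

theorem exists_flag_eq (F : CompleteFlag K n) : ∃ e : Basis (Fin n) K (Vec K n), flag e = F := by
  choose e h1 h2 using fun k : Fin n => F.exists_mem_level k.2
  obtain ⟨b, hb⟩ := exists_basis_of_mem e h1 h2
  exact ⟨b, flag_eq_of_mem fun k => by rw [hb]; exact h1 k⟩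

/-- The basis `e` is adapted to the pair of flags `(F, F')` in relative position `w`. -/
def IsAdapted (e : Basis (Fin n) K (Vec K n)) (w : Equiv.Perm (Fin n))
    (F F' : CompleteFlag K n) : Prop :=
  flag e = F ∧ flag (e.reindex w.symm) = F'

theorem exists_isAdapted_of_mem {F F' : CompleteFlag K n} {w : Equiv.Perm (Fin n)}
    (e : Fin n → Vec K n) (h1 : ∀ k : Fin n, e k ∈ F.level (k + 1))
    (h2 : ∀ k : Fin n, e k ∉ F.level k) (h3 : ∀ k : Fin n, e k ∈ F'.level (w.symm k + 1)) :
    ∃ b : Basis (Fin n) K (Vec K n), ⇑b = e ∧ IsAdapted b w F F' := by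
  obtain ⟨b, rfl⟩ := exists_basis_of_mem e h1 h2
  refine ⟨b, rfl, flag_eq_of_mem h1, flag_eq_of_mem fun k => ?_⟩
  have := h3 (w k)
  simpa using this

theorem mem_orbit_iff (w : Equiv.Perm (Fin n)) (β : Finset (Fin n)) (F F' : CompleteFlag K n)
    (v : Vec K n) : (F, F', v) ∈ orbit K w β ↔
      ∃ e : Basis (Fin n) K (Vec K n), IsAdapted e w F F' ∧ v = ∑ i ∈ β, e i := by
  have key : ∀ (e : Basis (Fin n) K (Vec K n)) (F : CompleteFlag K n),
      (∀ i : Fin (n + 1), F.step i = Submodule.span K (e '' {k | (k : ℕ) < (i : ℕ)})) ↔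
        flag e = F := by
    intro e F
    constructor
    · intro h
      exact step_injective K n (funext fun i => (h i).symm)
    · rintro rfl i
      rfl
  have hre : ∀ e : Basis (Fin n) K (Vec K n),
      (fun k => e (w k)) = ⇑(e.reindex w.symm) := by
    intro e; funext k; simp
  simp only [orbit, Set.mem_ofPred_eq, hre, key, IsAdapted, and_assoc]

section IsAdapted

variable {e f : Basis (Fin n) K (Vec K n)} {w u : Equiv.Perm (Fin n)} {F F' H : CompleteFlag K n}

theorem IsAdapted.mem_level (h : IsAdapted e w F F') (j : ℕ) (v : Vec K n) :
    v ∈ F.level j ↔ ∀ k : Fin n, e.repr v k ≠ 0 → (k : ℕ) < j := by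
  rw [← h.1, mem_flag_level]

theorem IsAdapted.mem_level' (h : IsAdapted e w F F') (j : ℕ) (v : Vec K n) :
    v ∈ F'.level j ↔ ∀ k : Fin n, e.repr v k ≠ 0 → (w.symm k : ℕ) < j := by
  rw [← h.2, mem_flag_reindex_level]

theorem IsAdapted.basis_mem (h : IsAdapted e w F F') (k : Fin n) (j : ℕ) :
    e k ∈ F.level j ↔ (k : ℕ) < j := by
  rw [← h.1, basis_mem_flag_level]

theorem IsAdapted.basis_mem' (h : IsAdapted e w F F') (k : Fin n) (j : ℕ) :
    e k ∈ F'.level j ↔ (w.symm k : ℕ) < j := by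
  rw [← h.2, basis_mem_flag_reindex_level]

/-- This recovers `w` from the two flags alone; uniqueness of the relative position follows. -/
theorem IsAdapted.symm_lt_iff (h : IsAdapted e w F F') (k : Fin n) (j : ℕ) :
    (w.symm k : ℕ) < j ↔ ∃ v ∈ F.level (k + 1), v ∈ F'.level j ∧ v ∉ F.level k := by
  constructor
  · intro hk
    exact ⟨e k, (h.basis_mem k _).mpr (by omega), (h.basis_mem' k j).mpr hk, fun hc => by
      have := (h.basis_mem k _).mp hc; omega⟩
  · rintro ⟨v, h1, h2, h3⟩
    rw [h.mem_level] at h1 h3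
    rw [h.mem_level'] at h2
    push Not at h3
    obtain ⟨l, hl, hl'⟩ := h3
    have : l = k := by have := h1 l hl; ext; omega
    exact this ▸ h2 l hl

theorem IsAdapted.perm_eq (h : IsAdapted e w F F') (h' : IsAdapted f u F F') : w = u := by
  have : w.symm = u.symm := by
    ext k
    have h1 := (h.symm_lt_iff k (u.symm k + 1)).trans (h'.symm_lt_iff k _).symm
    have h2 := (h.symm_lt_iff k (w.symm k + 1)).trans (h'.symm_lt_iff k _).symm
    omega
  exact Equiv.symm_bijective.injective this

/-- In an adapted basis, the vectors of another adapted basis only involve smaller labels. -/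
theorem IsAdapted.repr_ne_zero (h : IsAdapted e w F F') (h' : IsAdapted f w F F') {k l : Fin n}
    (hkl : e.repr (f k) l ≠ 0) : l ≤ k ∧ w.symm l ≤ w.symm k := by
  have h1 := (h.mem_level (k + 1) (f k)).mp ((h'.basis_mem k _).mpr (by omega)) l hkl
  have h2 := (h.mem_level' (w.symm k + 1) (f k)).mp ((h'.basis_mem' k _).mpr (by omega)) l hkl
  exact ⟨by rw [Fin.le_def]; omega, by rw [Fin.le_def]; omega⟩

end IsAdapted

/-- A set of labels which is a lower set for the order attached to the permutation `w`. -/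
def IsLowerLabels (w : Equiv.Perm (Fin n)) (I : Finset (Fin n)) : Prop :=
  ∀ k ∈ I, ∀ l, l ≤ k → w.symm l ≤ w.symm k → l ∈ I

/-- A change of adapted basis is triangular for the order attached to `w`, so the span of a lower
set of labels depends on the flags only. -/
theorem IsAdapted.span_le {e f : Basis (Fin n) K (Vec K n)} {w : Equiv.Perm (Fin n)}
    {F F' : CompleteFlag K n} (h : IsAdapted e w F F') (h' : IsAdapted f w F F')
    {I : Finset (Fin n)} (hI : IsLowerLabels w I) :
    Submodule.span K (f '' (I : Set (Fin n))) ≤ Submodule.span K (e '' (I : Set (Fin n))) := by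
  rw [Submodule.span_le]
  rintro _ ⟨k, hk, rfl⟩
  simp only [SetLike.mem_coe, mem_span_image_iff]
  intro l hl
  obtain ⟨h1, h2⟩ := h.repr_ne_zero h' hl
  exact hI k hk l h1 h2

theorem IsAdapted.span_eq {e f : Basis (Fin n) K (Vec K n)} {w : Equiv.Perm (Fin n)}
    {F F' : CompleteFlag K n} (h : IsAdapted e w F F') (h' : IsAdapted f w F F')
    {I : Finset (Fin n)} (hI : IsLowerLabels w I) :
    Submodule.span K (f '' (I : Set (Fin n))) = Submodule.span K (e '' (I : Set (Fin n))) :=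
  le_antisymm (h.span_le h' hI) (h'.span_le h hI)

/-! #### Neighbouring flags -/

/-- The flags agree except possibly at step `i + 1`. -/
def AgreeOff (i : ℕ) (F H : CompleteFlag K n) : Prop :=
  ∀ j, j ≤ n → j ≠ i + 1 → F.level j = H.level j

theorem AgreeOff.refl (i : ℕ) (F : CompleteFlag K n) : AgreeOff i F F :=
  fun _ _ _ => rfl

theorem AgreeOff.symm {i : ℕ} {F H : CompleteFlag K n} (h : AgreeOff i F H) : AgreeOff i H F :=
  fun j h1 h2 => (h j h1 h2).symm

theorem AgreeOff.trans {i : ℕ} {F H G : CompleteFlag K n} (h : AgreeOff i F H)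
    (h' : AgreeOff i H G) : AgreeOff i F G :=
  fun j h1 h2 => (h j h1 h2).trans (h' j h1 h2)

theorem AgreeOff.eq_of_level_le {i : ℕ} {F H : CompleteFlag K n} (h : AgreeOff i F H)
    (hl : F.level (i + 1) ≤ H.level (i + 1)) : F = H := by
  refine ext_level fun j hj => ?_
  by_cases hji : j = i + 1
  · subst hji
    exact level_eq_of_le hj hl (F.finrank_level hj)
  · exact h j hj hji

theorem AgreeOff.eq_of_mem {i : ℕ} {F H : CompleteFlag K n} (h : AgreeOff i F H)
    (h1 : i + 1 ≤ n) {v : Vec K n} (hv : v ∉ F.level i) (hF : v ∈ F.level (i + 1))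
    (hH : v ∈ H.level (i + 1)) : F = H := by
  refine h.eq_of_level_le ?_
  have e := h i (by omega) (by omega)
  rw [← level_sup_span (F := F) h1 (F.finrank_level h1) (F.level_mono (by omega)) hF hv, e]
  exact sup_le (H.level_mono (by omega)) ((Submodule.span_singleton_le_iff_mem _ _).mpr hH)

/-- The transposition of `i` and `i + 1`. -/
def adjSwap (n i : ℕ) : Equiv.Perm (Fin n) :=
  if h : i + 1 < n then Equiv.swap ⟨i, by omega⟩ ⟨i + 1, h⟩ else 1

theorem adjSwap_symm (i : ℕ) : (adjSwap n i).symm = adjSwap n i := by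
  unfold adjSwap
  split_ifs <;> rfl

theorem adjSwap_mul_self (i : ℕ) : adjSwap n i * adjSwap n i = 1 := by
  unfold adjSwap
  split_ifs <;> simp

theorem adjSwap_left {i : ℕ} (h : i + 1 < n) :
    adjSwap n i ⟨i, by omega⟩ = ⟨i + 1, h⟩ := by
  simp [adjSwap, h]

theorem adjSwap_right {i : ℕ} (h : i + 1 < n) :
    adjSwap n i ⟨i + 1, h⟩ = ⟨i, by omega⟩ := by
  simp [adjSwap, h]

theorem adjSwap_of_ne {i : ℕ} {k : Fin n} (h1 : (k : ℕ) ≠ i) (h2 : (k : ℕ) ≠ i + 1) :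
    adjSwap n i k = k := by
  unfold adjSwap
  split_ifs with h
  · refine Equiv.swap_apply_of_ne_of_ne ?_ ?_ <;>
    · rw [Ne, Fin.ext_iff]; assumption
  · rfl

theorem adjSwap_val_lt {i j : ℕ} (hj : j ≠ i + 1) (k : Fin n) :
    (adjSwap n i k : ℕ) < j ↔ (k : ℕ) < j := by
  by_cases h : i + 1 < n
  · by_cases h1 : (k : ℕ) = i
    · have : k = ⟨i, by omega⟩ := Fin.ext h1
      rw [this, adjSwap_left h]
      simp only
      omega
    · by_cases h2 : (k : ℕ) = i + 1
      · have : k = ⟨i + 1, h⟩ := Fin.ext h2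
        rw [this, adjSwap_right h]
        simp only
        omega
      · rw [adjSwap_of_ne h1 h2]
  · simp [adjSwap, h]

theorem agreeOff_flag_reindex (e : Basis (Fin n) K (Vec K n)) (i : ℕ) :
    AgreeOff i (flag e) (flag (e.reindex (adjSwap n i).symm)) := by
  intro j _ hj
  ext v
  rw [mem_flag_level, mem_flag_reindex_level]
  simp only [adjSwap_symm, adjSwap_val_lt hj]

theorem flag_reindex_ne (e : Basis (Fin n) K (Vec K n)) {i : ℕ} (hi : i + 1 < n) :
    flag e ≠ flag (e.reindex (adjSwap n i).symm) := by
  intro h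
  have h1 : e ⟨i, by omega⟩ ∈ (flag e).level (i + 1) := (basis_mem_flag_level _ _ _).mpr (by simp)
  rw [h, basis_mem_flag_reindex_level, adjSwap_symm, adjSwap_left hi] at h1
  simp at h1

theorem isAdapted_reindex_iff (e : Basis (Fin n) K (Vec K n)) (u w : Equiv.Perm (Fin n))
    (F F' : CompleteFlag K n) : IsAdapted (e.reindex u.symm) w F F' ↔
      flag (e.reindex u.symm) = F ∧ flag (e.reindex (u * w).symm) = F' := by
  have : (e.reindex u.symm).reindex w.symm = e.reindex (u * w).symm := by
    apply Basis.eq_of_apply_eq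
    intro k
    simp
  rw [IsAdapted, this]

/-- Geometric content of `T_{s_i} T_w = T_{s_i w}` in the length-increasing case. A vector spanning
step `i + 1` of F modulo step `i` replaces the basis vector with label `i + 1`; the inequality on
`w` guarantees that adding a multiple of the vector with label `i` respects F'. -/
theorem IsAdapted.of_agreeOff {e : Basis (Fin n) K (Vec K n)} {w : Equiv.Perm (Fin n)}
    {F H F' : CompleteFlag K n} {i : ℕ} (hi : i + 1 < n) (h : IsAdapted e w H F')
    (hw : w.symm ⟨i, by omega⟩ < w.symm ⟨i + 1, hi⟩) (hFH : AgreeOff i F H) (hne : F ≠ H) :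
    ∃ f, IsAdapted f (adjSwap n i * w) F F' := by
  obtain ⟨x, hx, hx'⟩ := F.exists_mem_level (j := i) (by omega)
  have hx1 : x ∈ H.level (i + 2) := by
    rw [← hFH (i + 2) (by omega) (by omega)]
    exact F.level_mono (by omega) hx
  have hx2 : x ∉ H.level (i + 1) := fun hc => hne (hFH.eq_of_mem (by omega) hx' hx hc)
  set a : Fin n := ⟨i, by omega⟩ with ha
  set b : Fin n := ⟨i + 1, hi⟩ with hb
  have hab : a ≠ b := by simp [ha, hb]
  rw [h.mem_level] at hx1 hx2
  push Not at hx2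
  have hxb : e.repr x b ≠ 0 := by
    obtain ⟨l, hl, hl'⟩ := hx2
    have : l = b := by have := hx1 l hl; ext; simp only [hb]; omega
    exact this ▸ hl
  -- The components of `x` on the two exchanged labels; the rest of `x` lies in step `i`, so `y` is
  -- as good as `x` for F and lies in the required steps of F'.
  let y : Vec K n := e.repr x a • e a + e.repr x b • e b
  have hrepr : ∀ k, e.repr y k = if k = a then e.repr x a else if k = b then e.repr x b else 0 := by
    intro k
    simp only [y, map_add, map_smul, Basis.repr_self, Finsupp.add_apply, Finsupp.smul_apply,
      Finsupp.single_apply, smul_eq_mul]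
    by_cases h1 : k = a
    · subst h1; simp [hab.symm]
    · by_cases h2 : k = b
      · subst h2; simp [hab, h1]
      · simp [h1, h2, Ne.symm h1, Ne.symm h2]
  have hxy : x - y ∈ F.level i := by
    rw [hFH i (by omega) (by omega), h.mem_level]
    intro k hk
    rw [map_sub, Finsupp.sub_apply, hrepr] at hk
    by_cases h1 : k = a
    · subst h1; simp at hk
    · by_cases h2 : k = b
      · subst h2
        rw [if_neg h1, if_pos rfl, sub_self] at hk
        exact absurd rfl hk
      · simp only [h1, h2, if_false, sub_zero] at hk
        have := hx1 k hk
        have h1' : (k : ℕ) ≠ i := fun hc => h1 (Fin.ext hc)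
        have h2' : (k : ℕ) ≠ i + 1 := fun hc => h2 (Fin.ext hc)
        omega
  have hy : y ∈ F.level (i + 1) := by
    have := Submodule.sub_mem _ hx (F.level_mono (Nat.le_succ i) hxy)
    simpa using this
  have hyb : e.repr y b ≠ 0 := by rw [hrepr, if_neg hab.symm, if_pos rfl]; exact hxb
  obtain ⟨b', hb', hB⟩ := exists_isAdapted_of_mem (F := H) (F' := F') (w := w)
    (Function.update e b y) (fun k => by
      by_cases hk : k = b
      · subst hk
        rw [Function.update_self, h.mem_level]
        intro l hl
        rw [hrepr] at hl
        by_cases h1 : l = a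
        · subst h1; simp [ha, hb]
        · by_cases h2 : l = b
          · subst h2; omega
          · simp [h1, h2] at hl
      · rw [Function.update_of_ne hk, h.basis_mem]
        omega)
    (fun k => by
      by_cases hk : k = b
      · subst hk
        rw [Function.update_self, h.mem_level]
        intro hc
        exact lt_irrefl _ (hc b hyb)
      · rw [Function.update_of_ne hk, h.basis_mem]
        omega)
    (fun k => by
      by_cases hk : k = b
      · subst hk
        rw [Function.update_self, h.mem_level']
        intro l hl
        rw [hrepr] at hl
        by_cases h1 : l = a
        · subst h1
          have := Fin.lt_def.mp hw
          omega
        · by_cases h2 : l = b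
          · subst h2; omega
          · simp [h1, h2] at hl
      · rw [Function.update_of_ne hk, h.basis_mem']
        omega)
  refine ⟨b'.reindex (adjSwap n i).symm, (isAdapted_reindex_iff _ _ _ _ _).mpr ⟨?_, ?_⟩⟩
  · have hK := agreeOff_flag_reindex b' i
    rw [hB.1] at hK
    symm
    refine (hFH.trans hK).eq_of_mem (v := y) (by omega) ?_ hy ?_
    · rw [hFH i (by omega) (by omega), h.mem_level]
      intro hc
      have := hc b hyb
      simp [hb] at this
    · have : y = b' b := by rw [hb', Function.update_self]
      rw [this, basis_mem_flag_reindex_level, adjSwap_symm, hb, adjSwap_right hi]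
      simp
  · rw [← mul_assoc, adjSwap_mul_self, one_mul]
    exact hB.2

theorem IsAdapted.adjSwap_reindex {f : Basis (Fin n) K (Vec K n)} {w : Equiv.Perm (Fin n)}
    {F F' : CompleteFlag K n} {i : ℕ} (h : IsAdapted f (adjSwap n i * w) F F') :
    IsAdapted (f.reindex (adjSwap n i).symm) w (flag (f.reindex (adjSwap n i).symm)) F' :=
  (isAdapted_reindex_iff _ _ _ _ _).mpr ⟨rfl, h.2⟩

/-- The intermediate flag is unique, so the convolution computing `T_{s_i} T_w` has a single nonzero
term. -/
theorem IsAdapted.eq_flag_reindex {e f : Basis (Fin n) K (Vec K n)} {w : Equiv.Perm (Fin n)}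
    {F H F' : CompleteFlag K n} {i : ℕ} (hi : i + 1 < n)
    (h : IsAdapted f (adjSwap n i * w) F F') (h' : IsAdapted e w H F')
    (hw : w.symm ⟨i, by omega⟩ < w.symm ⟨i + 1, hi⟩) (hFH : AgreeOff i F H) :
    H = flag (f.reindex (adjSwap n i).symm) := by
  have h1 : f ⟨i + 1, hi⟩ ∈ H.level (i + 2) := by
    rw [← hFH _ (by omega) (by omega), h.basis_mem]
    simp
  have h2 : f ⟨i + 1, hi⟩ ∈ F'.level (w.symm ⟨i, by omega⟩ + 1) := by
    rw [h.basis_mem', Equiv.Perm.mul_def, Equiv.symm_trans_apply, adjSwap_symm, adjSwap_right hi]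
    omega
  have hK := agreeOff_flag_reindex f i
  rw [h.1] at hK
  refine (hFH.symm.trans hK).eq_of_mem (v := f ⟨i + 1, hi⟩) (by omega) ?_ ?_ ?_
  · rw [← hFH _ (by omega) (by omega), h.basis_mem]
    simp
  · rw [h'.mem_level] at h1 ⊢
    rw [h'.mem_level'] at h2
    intro k hk
    have h3 := h1 k hk
    have h4 := h2 k hk
    have : k ≠ ⟨i + 1, hi⟩ := by
      rintro rfl
      have := Fin.lt_def.mp hw
      omega
    have : (k : ℕ) ≠ i + 1 := fun hc => this (Fin.ext hc)
    omega
  · rw [basis_mem_flag_reindex_level, adjSwap_symm, adjSwap_right hi]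
    simp

end Flags


/-! ### The orbits in terms of an adapted basis -/

section Orbits

open CompleteFlag Module

variable {K : Type} [Field K] {n : ℕ}

/-- The lower set of labels generated by `β`. -/
def labelClosure (w : Equiv.Perm (Fin n)) (β : Finset (Fin n)) : Finset (Fin n) :=
  Finset.univ.filter fun k => ∃ l ∈ β, k ≤ l ∧ w.symm k ≤ w.symm l

theorem mem_labelClosure {w : Equiv.Perm (Fin n)} {β : Finset (Fin n)} {k : Fin n} :
    k ∈ labelClosure w β ↔ ∃ l ∈ β, k ≤ l ∧ w.symm k ≤ w.symm l := by
  simp [labelClosure]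

theorem subset_labelClosure (w : Equiv.Perm (Fin n)) (β : Finset (Fin n)) :
    β ⊆ labelClosure w β :=
  fun k hk => mem_labelClosure.mpr ⟨k, hk, le_rfl, le_rfl⟩

theorem isLowerLabels_labelClosure (w : Equiv.Perm (Fin n)) (β : Finset (Fin n)) :
    IsLowerLabels w (labelClosure w β) := by
  intro k hk l h1 h2
  obtain ⟨m, hm, h3, h4⟩ := mem_labelClosure.mp hk
  exact mem_labelClosure.mpr ⟨m, hm, h1.trans h3, h2.trans h4⟩

theorem IsLowerLabels.labelClosure_subset {w : Equiv.Perm (Fin n)} {β I : Finset (Fin n)}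
    (hI : IsLowerLabels w I) : labelClosure w β ⊆ I ↔ β ⊆ I := by
  refine ⟨(subset_labelClosure w β).trans, fun h k hk => ?_⟩
  obtain ⟨l, hl, h1, h2⟩ := mem_labelClosure.mp hk
  exact hI l (h hl) k h1 h2

theorem IsLowerLabels.labelClosure_eq {w : Equiv.Perm (Fin n)} {I : Finset (Fin n)}
    (hI : IsLowerLabels w I) : labelClosure w I = I :=
  (hI.labelClosure_subset.mpr subset_rfl).antisymm (subset_labelClosure w I)

theorem exists_maximal_label (w : Equiv.Perm (Fin n)) (I : Finset (Fin n)) {k : Fin n}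
    (hk : k ∈ I) : ∃ a ∈ I, k ≤ a ∧ w.symm k ≤ w.symm a ∧
      ∀ l ∈ I, a ≤ l → w.symm a ≤ w.symm l → l = a := by
  obtain ⟨a, ha, hmax⟩ := Finset.exists_max_image
    (I.filter fun l => k ≤ l ∧ w.symm k ≤ w.symm l) (fun l => (l : ℕ) + (w.symm l : ℕ))
    ⟨k, by simp [hk]⟩
  simp only [Finset.mem_filter] at ha hmax
  refine ⟨a, ha.1, ha.2.1, ha.2.2, fun l hl h1 h2 => ?_⟩
  have h3 := hmax l ⟨hl, ha.2.1.trans h1, ha.2.2.trans h2⟩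
  rw [Fin.le_def] at h1 h2
  ext
  omega

/-- An orbit only remembers the lower set I generated by the support. The new basis differs from `f`
only at the maximal labels of I; each remaining label of I is assigned to a maximal label above it
by `g`. -/
theorem mem_orbit_of_labelClosure_eq {f : Basis (Fin n) K (Vec K n)} {w : Equiv.Perm (Fin n)}
    {F F' : CompleteFlag K n} (h : IsAdapted f w F F') {v : Vec K n} {β : Finset (Fin n)}
    (hv : labelClosure w (f.repr v).support = labelClosure w β) : (F, F', v) ∈ orbit K w β := by
  classical
  set I := labelClosure w β with hI
  choose! g g_mem g_le g_le' g_max using fun k (hk : k ∈ I) => exists_maximal_label w I hk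
  let σ := I.filter fun a => ∀ l ∈ I, a ≤ l → w.symm a ≤ w.symm l → l = a
  have hgσ : ∀ k ∈ I, g k ∈ σ := fun k hk =>
    Finset.mem_filter.mpr ⟨g_mem k hk, g_max k hk⟩
  have hσI : ∀ a ∈ σ, a ∈ I := fun a ha => (Finset.mem_filter.mp ha).1
  have hgg : ∀ a ∈ σ, g a = a := fun a ha =>
    (Finset.mem_filter.mp ha).2 _ (g_mem a (hσI a ha)) (g_le a (hσI a ha)) (g_le' a (hσI a ha))
  have hσβ : ∀ a ∈ σ, a ∈ β := by
    intro a ha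
    obtain ⟨l, hl, h1, h2⟩ := mem_labelClosure.mp (hσI a ha)
    rwa [(Finset.mem_filter.mp ha).2 l (subset_labelClosure w β hl) h1 h2] at hl
  have hσS : ∀ a ∈ σ, a ∈ (f.repr v).support := by
    intro a ha
    obtain ⟨l, hl, h1, h2⟩ := mem_labelClosure.mp (hv ▸ hσI a ha)
    rwa [(Finset.mem_filter.mp ha).2 l (hv ▸ subset_labelClosure w _ hl) h1 h2] at hl
  -- After the basis vectors with labels in `β \ σ` have been subtracted from `v`, the remainder is
  -- distributed over the maximal labels `σ`. At maximal labels nothing is subtracted, so their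
  -- coefficients stay nonzero.
  let c : Fin n → K := fun k => f.repr v k - if k ∈ β \ σ then 1 else 0
  have hcI : ∀ k, k ∉ I → c k = 0 := by
    intro k hk
    have h1 : f.repr v k = 0 := by
      by_contra hne
      exact hk (hv ▸ subset_labelClosure w _ (Finsupp.mem_support_iff.mpr hne))
    have h2 : k ∉ β \ σ := fun hc => hk (subset_labelClosure w β (Finset.mem_sdiff.mp hc).1)
    simp only [c, h1, if_neg h2, sub_zero]
  have hcσ : ∀ a ∈ σ, c a ≠ 0 := by
    intro a ha
    have := Finsupp.mem_support_iff.mp (hσS a ha)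
    simpa [c, ha] using this
  let e : Fin n → Vec K n := fun a =>
    if a ∈ σ then ∑ k ∈ I.filter (fun k => g k = a), c k • f k else f a
  have hrepr : ∀ a ∈ σ, ∀ m, f.repr (e a) m = if m ∈ I ∧ g m = a then c m else 0 := by
    intro a ha m
    simp only [e, if_pos ha, map_sum, map_smul, Basis.repr_self, Finsupp.finsetSum_apply,
      Finsupp.smul_apply, Finsupp.single_apply, smul_eq_mul, mul_ite, mul_one, mul_zero,
      Finset.sum_ite_eq', Finset.mem_filter]
  have hsupp : ∀ a m, f.repr (e a) m ≠ 0 → m ≤ a ∧ w.symm m ≤ w.symm a := by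
    intro a m hm
    by_cases ha : a ∈ σ
    · rw [hrepr a ha] at hm
      have hm' : m ∈ I ∧ g m = a := by by_contra hc; exact hm (if_neg hc)
      exact ⟨hm'.2 ▸ g_le m hm'.1, hm'.2 ▸ g_le' m hm'.1⟩
    · simp only [e, if_neg ha, Basis.repr_self, Finsupp.single_apply] at hm
      have : a = m := by by_contra hc; exact hm (if_neg hc)
      exact ⟨this.ge, by rw [this]⟩
  have hdiag : ∀ a, f.repr (e a) a ≠ 0 := by
    intro a
    by_cases ha : a ∈ σ
    · rw [hrepr a ha, if_pos ⟨hσI a ha, hgg a ha⟩]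
      exact hcσ a ha
    · simp [e, if_neg ha]
  obtain ⟨b, hb, hB⟩ := exists_isAdapted_of_mem (F := F) (F' := F') (w := w) e
    (fun k => (h.mem_level _ _).mpr fun l hl => by
      have := Fin.le_def.mp (hsupp k l hl).1; omega)
    (fun k hk => by
      have := (h.mem_level _ _).mp hk k (hdiag k); omega)
    (fun k => (h.mem_level' _ _).mpr fun l hl => by
      have := Fin.le_def.mp (hsupp k l hl).2; omega)
  refine (mem_orbit_iff _ _ _ _ _).mpr ⟨b, hB, ?_⟩
  have hσsub : σ ⊆ β := hσβ
  rw [hb, ← Finset.sum_sdiff hσsub]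
  have e1 : ∑ a ∈ σ, e a = ∑ k ∈ I, c k • f k := by
    rw [← Finset.sum_fiberwise_of_maps_to (g := g) hgσ]
    exact Finset.sum_congr rfl fun a ha => if_pos ha
  have e2 : ∑ a ∈ β \ σ, e a = ∑ k, (if k ∈ β \ σ then (1 : K) else 0) • f k := by
    simp only [ite_smul, one_smul, zero_smul, Finset.sum_ite_mem, Finset.univ_inter]
    exact Finset.sum_congr rfl fun a ha => if_neg (Finset.mem_sdiff.mp ha).2
  have e3 : ∑ k ∈ I, c k • f k = ∑ k, c k • f k :=
    Finset.sum_subset (Finset.subset_univ _) fun k _ hk => by rw [hcI k hk, zero_smul]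
  rw [e1, e2, e3, ← Finset.sum_add_distrib]
  conv_lhs => rw [← f.sum_repr v]
  refine Finset.sum_congr rfl fun k _ => ?_
  rw [← add_smul]
  congr 1
  simp only [c]
  ring

/-- Two lower sets agree if the same lower sets contain them, and the span of the vectors with
labels in a lower set is the same for both adapted bases. -/
theorem mem_orbit_iff_labelClosure {f : Basis (Fin n) K (Vec K n)} {w : Equiv.Perm (Fin n)}
    {F F' : CompleteFlag K n} (h : IsAdapted f w F F') (v : Vec K n) (β : Finset (Fin n)) :
    (F, F', v) ∈ orbit K w β ↔ labelClosure w (f.repr v).support = labelClosure w β := by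
  refine ⟨fun hv => ?_, mem_orbit_of_labelClosure_eq h⟩
  obtain ⟨e, he, rfl⟩ := (mem_orbit_iff _ _ _ _ _).mp hv
  have key : ∀ I : Finset (Fin n), IsLowerLabels w I →
      ((f.repr (∑ i ∈ β, e i)).support ⊆ I ↔ β ⊆ I) := by
    intro I hI
    have h1 : (f.repr (∑ i ∈ β, e i)).support ⊆ I ↔
        (∑ i ∈ β, e i) ∈ Submodule.span K (f '' (I : Set (Fin n))) := by
      rw [f.mem_span_image, Finset.coe_subset]
    have h2 : (e.repr (∑ i ∈ β, e i)).support ⊆ I ↔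
        (∑ i ∈ β, e i) ∈ Submodule.span K (e '' (I : Set (Fin n))) := by
      rw [e.mem_span_image, Finset.coe_subset]
    have h3 : (e.repr (∑ i ∈ β, e i)).support = β := by
      classical
      ext k
      simp [Finsupp.single_apply]
    rw [h1, ← h.span_eq he hI, ← h2, h3]
  refine Finset.Subset.antisymm ?_ ?_
  · rw [(isLowerLabels_labelClosure w β).labelClosure_subset,
      key _ (isLowerLabels_labelClosure w β)]
    exact subset_labelClosure w β
  · rw [(isLowerLabels_labelClosure w _).labelClosure_subset,
      ← key _ (isLowerLabels_labelClosure w _)]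
    exact subset_labelClosure w _

end Orbits

/-! ### Matrices over the group algebra -/

section Matrices

open CompleteFlag Module

variable {K : Type} [Field K] [Finite K] {n : ℕ}

open Classical in
/-- The sum of the elements of a subspace in the group algebra. -/
noncomputable def subSum (U : Submodule K (Vec K n)) : AddMonoidAlgebra ℂ (Vec K n) :=
  .ofCoeff (Finsupp.equivFunOnFinite.symm fun v => if v ∈ U then 1 else 0)

open Classical in
theorem coeff_subSum (U : Submodule K (Vec K n)) (v : Vec K n) :
    (subSum U).coeff v = if v ∈ U then 1 else 0 := rfl

theorem subSum_bot : subSum (⊥ : Submodule K (Vec K n)) = 1 := by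
  classical
  ext v
  rw [coeff_subSum, AddMonoidAlgebra.one_def, AddMonoidAlgebra.coeff_single, Finsupp.single_apply]
  simp [eq_comm]

omit [Finite K] in
theorem coeff_mul_eq_sum [Fintype K] (x y : AddMonoidAlgebra ℂ (Vec K n)) (v : Vec K n) :
    (x * y).coeff v = ∑ u : Vec K n, x.coeff u * y.coeff (v - u) := by
  classical
  rw [AddMonoidAlgebra.coeff_mul_antidiag x y v
    (Finset.univ.image fun u : Vec K n => (u, v - u))]
  · rw [Finset.sum_image]
    intro a _ b _ h
    exact congrArg Prod.fst h
  · rintro ⟨a, b⟩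
    simp only [Finset.mem_image, Finset.mem_univ, true_and, Prod.mk.injEq]
    constructor
    · rintro ⟨u, rfl, rfl⟩
      simp
    · intro h
      exact ⟨a, rfl, by rw [← h]; simp⟩

/-- Addition U × W → U + W is onto, and each fibre is a coset of U ∩ W. -/
theorem subSum_mul_subSum (U W : Submodule K (Vec K n)) :
    subSum U * subSum W = (Nat.card K : ℂ) ^ Module.finrank K ↥(U ⊓ W) • subSum (U ⊔ W) := by
  classical
  have := Fintype.ofFinite K
  ext v
  rw [coeff_mul_eq_sum, AddMonoidAlgebra.coeff_smul, Finsupp.smul_apply, coeff_subSum]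
  simp only [coeff_subSum, mul_ite, mul_one, mul_zero, smul_eq_mul]
  split_ifs with hv
  · obtain ⟨x, hx, y, hy, rfl⟩ := Submodule.mem_sup.mp hv
    rw [← Equiv.sum_comp (Equiv.addRight x)]
    have h1 : ∀ u : Vec K n, (if x + y - (Equiv.addRight x) u ∈ W then
        (if (Equiv.addRight x) u ∈ U then (1 : ℂ) else 0) else 0) =
        if u ∈ U ⊓ W then 1 else 0 := by
      intro u
      have e1 : x + y - (Equiv.addRight x) u ∈ W ↔ u ∈ W := by
        have : x + y - (Equiv.addRight x) u = y - u := by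
          change x + y - (u + x) = y - u
          rw [add_comm u x, add_sub_add_left_eq_sub]
        rw [this, W.sub_mem_iff_right hy]
      have e2 : (Equiv.addRight x) u ∈ U ↔ u ∈ U := U.add_mem_iff_left hx
      simp only [e1, e2, Submodule.mem_inf]
      by_cases hU : u ∈ U <;> by_cases hW : u ∈ W <;> simp [hU, hW]
    rw [Finset.sum_congr rfl fun u _ => h1 u, Finset.sum_boole, ← Nat.cast_pow,
      ← Module.natCard_eq_pow_finrank, Nat.card_eq_fintype_card, Fintype.card_subtype]
  · refine Finset.sum_eq_zero fun u _ => ?_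
    split_ifs with h1 h2
    · exact absurd (Submodule.mem_sup.mpr ⟨u, h2, v - u, h1, by abel⟩) hv
    · rfl
    · rfl

open Classical in
/-- The characteristic function of the triples `(F, F', v)` such that `(F, F')` is in relative
position `w` and `v` is in the span of the vectors with labels in `I` of an adapted basis. -/
noncomputable def regionMat (K : Type) [Field K] [Finite K] {n : ℕ} (w : Equiv.Perm (Fin n))
    (I : Finset (Fin n)) : FunctionAlgebra K n := fun F F' =>
  .ofCoeff (Finsupp.equivFunOnFinite.symm fun v =>
    if ∃ e : Basis (Fin n) K (Vec K n), IsAdapted e w F F' ∧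
      v ∈ Submodule.span K (e '' (I : Set (Fin n))) then 1 else 0)

theorem regionMat_of_isAdapted {e : Basis (Fin n) K (Vec K n)} {w : Equiv.Perm (Fin n)}
    {F F' : CompleteFlag K n} (h : IsAdapted e w F F') {I : Finset (Fin n)}
    (hI : IsLowerLabels w I) :
    regionMat K w I F F' = subSum (Submodule.span K (e '' (I : Set (Fin n)))) := by
  classical
  ext v
  change (if _ then (1 : ℂ) else 0) = if _ then 1 else 0
  refine if_congr ⟨?_, fun hv => ⟨e, h, hv⟩⟩ rfl rfl
  rintro ⟨f, hf, hv⟩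
  exact h.span_le hf hI hv

theorem regionMat_of_not {w : Equiv.Perm (Fin n)} {F F' : CompleteFlag K n}
    (h : ¬∃ e, IsAdapted e w F F') (I : Finset (Fin n)) : regionMat K w I F F' = 0 := by
  classical
  ext v
  change (if _ then (1 : ℂ) else 0) = 0
  exact if_neg fun ⟨e, he, _⟩ => h ⟨e, he⟩

open Classical in
theorem coeff_orbitFun (w : Equiv.Perm (Fin n)) (β : Finset (Fin n)) (F F' : CompleteFlag K n)
    (v : Vec K n) : (orbitFun K w β F F').coeff v =
      if (F, F', v) ∈ orbit K w β then 1 else 0 := rfl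

theorem orbitFun_of_not {w : Equiv.Perm (Fin n)} {F F' : CompleteFlag K n}
    (h : ¬∃ e, IsAdapted e w F F') (β : Finset (Fin n)) : orbitFun K w β F F' = 0 := by
  classical
  ext v
  rw [coeff_orbitFun, if_neg]
  · rfl
  · rw [mem_orbit_iff]
    rintro ⟨e, he, _⟩
    exact h ⟨e, he⟩

theorem orbitFun_labelClosure (w : Equiv.Perm (Fin n)) (β : Finset (Fin n)) :
    orbitFun K w (labelClosure w β) = orbitFun K w β := by
  classical
  ext F F' v
  by_cases h : ∃ e, IsAdapted e w F F'
  · obtain ⟨e, he⟩ := h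
    rw [coeff_orbitFun, coeff_orbitFun, mem_orbit_iff_labelClosure he,
      mem_orbit_iff_labelClosure he, (isLowerLabels_labelClosure w β).labelClosure_eq]
  · rw [orbitFun_of_not h, orbitFun_of_not h]

-- An adapted basis sorts the vectors of the span by the lower set their support generates. The
-- system is triangular for inclusion, so orbit functions can be recovered from regions.
open Classical in
theorem regionMat_eq_sum {w : Equiv.Perm (Fin n)} {I : Finset (Fin n)}
    (hI : IsLowerLabels w I) :
    regionMat K w I = ∑ J ∈ I.powerset.filter (IsLowerLabels w), orbitFun K w J := by
  ext F F' v
  rw [Matrix.sum_apply, AddMonoidAlgebra.coeff_sum, Finsupp.finsetSum_apply]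
  by_cases h : ∃ e, IsAdapted e w F F'
  · obtain ⟨e, he⟩ := h
    rw [regionMat_of_isAdapted he hI, coeff_subSum]
    have h1 : ∀ J ∈ I.powerset.filter (IsLowerLabels w), (orbitFun K w J F F').coeff v =
        if labelClosure w (e.repr v).support = J then 1 else 0 := by
      intro J hJ
      rw [coeff_orbitFun, mem_orbit_iff_labelClosure he,
        (Finset.mem_filter.mp hJ).2.labelClosure_eq]
      congr
    rw [Finset.sum_congr rfl h1, Finset.sum_ite_eq]
    refine if_congr ?_ rfl rfl
    rw [e.mem_span_image, Finset.coe_subset, Finset.mem_filter, Finset.mem_powerset,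
      hI.labelClosure_subset]
    exact (and_iff_left (isLowerLabels_labelClosure w _)).symm
  · rw [regionMat_of_not h]
    exact (Finset.sum_eq_zero fun J _ => by rw [orbitFun_of_not h]; rfl).symm

theorem isLowerLabels_empty (w : Equiv.Perm (Fin n)) : IsLowerLabels w ∅ := by
  intro k hk
  simp at hk

theorem regionMat_empty (w : Equiv.Perm (Fin n)) : regionMat K w ∅ = orbitFun K w ∅ := by
  classical
  rw [regionMat_eq_sum (isLowerLabels_empty w), Finset.powerset_empty, Finset.filter_singleton,
    if_pos (isLowerLabels_empty w), Finset.sum_singleton]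

theorem regionMat_empty_of_isAdapted {e : Basis (Fin n) K (Vec K n)} {w : Equiv.Perm (Fin n)}
    {F F' : CompleteFlag K n} (h : IsAdapted e w F F') : regionMat K w ∅ F F' = 1 := by
  rw [regionMat_of_isAdapted h (isLowerLabels_empty w)]
  simp [subSum_bot]

theorem regionMat_one_empty : regionMat K (1 : Equiv.Perm (Fin n)) ∅ = 1 := by
  refine Matrix.ext fun F F' => ?_
  have hre : ∀ e : Basis (Fin n) K (Vec K n), e.reindex (Equiv.symm 1) = e := by
    intro e; apply Basis.eq_of_apply_eq; intro k; simp
  by_cases h : F = F'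
  · subst h
    obtain ⟨e, he⟩ := exists_flag_eq F
    rw [regionMat_empty_of_isAdapted (e := e) ⟨he, by rw [hre, he]⟩, Matrix.one_apply_eq]
  · rw [Matrix.one_apply_ne h, regionMat_of_not]
    rintro ⟨e, h1, h2⟩
    rw [hre] at h2
    exact h (h1.symm.trans h2)

open Classical in
/-- The characteristic function of the pairs of flags which differ exactly at step `i + 1`. -/
noncomputable def stepMat (K : Type) [Field K] [Finite K] (n i : ℕ) :
    FunctionAlgebra K n := fun F H =>
  if AgreeOff i F H ∧ F ≠ H then 1 else 0

/-- The diagonal matrix of the sums of the elements of the `l`-th steps. -/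
noncomputable def levelMat (K : Type) [Field K] [Finite K] (n l : ℕ) : FunctionAlgebra K n :=
  Matrix.diagonal fun F => subSum (F.level l)

theorem stepMat_mul_regionMat {i : ℕ} (hi : i + 1 < n) {w : Equiv.Perm (Fin n)}
    (hw : w.symm ⟨i, by omega⟩ < w.symm ⟨i + 1, hi⟩) {I : Finset (Fin n)}
    (hI : IsLowerLabels w I) (hI' : IsLowerLabels (adjSwap n i * w) (I.image (adjSwap n i))) :
    stepMat K n i * regionMat K w I =
      regionMat K (adjSwap n i * w) (I.image (adjSwap n i)) := by
  classical
  refine Matrix.ext fun F F' => ?_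
  rw [Matrix.mul_apply]
  by_cases h : ∃ f, IsAdapted f (adjSwap n i * w) F F'
  · obtain ⟨f, hf⟩ := h
    have h0 := agreeOff_flag_reindex f i
    have h1 := flag_reindex_ne f hi
    rw [hf.1] at h0 h1
    rw [regionMat_of_isAdapted hf hI',
      Finset.sum_eq_single (flag (f.reindex (adjSwap n i).symm))]
    · rw [stepMat, if_pos ⟨h0, h1⟩, one_mul, regionMat_of_isAdapted hf.adjSwap_reindex hI]
      congr 2
      ext v
      simp only [Set.mem_image, Finset.coe_image, SetLike.mem_coe, Basis.reindex_apply,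
        Equiv.symm_symm, exists_exists_and_eq_and]
    · intro H _ hH
      by_cases h2 : AgreeOff i F H
      · rw [regionMat_of_not, mul_zero]
        rintro ⟨e, he⟩
        exact hH (hf.eq_flag_reindex hi he hw h2)
      · rw [stepMat, if_neg fun hc => h2 hc.1, zero_mul]
    · intro hc
      exact absurd (Finset.mem_univ _) hc
  · rw [regionMat_of_not h]
    refine Finset.sum_eq_zero fun H _ => ?_
    by_cases h2 : AgreeOff i F H ∧ F ≠ H
    · rw [regionMat_of_not, mul_zero]
      rintro ⟨e, he⟩
      exact h (he.of_agreeOff hi hw h2.1 h2.2)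
    · rw [stepMat, if_neg h2, zero_mul]

theorem stepMat_eq {i : ℕ} (hi : i + 1 < n) : stepMat K n i = regionMat K (adjSwap n i) ∅ := by
  have := stepMat_mul_regionMat (K := K) (w := 1) hi
    (Fin.mk_lt_mk.mpr (Nat.lt_succ_self i)) (isLowerLabels_empty 1)
    (by simpa only [Finset.image_empty] using isLowerLabels_empty _)
  simpa [regionMat_one_empty] using this

/-- The labels smaller than `l`. -/
def initialLabels (n l : ℕ) : Finset (Fin n) := Finset.univ.filter fun k => (k : ℕ) < l

theorem isLowerLabels_initialLabels (w : Equiv.Perm (Fin n)) (l : ℕ) :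
    IsLowerLabels w (initialLabels n l) := by
  intro k hk m hm _
  simp only [initialLabels, Finset.mem_filter, Finset.mem_univ, true_and] at hk ⊢
  rw [Fin.le_def] at hm
  omega

theorem levelMat_mul_regionMat (w : Equiv.Perm (Fin n)) (l : ℕ) :
    levelMat K n l * regionMat K w ∅ = regionMat K w (initialLabels n l) := by
  refine Matrix.ext fun F F' => ?_
  rw [levelMat, Matrix.diagonal_mul]
  by_cases h : ∃ e, IsAdapted e w F F'
  · obtain ⟨e, he⟩ := h
    rw [regionMat_empty_of_isAdapted he, mul_one,
      regionMat_of_isAdapted he (isLowerLabels_initialLabels w l)]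
    congr 1
    ext v
    rw [he.mem_level, mem_span_image_iff]
    simp [initialLabels]
  · rw [regionMat_of_not h, regionMat_of_not h, mul_zero]

end Matrices


/-! ### The relations of the mirabolic Hecke algebra over a finite field -/

section Relations

open CompleteFlag Module

variable {K : Type} [Field K] {n : ℕ}

/-- The neighbour of a flag whose step `i + 1` is spanned by step `i` and a vector `v`. -/
noncomputable def neighbour (F : CompleteFlag K n) (i : ℕ) (v : Vec K n) (hi : i + 1 < n)
    (h1 : v ∉ F.level i) (h2 : v ∈ F.level (i + 2)) : CompleteFlag K n where
  step j := if (j : ℕ) = i + 1 then F.level i ⊔ Submodule.span K {v} else F.level j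
  mono a b hab := by
    have hab : (a : ℕ) ≤ b := hab
    have hs : F.level i ⊔ Submodule.span K {v} ≤ F.level (i + 2) :=
      sup_le (F.level_mono (by omega)) ((Submodule.span_singleton_le_iff_mem _ _).mpr h2)
    simp only
    split_ifs with ha hb hb
    · exact le_rfl
    · exact hs.trans (F.level_mono (by omega))
    · exact (F.level_mono (by omega)).trans le_sup_left
    · exact F.level_mono hab
  finrank_step j := by
    by_cases hj : (j : ℕ) = i + 1
    · rw [if_pos hj, Submodule.finrank_sup_span_singleton h1, F.finrank_level (by omega), hj]
    · rw [if_neg hj]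
      exact F.finrank_level (Nat.lt_succ_iff.mp j.2)

theorem exists_agreeOff_mem {F : CompleteFlag K n} {i : ℕ} {v : Vec K n} (hi : i + 1 < n)
    (h1 : v ∉ F.level i) (h2 : v ∈ F.level (i + 2)) :
    ∃ H, AgreeOff i F H ∧ v ∈ H.level (i + 1) := by
  have key : ∀ j, j ≤ n → (neighbour F i v hi h1 h2).level j =
      if j = i + 1 then F.level i ⊔ Submodule.span K {v} else F.level j := by
    intro j hj
    simp only [level, neighbour, min_eq_left hj]
  refine ⟨neighbour F i v hi h1 h2, fun j hj hji => ?_, ?_⟩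
  · rw [key j hj, if_neg hji]
  · rw [key _ (by omega), if_pos rfl]
    exact Submodule.mem_sup_right (Submodule.mem_span_singleton_self v)

variable [Finite K]

open Classical in
/-- The flags which agree with `F` except possibly at step `i + 1`. -/
noncomputable def neighbours (F : CompleteFlag K n) (i : ℕ) : Finset (CompleteFlag K n) :=
  Finset.univ.filter (AgreeOff i F)

theorem mem_neighbours {F H : CompleteFlag K n} {i : ℕ} :
    H ∈ neighbours F i ↔ AgreeOff i F H := by
  simp [neighbours]

/-- The steps `i + 1` of the neighbours are the lines of a plane: a vector of step `i + 2` outside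
step `i` lies in exactly one of them, a vector of step `i` in all. -/
theorem sum_neighbours_subSum (F : CompleteFlag K n) {i : ℕ} (hi : i + 1 < n) :
    ∑ H ∈ neighbours F i, subSum (H.level (i + 1)) =
      subSum (F.level (i + 2)) + (((neighbours F i).card : ℂ) - 1) • subSum (F.level i) := by
  classical
  ext v
  rw [AddMonoidAlgebra.coeff_sum, Finsupp.finsetSum_apply, AddMonoidAlgebra.coeff_add,
    Finsupp.add_apply, AddMonoidAlgebra.coeff_smul, Finsupp.smul_apply]
  simp only [coeff_subSum, smul_eq_mul]
  by_cases h1 : v ∈ F.level i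
  · rw [if_pos h1, if_pos (F.level_mono (by omega) h1), Finset.sum_congr rfl fun H hH =>
      if_pos (H.level_mono (Nat.le_succ i)
        ((mem_neighbours.mp hH) i (by omega) (by omega) ▸ h1)), Finset.sum_const, nsmul_eq_mul]
    ring
  · rw [if_neg h1, mul_zero, add_zero]
    by_cases h2 : v ∈ F.level (i + 2)
    · obtain ⟨H, hH, hv⟩ := exists_agreeOff_mem hi h1 h2
      rw [if_pos h2, Finset.sum_eq_single H, if_pos hv]
      · intro G hG hne
        refine if_neg fun hc => hne ?_
        refine ((mem_neighbours.mp hG).symm.trans hH).eq_of_mem (by omega) ?_ hc hv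
        rwa [← mem_neighbours.mp hG i (by omega) (by omega)]
      · exact fun hc => absurd (mem_neighbours.mpr hH) hc
    · rw [if_neg h2]
      refine Finset.sum_eq_zero fun H hH => if_neg fun hc => h2 ?_
      rw [mem_neighbours.mp hH (i + 2) (by omega) (by omega)]
      exact H.level_mono (by omega) hc

theorem sum_coeff_subSum [Fintype K] (U : Submodule K (Vec K n)) :
    ∑ v, (subSum U).coeff v = (Nat.card K : ℂ) ^ finrank K U := by
  classical
  simp only [coeff_subSum]
  rw [Finset.sum_boole, ← Nat.cast_pow, ← Module.natCard_eq_pow_finrank,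
    Nat.card_eq_fintype_card, Fintype.card_subtype]

/-- Summing coefficients in the previous identity gives N s^(i+1) = s^(i+2) + (N - 1) s^i for the
number N of neighbours. -/
theorem card_neighbours (F : CompleteFlag K n) {i : ℕ} (hi : i + 1 < n) :
    ((neighbours F i).card : ℂ) = Nat.card K + 1 := by
  have := Fintype.ofFinite K
  have h := congrArg (fun x : AddMonoidAlgebra ℂ (Vec K n) => ∑ v, x.coeff v)
    (sum_neighbours_subSum F hi)
  simp only [AddMonoidAlgebra.coeff_sum, Finsupp.finsetSum_apply, AddMonoidAlgebra.coeff_add,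
    Finsupp.add_apply, AddMonoidAlgebra.coeff_smul, Finsupp.smul_apply, smul_eq_mul,
    Finset.sum_add_distrib, ← Finset.mul_sum, sum_coeff_subSum] at h
  rw [Finset.sum_comm] at h
  simp only [sum_coeff_subSum] at h
  rw [Finset.sum_congr rfl fun H _ => by rw [H.finrank_level (by omega)], Finset.sum_const,
    F.finrank_level (by omega), F.finrank_level (by omega), nsmul_eq_mul] at h
  have h1 : 1 < Nat.card K := Finite.one_lt_card
  have h2 : (Nat.card K : ℂ) ≠ 0 := by
    rw [Nat.cast_ne_zero]; omega
  have h3 : (Nat.card K : ℂ) - 1 ≠ 0 := by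
    rw [sub_ne_zero, Nat.cast_ne_one]; omega
  refine mul_left_cancel₀ (mul_ne_zero (pow_ne_zero i h2) h3) ?_
  linear_combination h

theorem stepMat_of_le {i : ℕ} (hi : n ≤ i + 1) : stepMat K n i = 0 := by
  classical
  refine Matrix.ext fun F H => ?_
  rw [stepMat, if_neg, Matrix.zero_apply]
  rintro ⟨h, hne⟩
  refine hne (ext_level fun j hj => ?_)
  rcases hj.lt_or_eq with hj' | rfl
  · exact h j hj (by omega)
  · rw [level_last, level_last]

open Classical in
theorem one_add_stepMat_apply (i : ℕ) (F H : CompleteFlag K n) :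
    (1 + stepMat K n i) F H = if AgreeOff i F H then 1 else 0 := by
  rw [Matrix.add_apply, stepMat]
  by_cases h : F = H
  · subst h
    simp [AgreeOff.refl]
  · simp [h]

theorem one_add_stepMat_mul_apply (i : ℕ) (x : FunctionAlgebra K n) (F G : CompleteFlag K n) :
    ((1 + stepMat K n i) * x) F G = ∑ H ∈ neighbours F i, x H G := by
  classical
  rw [Matrix.mul_apply, neighbours, Finset.sum_filter]
  refine Finset.sum_congr rfl fun H _ => ?_
  rw [one_add_stepMat_apply, ite_mul, one_mul, zero_mul]

/-- `1 + stepMat` is the matrix of the equivalence relation `AgreeOff i`, whose classes all have s +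
1 elements. -/
theorem one_add_stepMat_mul_self {i : ℕ} (hi : i + 1 < n) :
    (1 + stepMat K n i) * (1 + stepMat K n i) = ((Nat.card K : ℂ) + 1) • (1 + stepMat K n i) := by
  classical
  refine Matrix.ext fun F G => ?_
  rw [one_add_stepMat_mul_apply, Matrix.smul_apply, one_add_stepMat_apply,
    Finset.sum_congr rfl (g := fun _ => if AgreeOff i F G then 1 else 0), Finset.sum_const,
    ← card_neighbours F hi, Nat.cast_smul_eq_nsmul]
  intro H hH
  rw [one_add_stepMat_apply]
  have hH := mem_neighbours.mp hH
  exact if_congr ⟨hH.trans, hH.symm.trans⟩ rfl rfl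

theorem one_add_stepMat_mul_levelMat_mul {i : ℕ} (hi : i + 1 < n) :
    (1 + stepMat K n i) * levelMat K n (i + 1) * (1 + stepMat K n i) =
      (levelMat K n (i + 2) + (Nat.card K : ℂ) • levelMat K n i) * (1 + stepMat K n i) := by
  classical
  refine Matrix.ext fun F G => ?_
  have h1 : levelMat K n (i + 2) + (Nat.card K : ℂ) • levelMat K n i = Matrix.diagonal
      fun F => subSum (F.level (i + 2)) + (Nat.card K : ℂ) • subSum (F.level i) := by
    rw [levelMat, levelMat, ← Matrix.diagonal_smul, Matrix.diagonal_add]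
    rfl
  rw [h1, Matrix.diagonal_mul, mul_assoc, one_add_stepMat_mul_apply, one_add_stepMat_apply]
  have h2 := sum_neighbours_subSum F hi
  rw [card_neighbours F hi, add_sub_cancel_right] at h2
  rw [← h2, Finset.sum_mul]
  refine Finset.sum_congr rfl fun H hH => ?_
  have hH := mem_neighbours.mp hH
  rw [levelMat, Matrix.diagonal_mul, one_add_stepMat_apply]
  congr 1
  exact if_congr ⟨hH.trans, hH.symm.trans⟩ rfl rfl

theorem levelMat_mul_levelMat {l m : ℕ} (h : l ≤ m) (hm : m ≤ n) :
    levelMat K n l * levelMat K n m = (Nat.card K : ℂ) ^ l • levelMat K n m := by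
  rw [levelMat, levelMat, Matrix.diagonal_mul_diagonal, ← Matrix.diagonal_smul]
  congr 1
  funext F
  have hle := F.level_mono h
  rw [subSum_mul_subSum, inf_eq_left.mpr hle, sup_eq_right.mpr hle, F.finrank_level (h.trans hm)]
  rfl

theorem levelMat_comm (l m : ℕ) :
    levelMat K n l * levelMat K n m = levelMat K n m * levelMat K n l := by
  rw [levelMat, levelMat, Matrix.diagonal_mul_diagonal, Matrix.diagonal_mul_diagonal]
  simp only [mul_comm]

theorem levelMat_zero : levelMat K n 0 = 1 := by
  simp only [levelMat, level_zero, subSum_bot, Matrix.diagonal_one]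

theorem stepMat_commute_levelMat {i l : ℕ} (hl : l ≤ n) (hil : l ≠ i + 1) :
    Commute (stepMat K n i) (levelMat K n l) := by
  classical
  refine Matrix.ext fun F G => ?_
  rw [levelMat, Matrix.mul_diagonal, Matrix.diagonal_mul, stepMat]
  split_ifs with h
  · rw [h.1 l hl hil, mul_comm]
  · rw [mul_zero, zero_mul]

omit [Finite K] in
theorem AgreeOff.inf_eq {i : ℕ} (hi : i + 1 < n) {F H : CompleteFlag K n}
    (h : AgreeOff i F H) (hne : F ≠ H) :
    F.level (i + 1) ⊓ H.level (i + 1) = F.level i := by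
  refine le_antisymm (fun v hv => ?_) (le_inf (F.level_mono (by omega)) ?_)
  · by_contra hc
    exact hne (h.eq_of_mem (by omega) hc hv.1 hv.2)
  · rw [h i (by omega) (by omega)]
    exact H.level_mono (by omega)

omit [Finite K] in
theorem AgreeOff.sup_eq {i : ℕ} (hi : i + 1 < n) {F H : CompleteFlag K n}
    (h : AgreeOff i F H) (hne : F ≠ H) :
    F.level (i + 1) ⊔ H.level (i + 1) = F.level (i + 2) := by
  refine level_eq_of_le (by omega) (sup_le (F.level_mono (by omega)) ?_) ?_
  · rw [h (i + 2) (by omega) (by omega)]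
    exact H.level_mono (by omega)
  · have := Submodule.finrank_sup_add_finrank_inf_eq (F.level (i + 1)) (H.level (i + 1))
    rw [h.inf_eq hi hne, F.finrank_level (by omega), F.finrank_level (by omega),
      H.finrank_level (by omega)] at this
    omega

theorem levelMat_mul_stepMat_mul_levelMat {i : ℕ} (hi : i + 1 < n) :
    levelMat K n (i + 1) * stepMat K n i * levelMat K n (i + 1) =
      (Nat.card K : ℂ) ^ i • (stepMat K n i * levelMat K n (i + 2)) := by
  classical
  refine Matrix.ext fun F G => ?_
  rw [levelMat, levelMat, Matrix.mul_diagonal, Matrix.diagonal_mul, Matrix.smul_apply,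
    Matrix.mul_diagonal, stepMat]
  split_ifs with h
  · rw [mul_one, one_mul, subSum_mul_subSum, h.1.inf_eq hi h.2, h.1.sup_eq hi h.2,
      F.finrank_level (by omega), h.1 (i + 2) (by omega) (by omega)]
  · rw [mul_zero, zero_mul, zero_mul, smul_zero]

/-! #### Products of neighbouring transpositions -/

theorem adjSwap_val {i : ℕ} (hi : i + 1 < n) (k : Fin n) : (adjSwap n i k : ℕ) =
    if (k : ℕ) = i then i + 1 else if (k : ℕ) = i + 1 then i else k := by
  split_ifs with h1 h2
  · rw [show k = ⟨i, by omega⟩ from Fin.ext h1, adjSwap_left hi]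
  · rw [show k = ⟨i + 1, hi⟩ from Fin.ext h2, adjSwap_right hi]
  · rw [adjSwap_of_ne h1 h2]

theorem adjSwap_braid {i : ℕ} (hi : i + 2 < n) :
    adjSwap n i * (adjSwap n (i + 1) * adjSwap n i) =
      adjSwap n (i + 1) * (adjSwap n i * adjSwap n (i + 1)) := by
  ext k
  simp only [Equiv.Perm.coe_mul, Function.comp_apply, adjSwap_val (show i + 1 < n by omega),
    adjSwap_val (show i + 1 + 1 < n by omega)]
  split_ifs <;> omega

theorem adjSwap_comm {i j : ℕ} (hij : i + 1 < j) (hj : j + 1 < n) :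
    adjSwap n i * adjSwap n j = adjSwap n j * adjSwap n i := by
  ext k
  simp only [Equiv.Perm.coe_mul, Function.comp_apply, adjSwap_val (show i + 1 < n by omega),
    adjSwap_val hj]
  split_ifs <;> omega

theorem symm_mul_apply (u w : Equiv.Perm (Fin n)) (k : Fin n) :
    (u * w).symm k = w.symm (u.symm k) := rfl

theorem stepMat_mul_regionMat_empty {i : ℕ} (hi : i + 1 < n) {w : Equiv.Perm (Fin n)}
    (hw : w.symm ⟨i, by omega⟩ < w.symm ⟨i + 1, hi⟩) :
    stepMat K n i * regionMat K w ∅ = regionMat K (adjSwap n i * w) ∅ := by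
  have := stepMat_mul_regionMat (K := K) hi hw (isLowerLabels_empty w)
    (by simpa only [Finset.image_empty] using isLowerLabels_empty _)
  simpa only [Finset.image_empty] using this

/-- Both sides are built up along two reduced words of the same permutation. -/
theorem stepMat_braid {i : ℕ} (hi : i + 2 < n) :
    stepMat K n i * stepMat K n (i + 1) * stepMat K n i =
      stepMat K n (i + 1) * stepMat K n i * stepMat K n (i + 1) := by
  have e1 : stepMat K n (i + 1) * stepMat K n i =
      regionMat K (adjSwap n (i + 1) * adjSwap n i) ∅ := by
    rw [stepMat_eq (show i + 1 < n by omega),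
      stepMat_mul_regionMat_empty (show i + 1 + 1 < n by omega)]
    simp only [adjSwap_symm, Fin.lt_def, adjSwap_val (show i + 1 < n by omega)]
    split_ifs <;> omega
  have e2 : stepMat K n i * stepMat K n (i + 1) =
      regionMat K (adjSwap n i * adjSwap n (i + 1)) ∅ := by
    rw [stepMat_eq (show i + 1 + 1 < n by omega),
      stepMat_mul_regionMat_empty (show i + 1 < n by omega)]
    simp only [adjSwap_symm, Fin.lt_def, adjSwap_val (show i + 1 + 1 < n by omega)]
    split_ifs <;> omega
  rw [mul_assoc, mul_assoc, e1, e2, stepMat_mul_regionMat_empty (show i + 1 < n by omega),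
    stepMat_mul_regionMat_empty (show i + 1 + 1 < n by omega), adjSwap_braid hi]
  · simp only [symm_mul_apply, adjSwap_symm, Fin.lt_def, adjSwap_val (show i + 1 < n by omega),
      adjSwap_val (show i + 1 + 1 < n by omega)]
    split_ifs <;> omega
  · simp only [symm_mul_apply, adjSwap_symm, Fin.lt_def, adjSwap_val (show i + 1 < n by omega),
      adjSwap_val (show i + 1 + 1 < n by omega)]
    split_ifs <;> omega

theorem stepMat_comm {i j : ℕ} (hij : i + 1 < j) (hj : j + 1 < n) :
    stepMat K n i * stepMat K n j = stepMat K n j * stepMat K n i := by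
  have hi : i + 1 < n := by omega
  have e1 : stepMat K n i * stepMat K n j = regionMat K (adjSwap n i * adjSwap n j) ∅ := by
    rw [stepMat_eq hj, stepMat_mul_regionMat_empty hi]
    simp only [adjSwap_symm, Fin.lt_def, adjSwap_val hj]
    split_ifs <;> omega
  have e2 : stepMat K n j * stepMat K n i = regionMat K (adjSwap n j * adjSwap n i) ∅ := by
    rw [stepMat_eq hi, stepMat_mul_regionMat_empty hj]
    simp only [adjSwap_symm, Fin.lt_def, adjSwap_val hi]
    split_ifs <;> omega
  rw [e1, e2, adjSwap_comm hij hj]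

/-- The idempotent attached to the `l`-th steps of the flags. -/
noncomputable def levelIdem (K : Type) [Field K] [Finite K] (n l : ℕ) : FunctionAlgebra K n :=
  ((Nat.card K : ℂ) ^ l)⁻¹ • levelMat K n l

theorem isMirabolicSystem_stepMat :
    IsMirabolicSystem n (Nat.card K : ℂ) (stepMat K n) (levelIdem K n) := by
  have hs : (Nat.card K : ℂ) ≠ 0 := Nat.cast_ne_zero.mpr Nat.card_pos.ne'
  have h0 : levelIdem K n 0 = 1 := by simp [levelIdem, levelMat_zero]
  constructor
  · intro l m h1 h2
    rw [levelIdem, levelIdem, smul_mul_smul_comm, levelMat_mul_levelMat h1 h2, smul_smul]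
    congr 1
    field_simp
  · intro l m h1 h2
    rw [levelIdem, levelIdem, smul_mul_smul_comm, levelMat_comm, levelMat_mul_levelMat h1 h2,
      smul_smul]
    congr 1
    field_simp
  · intro i _
    rw [h0, one_mul]
  · intro i l _ h2 h3
    exact (stepMat_commute_levelMat h2 h3).smul_right _
  · intro i hi
    have := one_add_stepMat_mul_self (K := K) hi
    have e : stepMat K n i * stepMat K n i =
        (1 + stepMat K n i) * (1 + stepMat K n i) - 1 - stepMat K n i - stepMat K n i := by
      noncomm_ring
    rw [h0, e, this]
    module
  · intro i hi
    exact stepMat_braid hi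
  · intro i j h1 h2
    exact stepMat_comm h1 h2
  · intro i hi
    rw [levelIdem, levelIdem, smul_mul_assoc, mul_smul_comm, smul_mul_assoc,
      levelMat_mul_stepMat_mul_levelMat hi, mul_smul_comm, smul_smul, smul_smul]
    congr 1
    field_simp
    ring
  · intro i hi
    rw [h0, levelIdem, levelIdem, levelIdem, mul_smul_comm, smul_mul_assoc,
      one_add_stepMat_mul_levelMat_mul hi, ← smul_mul_assoc]
    congr 1
    rw [smul_add, smul_smul, smul_smul, add_comm]
    congr 2 <;>
    · field_simp
      ring

end Relations


/-! ### Generators of the mirabolic Hecke algebra -/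

section Families

open CompleteFlag Module

variable {n : ℕ}

theorem PrimePower.card_fq (s : PrimePower) : (Nat.card s.Fq : ℂ) = s.size := by
  rw [GaloisField.card s.p s.k s.ne_zero]
  simp [PrimePower.size]

theorem Family.smul_apply (f : ℂ[T;T⁻¹]) (x : Family n) (s : PrimePower) :
    (f • x) s = LaurentPolynomial.eval₂ (RingHom.id ℂ) s.size f • x s := by
  have h : f • x = Family.scalar n f * x := rfl
  rw [h]
  change algebraMap ℂ (FunctionAlgebra s.Fq n) _ * x s = _
  rw [← Algebra.smul_def]

theorem Family.T_smul_apply (x : Family n) (s : PrimePower) :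
    ((LaurentPolynomial.T 1 : ℂ[T;T⁻¹]) • x) s = (Nat.card s.Fq : ℂ) • x s := by
  rw [Family.smul_apply, LaurentPolynomial.eval₂_T, zpow_one, s.card_fq]

/-- The evaluation of a family at a prime power. -/
noncomputable def Family.eval (n : ℕ) (s : PrimePower) : Family n →+* FunctionAlgebra s.Fq n :=
  Pi.evalRingHom (fun s : PrimePower => FunctionAlgebra s.Fq n) s

theorem Family.eval_apply (s : PrimePower) (x : Family n) : Family.eval n s x = x s := rfl

theorem Family.ext_eval {x y : Family n} (h : ∀ s, Family.eval n s x = Family.eval n s y) :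
    x = y := funext h

theorem Family.eval_T_smul (x : Family n) (s : PrimePower) :
    Family.eval n s ((LaurentPolynomial.T 1 : ℂ[T;T⁻¹]) • x) =
      (Nat.card s.Fq : ℂ) • Family.eval n s x :=
  Family.T_smul_apply x s

/-- The family of the functions `stepMat`. -/
noncomputable def familyStep (n i : ℕ) : Family n := fun s => stepMat s.Fq n i

/-- The family of the functions `levelIdem`. -/
noncomputable def familyLevel (n l : ℕ) : Family n := fun s => levelIdem s.Fq n l

/-- The family of the functions `regionMat`. -/
noncomputable def familyRegion (w : Equiv.Perm (Fin n)) (I : Finset (Fin n)) : Family n :=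
  fun s => regionMat s.Fq w I

theorem isMirabolicSystem_family :
    IsMirabolicSystem n (LaurentPolynomial.T 1 : ℂ[T;T⁻¹]) (familyStep n) (familyLevel n) := by
  have h := fun s : PrimePower => isMirabolicSystem_stepMat (K := s.Fq) (n := n)
  constructor
  · exact fun l m h1 h2 => Family.ext_eval fun s => (h s).E_mul l m h1 h2
  · exact fun l m h1 h2 => Family.ext_eval fun s => (h s).mul_E l m h1 h2
  · exact fun i hi => Family.ext_eval fun s => (h s).E_zero_mul i hi
  · exact fun i l h1 h2 h3 => Family.ext_eval fun s => (h s).comm_E i l h1 h2 h3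
  · refine fun i hi => Family.ext_eval fun s => ?_
    rw [sub_smul, one_smul, map_add, map_sub, Family.eval_T_smul, Family.eval_T_smul]
    exact ((h s).quad i hi).trans (by rw [sub_smul, one_smul]; rfl)
  · exact fun i hi => Family.ext_eval fun s => (h s).braid i hi
  · exact fun i j h1 h2 => Family.ext_eval fun s => (h s).comm i j h1 h2
  · exact fun i hi => Family.ext_eval fun s => (h s).E_mul_T_mul_E i hi
  · refine fun i hi => Family.ext_eval fun s => ?_
    rw [map_mul _ (_ + _), map_add _ (familyLevel n i), Family.eval_T_smul]
    exact (h s).add_mul_E_mul_add i hi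

theorem familyLevel_zero : familyLevel n 0 = 1 := by
  refine Family.ext_eval fun s => ?_
  rw [map_one]
  exact (by simp [levelIdem, levelMat_zero] : levelIdem s.Fq n 0 = 1)

theorem familyRegion_one_empty : familyRegion (1 : Equiv.Perm (Fin n)) ∅ = 1 :=
  Family.ext_eval fun s => by
    rw [map_one]
    exact regionMat_one_empty

theorem familyStep_eq {i : ℕ} (hi : i + 1 < n) :
    familyStep n i = familyRegion (adjSwap n i) ∅ :=
  Family.ext_eval fun _ => stepMat_eq hi

theorem familyRegion_empty (w : Equiv.Perm (Fin n)) : familyRegion w ∅ = generic w ∅ :=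
  Family.ext_eval fun _ => regionMat_empty w

open Classical in
theorem familyRegion_eq_sum {w : Equiv.Perm (Fin n)} {I : Finset (Fin n)}
    (hI : IsLowerLabels w I) :
    familyRegion w I = ∑ J ∈ I.powerset.filter (IsLowerLabels w), generic w J :=
  Family.ext_eval fun s => by
    rw [map_sum]
    exact regionMat_eq_sum hI

theorem generic_labelClosure (w : Equiv.Perm (Fin n)) (β : Finset (Fin n)) :
    generic w (labelClosure w β) = generic w β :=
  Family.ext_eval fun _ => orbitFun_labelClosure w β

theorem familyStep_mul_familyRegion {i : ℕ} (hi : i + 1 < n) {w : Equiv.Perm (Fin n)}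
    (hw : w.symm ⟨i, by omega⟩ < w.symm ⟨i + 1, hi⟩) {I : Finset (Fin n)}
    (hI : IsLowerLabels w I) (hI' : IsLowerLabels (adjSwap n i * w) (I.image (adjSwap n i))) :
    familyStep n i * familyRegion w I =
      familyRegion (adjSwap n i * w) (I.image (adjSwap n i)) :=
  Family.ext_eval fun _ => stepMat_mul_regionMat hi hw hI hI'

theorem familyStep_mul_familyRegion_empty {i : ℕ} (hi : i + 1 < n) {w : Equiv.Perm (Fin n)}
    (hw : w.symm ⟨i, by omega⟩ < w.symm ⟨i + 1, hi⟩) :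
    familyStep n i * familyRegion w ∅ = familyRegion (adjSwap n i * w) ∅ :=
  Family.ext_eval fun _ => stepMat_mul_regionMat_empty hi hw

theorem familyStep_mul_self {i : ℕ} (hi : i + 1 < n) : familyStep n i * familyStep n i =
    (LaurentPolynomial.T 1 - 1 : ℂ[T;T⁻¹]) • familyStep n i +
      (LaurentPolynomial.T 1 : ℂ[T;T⁻¹]) • 1 := by
  rw [isMirabolicSystem_family.quad i hi, familyLevel_zero]

theorem familyStep_mul_familyRegion_empty_of_gt {i : ℕ} (hi : i + 1 < n)
    {w : Equiv.Perm (Fin n)} (hw : w.symm ⟨i + 1, hi⟩ < w.symm ⟨i, by omega⟩) :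
    familyStep n i * familyRegion w ∅ =
      (LaurentPolynomial.T 1 - 1 : ℂ[T;T⁻¹]) • familyRegion w ∅ +
        (LaurentPolynomial.T 1 : ℂ[T;T⁻¹]) • familyRegion (adjSwap n i * w) ∅ := by
  have h := familyStep_mul_familyRegion_empty (w := adjSwap n i * w) hi (by
    rwa [symm_mul_apply, symm_mul_apply, adjSwap_symm, adjSwap_left hi, adjSwap_right hi])
  rw [← mul_assoc, adjSwap_mul_self, one_mul] at h
  rw [← h, ← mul_assoc, familyStep_mul_self hi, add_mul, smul_mul_assoc, smul_mul_assoc, one_mul]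

theorem familyLevel_mul_familyRegion (w : Equiv.Perm (Fin n)) (l : ℕ) :
    familyLevel n l * familyRegion w ∅ =
      (LaurentPolynomial.T (-l) : ℂ[T;T⁻¹]) • familyRegion w (initialLabels n l) := by
  refine Family.ext_eval fun s => ?_
  rw [Family.eval_apply _ (_ • _), Family.smul_apply, LaurentPolynomial.eval₂_T, zpow_neg,
    zpow_natCast, Units.val_inv_eq_inv_val, Units.val_pow_eq_pow_val, ← s.card_fq]
  change levelIdem s.Fq n l * regionMat s.Fq w ∅ = _ • regionMat s.Fq w _
  rw [levelIdem, smul_mul_assoc, levelMat_mul_regionMat]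

/-! #### The algebra generated by `familyStep` and `familyLevel` -/

/-- The generators `familyStep n i` and `familyLevel n l`. -/
def generators (n : ℕ) : Set (Family n) :=
  {x | (∃ i, i + 1 < n ∧ familyStep n i = x) ∨ ∃ l, l ≤ n ∧ familyLevel n l = x}

theorem generic_mem (w : Equiv.Perm (Fin n)) (β : Finset (Fin n)) :
    generic w β ∈ HeckeAlgebra n :=
  Algebra.subset_adjoin ⟨(w, β), rfl⟩

theorem familyStep_mem (n i : ℕ) : familyStep n i ∈ HeckeAlgebra n := by
  by_cases hi : i + 1 < n
  · rw [familyStep_eq hi, familyRegion_empty]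
    exact generic_mem _ _
  · have h : familyStep n i = 0 := Family.ext_eval fun s => by
      rw [map_zero]
      exact stepMat_of_le (by omega)
    rw [h]
    exact Subalgebra.zero_mem _

theorem familyLevel_mem (n l : ℕ) : familyLevel n l ∈ HeckeAlgebra n := by
  have h := familyLevel_mul_familyRegion (1 : Equiv.Perm (Fin n)) l
  rw [familyRegion_one_empty, mul_one] at h
  rw [h, familyRegion_eq_sum (isLowerLabels_initialLabels _ _)]
  exact Subalgebra.smul_mem _ (Subalgebra.sum_mem _ fun J _ => generic_mem _ _) _

theorem generators_subset : generators n ⊆ HeckeAlgebra n := by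
  rintro _ (⟨i, _, rfl⟩ | ⟨l, _, rfl⟩)
  · exact familyStep_mem n i
  · exact familyLevel_mem n l

theorem mem_of_T_smul_mem {B : Subalgebra ℂ[T;T⁻¹] (Family n)} {x : Family n}
    (h : (LaurentPolynomial.T 1 : ℂ[T;T⁻¹]) • x ∈ B) : x ∈ B := by
  have := B.smul_mem h (LaurentPolynomial.T (-1))
  rwa [smul_smul, ← LaurentPolynomial.T_add, neg_add_cancel, LaurentPolynomial.T_zero,
    one_smul] at this

theorem perm_induction {p : Equiv.Perm (Fin n) → Prop} (h1 : p 1)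
    (hs : ∀ i, i + 1 < n → ∀ w, p w → p (adjSwap n i * w)) (w : Equiv.Perm (Fin n)) : p w := by
  rcases n with _ | n
  · rwa [Subsingleton.elim w 1]
  · have hw : w ∈ Submonoid.closure
        (Set.range fun i : Fin n => Equiv.swap i.castSucc i.succ) := by
      rw [Equiv.Perm.mclosure_swap_castSucc_succ]
      trivial
    induction hw using Submonoid.closure_induction_left with
    | one => exact h1
    | mul_left x hx y _ ih =>
      obtain ⟨i, rfl⟩ := hx
      have := hs i (by omega) y ih
      rw [adjSwap, dif_pos (by omega)] at this
      exact this

theorem symm_apply_lt_or_gt (w : Equiv.Perm (Fin n)) {i : ℕ} (hi : i + 1 < n) :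
    w.symm ⟨i, by omega⟩ < w.symm ⟨i + 1, hi⟩ ∨ w.symm ⟨i + 1, hi⟩ < w.symm ⟨i, by omega⟩ := by
  refine lt_or_gt_of_ne fun h => ?_
  have := Fin.ext_iff.mp (w.symm.injective h)
  simp at this

variable {B : Subalgebra ℂ[T;T⁻¹] (Family n)}

theorem familyRegion_empty_mem (hB : generators n ⊆ B) (w : Equiv.Perm (Fin n)) :
    familyRegion w ∅ ∈ B := by
  refine perm_induction (p := fun w => familyRegion w ∅ ∈ B) ?_ (fun i hi w hw => ?_) w
  · rw [familyRegion_one_empty]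
    exact B.one_mem
  · have hT : familyStep n i ∈ B := hB (Or.inl ⟨i, hi, rfl⟩)
    rcases symm_apply_lt_or_gt w hi with h | h
    · rw [← familyStep_mul_familyRegion_empty hi h]
      exact B.mul_mem hT hw
    -- When the generator shortens `w`, the quadratic relation exhibits 𝐪 times the shorter element,
    -- and 𝐪 is a unit.
    · refine mem_of_T_smul_mem ?_
      rw [← sub_eq_iff_eq_add'.mpr (familyStep_mul_familyRegion_empty_of_gt hi h)]
      exact B.sub_mem (B.mul_mem hT hw) (B.smul_mem hw _)

theorem exists_eq_initialLabels {I : Finset (Fin n)}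
    (h : ∀ i, ∀ hi : i + 1 < n, (⟨i + 1, hi⟩ : Fin n) ∈ I → (⟨i, by omega⟩ : Fin n) ∈ I) :
    ∃ l ≤ n, I = initialLabels n l := by
  have key : ∀ d a, ∀ hd : a + d < n, (⟨a + d, hd⟩ : Fin n) ∈ I → (⟨a, by omega⟩ : Fin n) ∈ I := by
    intro d
    induction d with
    | zero => exact fun a _ h => h
    | succ d ih => exact fun a hd hm => ih a (by omega) (h (a + d) hd hm)
  refine ⟨I.sup fun k => (k : ℕ) + 1, Finset.sup_le fun k _ => k.2, ?_⟩
  ext k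
  simp only [initialLabels, Finset.mem_filter, Finset.mem_univ, true_and, Finset.lt_sup_iff]
  refine ⟨fun hk => ⟨k, hk, Nat.lt_succ_self _⟩, ?_⟩
  rintro ⟨m, hm, hkm⟩
  obtain ⟨d, hd⟩ := Nat.exists_eq_add_of_le (Nat.lt_succ_iff.mp hkm)
  refine key d k (hd ▸ m.2) ?_
  convert hm using 1
  exact Fin.ext hd.symm

/-- If I is an initial segment, `familyLevel` produces the region. Otherwise some i + 1 is in I and
i is not; being a lower set then forces the order of the two labels under `w.symm`, and the region
is `familyStep n i` times a region with smaller label sum. -/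
theorem familyRegion_mem (hB : generators n ⊆ B) : ∀ (N : ℕ) (w : Equiv.Perm (Fin n))
    (I : Finset (Fin n)), IsLowerLabels w I → ∑ k ∈ I, (k : ℕ) ≤ N → familyRegion w I ∈ B := by
  intro N
  induction N using Nat.strong_induction_on with
  | _ N ih =>
  intro w I hI hN
  by_cases h : ∀ i, ∀ hi : i + 1 < n, (⟨i + 1, hi⟩ : Fin n) ∈ I → (⟨i, by omega⟩ : Fin n) ∈ I
  · obtain ⟨l, hl, rfl⟩ := exists_eq_initialLabels h
    have h1 := familyLevel_mul_familyRegion w l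
    have h2 : familyLevel n l * familyRegion w ∅ ∈ B :=
      B.mul_mem (hB (Or.inr ⟨l, hl, rfl⟩)) (familyRegion_empty_mem hB w)
    rw [h1] at h2
    have h3 := B.smul_mem h2 (LaurentPolynomial.T l)
    rwa [smul_smul, ← LaurentPolynomial.T_add, add_neg_cancel, LaurentPolynomial.T_zero,
      one_smul] at h3
  · push Not at h
    obtain ⟨i, hi, h1, h2⟩ := h
    have hs : ∀ k ∈ I, (adjSwap n i k : ℕ) ≤ k := by
      intro k hk
      have : (k : ℕ) ≠ i := fun hc => h2 (by rwa [← show k = ⟨i, by omega⟩ from Fin.ext hc])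
      rw [adjSwap_val hi, if_neg this]
      split_ifs <;> omega
    have hw : w.symm ⟨i + 1, hi⟩ < w.symm ⟨i, by omega⟩ :=
      (symm_apply_lt_or_gt w hi).resolve_left fun hc =>
        h2 (hI _ h1 _ (Fin.mk_le_mk.mpr (Nat.le_succ i)) hc.le)
    have hI' : IsLowerLabels (adjSwap n i * w) (I.image (adjSwap n i)) := by
      intro k hk l hlk hw'
      obtain ⟨k, hkI, rfl⟩ := Finset.mem_image.mp hk
      obtain ⟨l, rfl⟩ := (adjSwap n i).surjective l
      have e : ∀ m, (adjSwap n i).symm (adjSwap n i m) = m := (adjSwap n i).symm_apply_apply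
      rw [symm_mul_apply, symm_mul_apply, e, e] at hw'
      refine Finset.mem_image_of_mem _ (hI k hkI l ?_ hw')
      have hki : (k : ℕ) ≠ i := fun hc => h2 (by rwa [← show k = ⟨i, by omega⟩ from Fin.ext hc])
      rw [Fin.le_def, adjSwap_val hi, adjSwap_val hi] at hlk
      rw [Fin.le_def]
      split_ifs at hlk <;> omega
    have hsum : ∑ k ∈ I.image (adjSwap n i), (k : ℕ) < ∑ k ∈ I, (k : ℕ) := by
      rw [Finset.sum_image (adjSwap n i).injective.injOn]
      refine Finset.sum_lt_sum hs ⟨_, h1, ?_⟩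
      rw [adjSwap_right hi]
      exact Nat.lt_succ_self i
    have h3 : (I.image (adjSwap n i)).image (adjSwap n i) = I := by
      rw [Finset.image_image, ← Equiv.Perm.coe_mul, adjSwap_mul_self]
      exact Finset.image_id
    have h4 : adjSwap n i * (adjSwap n i * w) = w := by
      rw [← mul_assoc, adjSwap_mul_self, one_mul]
    have h5 := familyStep_mul_familyRegion (w := adjSwap n i * w) hi (by
      rwa [symm_mul_apply, symm_mul_apply, adjSwap_symm, adjSwap_left hi, adjSwap_right hi])
      hI' (by rwa [h3, h4])
    rw [h3, h4] at h5
    rw [← h5]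
    exact B.mul_mem (hB (Or.inl ⟨i, hi, rfl⟩)) (ih _ (hsum.trans_le hN) _ _ hI' le_rfl)

theorem generic_mem_of_isLowerLabels (hB : generators n ⊆ B) (w : Equiv.Perm (Fin n))
    (I : Finset (Fin n)) (hI : IsLowerLabels w I) : generic w I ∈ B := by
  classical
  induction I using Finset.strongInduction with
  | _ I ih =>
  have h := familyRegion_eq_sum hI
  have hm : I ∈ I.powerset.filter (IsLowerLabels w) :=
    Finset.mem_filter.mpr ⟨Finset.mem_powerset_self I, hI⟩
  rw [← Finset.add_sum_erase _ _ hm] at h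
  rw [← sub_eq_iff_eq_add.mpr h]
  refine B.sub_mem (familyRegion_mem hB _ w I hI le_rfl) (B.sum_mem fun J hJ => ?_)
  obtain ⟨h1, h2⟩ := Finset.mem_erase.mp hJ
  obtain ⟨h3, h4⟩ := Finset.mem_filter.mp h2
  exact ih J (lt_of_le_of_ne (Finset.mem_powerset.mp h3) h1) h4

theorem heckeAlgebra_eq_adjoin (n : ℕ) :
    HeckeAlgebra n = Algebra.adjoin ℂ[T;T⁻¹] (generators n) := by
  refine le_antisymm (Algebra.adjoin_le ?_) (Algebra.adjoin_le generators_subset)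
  rintro _ ⟨⟨w, β⟩, rfl⟩
  simp only
  rw [← generic_labelClosure]
  exact generic_mem_of_isLowerLabels Algebra.subset_adjoin w _ (isLowerLabels_labelClosure w β)

/-! #### The left ideal generated by the last idempotent -/

/-- The span of the products of the standard basis of the Hecke algebra with the idempotent
`familyLevel n n`. -/
noncomputable def lastSpan (n : ℕ) : Submodule ℂ[T;T⁻¹] (Family n) :=
  Submodule.span _ (Set.range fun w : Equiv.Perm (Fin n) => familyRegion w ∅ * familyLevel n n)

theorem familyLevel_last_comm (x : Family n) : familyLevel n n * x = x * familyLevel n n := by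
  refine Family.ext_eval fun s => ?_
  rw [map_mul, map_mul]
  change levelIdem s.Fq n n * x s = x s * levelIdem s.Fq n n
  rw [levelIdem, smul_mul_assoc, mul_smul_comm]
  congr 1
  refine Matrix.ext fun F G => ?_
  rw [levelMat, Matrix.diagonal_mul, Matrix.mul_diagonal, level_last, level_last, mul_comm]

theorem familyRegion_mul_last_mem (w : Equiv.Perm (Fin n)) :
    familyRegion w ∅ * familyLevel n n ∈ lastSpan n :=
  Submodule.subset_span ⟨w, rfl⟩

/-- `familyLevel n n` is central and absorbs every `familyLevel n l`, so on its multiples only the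
Hecke generators act visibly. -/
theorem mul_mem_lastSpan {y x : Family n} (hy : y ∈ HeckeAlgebra n) (hx : x ∈ lastSpan n) :
    y * x ∈ lastSpan n := by
  rw [heckeAlgebra_eq_adjoin] at hy
  induction hy using Algebra.adjoin_induction generalizing x with
  | mem y hy =>
    induction hx using Submodule.span_induction with
    | mem x hx =>
      obtain ⟨w, rfl⟩ := hx
      simp only
      rcases hy with ⟨i, hi, rfl⟩ | ⟨l, hl, rfl⟩
      · rw [← mul_assoc]
        rcases symm_apply_lt_or_gt w hi with h | h
        · rw [familyStep_mul_familyRegion_empty hi h]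
          exact familyRegion_mul_last_mem _
        · rw [familyStep_mul_familyRegion_empty_of_gt hi h, add_mul, smul_mul_assoc,
            smul_mul_assoc]
          exact add_mem (Submodule.smul_mem _ _ (familyRegion_mul_last_mem _))
            (Submodule.smul_mem _ _ (familyRegion_mul_last_mem _))
      · rw [← familyLevel_last_comm, ← mul_assoc, isMirabolicSystem_family.E_mul l n hl le_rfl,
          familyLevel_last_comm]
        exact familyRegion_mul_last_mem _
    | zero => rw [mul_zero]; exact Submodule.zero_mem _
    | add x z _ _ h1 h2 => rw [mul_add]; exact add_mem h1 h2
    | smul c x _ h => rw [mul_smul_comm]; exact Submodule.smul_mem _ _ h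
  | algebraMap c =>
    rw [← Algebra.smul_def]
    exact Submodule.smul_mem _ _ hx
  | add y z _ _ h1 h2 => rw [add_mul]; exact add_mem (h1 hx) (h2 hx)
  | mul y z _ _ h1 h2 => rw [mul_assoc]; exact h1 (h2 hx)

theorem mul_familyLevel_last_mem {y : Family n} (hy : y ∈ HeckeAlgebra n) :
    y * familyLevel n n ∈ lastSpan n := by
  have h := familyRegion_mul_last_mem (1 : Equiv.Perm (Fin n))
  rw [familyRegion_one_empty, one_mul] at h
  exact mul_mem_lastSpan hy h

/-- Only the identity permutation has a nonzero diagonal, so the diagonal reads off one coefficient,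
a single Laurent polynomial valid for all fields at once. -/
theorem exists_diagonal_of_mem_lastSpan {x : Family n} (hx : x ∈ lastSpan n) :
    ∃ c : ℂ[T;T⁻¹], ∀ (s : PrimePower) (F : CompleteFlag s.Fq n),
      x s F F = LaurentPolynomial.eval₂ (RingHom.id ℂ) s.size c • levelIdem s.Fq n n F F := by
  classical
  induction hx using Submodule.span_induction with
  | mem x hx =>
    obtain ⟨w, rfl⟩ := hx
    refine ⟨if w = 1 then 1 else 0, fun s F => ?_⟩
    change (regionMat s.Fq w ∅ * levelIdem s.Fq n n) F F = _
    rw [levelIdem, mul_smul_comm, Matrix.smul_apply, Matrix.smul_apply, levelMat,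
      Matrix.mul_diagonal, Matrix.diagonal_apply_eq]
    split_ifs with h
    · rw [h, regionMat_one_empty, Matrix.one_apply_eq, one_mul, map_one, one_smul]
    · rw [regionMat_of_not, zero_mul, map_zero, zero_smul, smul_zero]
      rintro ⟨e, he⟩
      refine h (he.perm_eq (u := 1) ⟨he.1, ?_⟩)
      rw [← he.1]
      congr 1
      exact Basis.eq_of_apply_eq fun k => by simp
  | zero => exact ⟨0, fun s F => by rw [map_zero, zero_smul]; rfl⟩
  | add x z _ _ h1 h2 =>
    obtain ⟨c, hc⟩ := h1
    obtain ⟨d, hd⟩ := h2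
    exact ⟨c + d, fun s F => by
      rw [map_add, add_smul, ← hc, ← hd]; rfl⟩
  | smul a x _ h =>
    obtain ⟨c, hc⟩ := h
    exact ⟨a * c, fun s F => by
      rw [map_mul, mul_smul, ← hc, Family.smul_apply]; rfl⟩

end Families


/-! ### The symmetrizer over a finite field -/

section Symmetrizer

open CompleteFlag Module

variable {K : Type} [Field K] [Finite K] {n : ℕ}

/-- The support of the function lies over pairs of flags which agree up to the step `a`. -/
def AgreesUpTo (a : ℕ) (x : FunctionAlgebra K n) : Prop :=
  ∀ F H, x F H ≠ 0 → ∀ j ≤ a, F.level j = H.level j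

omit [Finite K] in
theorem AgreesUpTo.mono {a b : ℕ} {x : FunctionAlgebra K n} (h : AgreesUpTo b x) (hab : a ≤ b) :
    AgreesUpTo a x :=
  fun F H hx j hj => h F H hx j (hj.trans hab)

omit [Finite K] in
theorem agreesUpTo_one (a : ℕ) : AgreesUpTo a (1 : FunctionAlgebra K n) := by
  intro F H h j _
  by_cases hFH : F = H
  · rw [hFH]
  · exact absurd (Matrix.one_apply_ne hFH) h

omit [Finite K] in
theorem AgreesUpTo.add {a : ℕ} {x y : FunctionAlgebra K n} (hx : AgreesUpTo a x)
    (hy : AgreesUpTo a y) : AgreesUpTo a (x + y) := by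
  intro F H h
  by_cases h0 : x F H = 0
  · refine hy F H fun h1 => h ?_
    rw [Matrix.add_apply, h0, h1, add_zero]
  · exact hx F H h0

theorem AgreesUpTo.mul {a : ℕ} {x y : FunctionAlgebra K n} (hx : AgreesUpTo a x)
    (hy : AgreesUpTo a y) : AgreesUpTo a (x * y) := by
  intro F H h j hj
  rw [Matrix.mul_apply] at h
  obtain ⟨G, _, hG⟩ := Finset.exists_ne_zero_of_sum_ne_zero h
  exact (hx F G (left_ne_zero_of_mul hG) j hj).trans (hy G H (right_ne_zero_of_mul hG) j hj)

theorem agreesUpTo_stepMat {i : ℕ} (hi : i ≤ n) : AgreesUpTo i (stepMat K n i) := by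
  classical
  intro F H h j hj
  rw [stepMat] at h
  have h' : AgreeOff i F H ∧ F ≠ H := by
    by_contra hc
    exact h (if_neg hc)
  exact h'.1 j (by omega) (by omega)

theorem agreesUpTo_ascSum (a r : ℕ) (h : a + r ≤ n) : AgreesUpTo a (ascSum (stepMat K n) a r) := by
  induction r generalizing a with
  | zero => exact agreesUpTo_one a
  | succ r ih =>
    exact (agreesUpTo_one a).add ((agreesUpTo_stepMat (by omega)).mul
      ((ih (a + 1) (by omega)).mono (Nat.le_succ a)))

theorem agreesUpTo_symmetrizer (a r : ℕ) (h : a + r ≤ n) :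
    AgreesUpTo a (symmetrizer (stepMat K n) a r) := by
  induction r generalizing a with
  | zero => exact agreesUpTo_one a
  | succ r ih =>
    exact ((ih (a + 1) (by omega)).mono (Nat.le_succ a)).mul (agreesUpTo_ascSum a r (by omega))

/-- Any summand other than 1 starts by changing step `a + 1`, and its later factors leave that step
alone. -/
theorem ascSum_apply (a r : ℕ) (h : a + r < n) (H F : CompleteFlag K n)
    (hHF : ∀ j ≤ a + 1, H.level j = F.level j) :
    ascSum (stepMat K n) a r H F = (1 : FunctionAlgebra K n) H F := by
  classical
  cases r with
  | zero => rfl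
  | succ r =>
    rw [ascSum, Matrix.add_apply, Matrix.mul_apply, Finset.sum_eq_zero, add_zero]
    intro G _
    by_contra hne
    have h1 := agreesUpTo_ascSum (a + 1) r (by omega) G F (right_ne_zero_of_mul hne)
    have h2 := left_ne_zero_of_mul hne
    rw [stepMat] at h2
    have h3 : AgreeOff a H G ∧ H ≠ G := by
      by_contra hc
      exact h2 (if_neg hc)
    refine h3.2 (h3.1.eq_of_level_le ?_)
    rw [hHF _ le_rfl, h1 _ le_rfl]

/-- The symmetrizer is the sum of all `T_w` on its strands, and only the unit has diagonal entries.
The induction peels off one coset sum instead of listing permutations. -/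
theorem symmetrizer_apply_self (a r : ℕ) (h : a + r ≤ n) (F : CompleteFlag K n) :
    symmetrizer (stepMat K n) a r F F = 1 := by
  classical
  induction r generalizing a with
  | zero => exact Matrix.one_apply_eq F
  | succ r ih =>
    rw [symmetrizer, Matrix.mul_apply, Finset.sum_eq_single F]
    · rw [ascSum_apply a r (by omega) F F fun _ _ => rfl, Matrix.one_apply_eq, mul_one,
        ih (a + 1) (by omega)]
    · intro H _ hH
      by_contra hne
      have h1 := agreesUpTo_symmetrizer (a + 1) r (by omega) F H (left_ne_zero_of_mul hne)
      have h2 := right_ne_zero_of_mul hne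
      rw [ascSum_apply a r (by omega) H F fun j hj => (h1 j hj).symm, Matrix.one_apply_ne hH] at h2
      exact h2 rfl
    · exact fun hc => absurd (Finset.mem_univ F) hc

theorem stepMat_mul_symmetrizer {i : ℕ} (hi : i + 1 < n) :
    stepMat K n i * symmetrizer (stepMat K n) 0 n =
      (Nat.card K : ℂ) • symmetrizer (stepMat K n) 0 n := by
  have hT : IsHeckeSystem n (Nat.card K : ℂ) (stepMat K n) := by
    have h := isMirabolicSystem_stepMat (K := K) (n := n)
    have h0 : levelIdem K n 0 = 1 := by simp [levelIdem, levelMat_zero]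
    refine ⟨fun i hi => ?_, h.braid, h.comm⟩
    rw [h.quad i hi, h0]
  have hne : qFac (Nat.card K : ℂ) n ≠ 0 := by
    rw [qFac, Finset.prod_ne_zero_iff]
    intro m _
    rw [qNum, Finset.sum_range_succ', pow_zero]
    norm_cast
  have h1 : symmetrizer' (stepMat K n) 0 n = symmetrizer (stepMat K n) 0 n :=
    smul_right_injective _ hne (hT.smul_symmetrizer'_eq 0 n (by omega))
  rw [← h1]
  exact hT.gen_mul_symmetrizer' 0 n (by omega) i (by omega) (by omega)

end Symmetrizer

/-! ### Transport along ring homomorphisms -/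

theorem map_ascSum {R R' : Type*} [Ring R] [Ring R'] (f : R →+* R') (T : ℕ → R) (a r : ℕ) :
    f (ascSum T a r) = ascSum (fun i => f (T i)) a r := by
  induction r generalizing a with
  | zero => exact map_one f
  | succ r ih => rw [ascSum, ascSum, map_add, map_mul, map_one, ih]

theorem map_symmetrizer {R R' : Type*} [Ring R] [Ring R'] (f : R →+* R') (T : ℕ → R) (a r : ℕ) :
    f (symmetrizer T a r) = symmetrizer (fun i => f (T i)) a r := by
  induction r generalizing a with
  | zero => exact map_one f
  | succ r ih => rw [symmetrizer, symmetrizer, map_mul, ih, map_ascSum]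

theorem IsMirabolicSystem.of_injective {k R k' R' : Type*} [CommRing k] [Ring R] [Algebra k R]
    [CommRing k'] [Ring R'] [Algebra k' R'] {n : ℕ} {q : k} {q' : k'} {T E : ℕ → R}
    (f : R →+* R') (hf : Function.Injective f) (hq : ∀ x, f (q • x) = q' • f x)
    (h : IsMirabolicSystem n q' (fun i => f (T i)) fun l => f (E l)) :
    IsMirabolicSystem n q T E where
  E_mul l m h1 h2 := hf (by rw [map_mul, h.E_mul l m h1 h2])
  mul_E l m h1 h2 := hf (by rw [map_mul, h.mul_E l m h1 h2])
  E_zero_mul i hi := hf (by rw [map_mul, h.E_zero_mul i hi])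
  comm_E i l h1 h2 h3 := hf (by rw [map_mul, map_mul, (h.comm_E i l h1 h2 h3).eq])
  quad i hi := hf (by
    rw [map_mul, h.quad i hi, map_add, sub_smul, sub_smul, map_sub, hq, hq, one_smul, one_smul])
  braid i hi := hf (by simp only [map_mul, h.braid i hi])
  comm i j h1 h2 := hf (by simp only [map_mul, h.comm i j h1 h2])
  E_mul_T_mul_E i hi := hf (by simp only [map_mul, h.E_mul_T_mul_E i hi])
  add_mul_E_mul_add i hi := hf (by
    simp only [map_mul, map_add, hq, h.add_mul_E_mul_add i hi])

/-! ### The criterion for an algebra generated by a mirabolic system -/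

section Criterion

variable {k A : Type*} [Field k] [Ring A] [Algebra k A] {n : ℕ} {q : k} {T E : ℕ → A}

/-- The ring is generated by the scalars and the elements `T i` and `E l`. -/
def IsGeneratedBy (k : Type*) {A : Type*} [Field k] [Ring A] [Algebra k A] (n : ℕ)
    (T E : ℕ → A) : Prop :=
  ∀ S : Subring A, (∀ i, i + 1 < n → T i ∈ S) → (∀ l, l ≤ n → E l ∈ S) →
    (∀ c : k, algebraMap k A c ∈ S) → S = ⊤

theorem IsMirabolicSystem.isSemisimpleRing (h : IsMirabolicSystem n q T E)
    (hgen : IsGeneratedBy k n T E) (h0 : E 0 = 1) (hq : q ≠ 0)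
    (hn : ∀ m, m < n → qNum q (m + 1) ≠ 0) : IsSemisimpleRing A := by
  refine (isSemisimpleModule_iff A A).mpr ⟨fun N => ?_⟩
  obtain ⟨P, P_mem, P_apply, P_T, P_E⟩ := IsMirabolicSystem.exists_projection (k := k)
    (N := N.restrictScalars k) hq n hn _ _
    (h.map (q' := q) (Algebra.lmul k A).toRingHom fun x => map_smul (Algebra.lmul k A) q x)
    (fun i _ v hv => N.smul_mem (T i) hv) (fun l _ v hv => N.smul_mem (E l) hv)
  -- The elements whose left multiplication commutes with `P` form a subring containing the
  -- generators, so `P` is linear over the whole ring.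
  have hS := hgen ((Subring.centralizer {P}).comap (Algebra.lmul k A).toRingHom)
    (fun i hi => Subring.mem_centralizer_iff.mpr fun g hg => by
      rw [Set.mem_singleton_iff.mp hg]; exact (P_T i hi).eq.symm)
    (fun l hl => Subring.mem_centralizer_iff.mpr fun g hg => by
      rw [Set.mem_singleton_iff.mp hg]; exact (P_E l hl).eq.symm)
    (fun c => Subring.mem_centralizer_iff.mpr fun g hg => by
      rw [Set.mem_singleton_iff.mp hg]
      ext v
      simp)
  have hP : ∀ a v : A, P (a * v) = a * P v := by
    intro a v
    have ha : a ∈ (Subring.centralizer {P}).comap (Algebra.lmul k A).toRingHom := hS ▸ trivial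
    exact LinearMap.congr_fun (Subring.mem_centralizer_iff.mp ha P rfl) v
  let P' : A →ₗ[A] N :=
    { toFun := fun v => ⟨P v, P_mem v⟩
      map_add' := fun v w => Subtype.ext (map_add P v w)
      map_smul' := fun a v => Subtype.ext (hP a v) }
  refine ⟨LinearMap.ker P', LinearMap.isCompl_of_proj fun x => Subtype.ext ?_⟩
  have := P_apply x x.2
  rw [h0] at this
  exact this.trans (one_mul _)

/-- The left ideal of X consists of scalar multiples of X, and X² = 0. In a semisimple ring it is
generated by an idempotent a X, so X = X a X, a multiple of X². -/
theorem IsMirabolicSystem.symmetrizer_mul_eq_zero [IsSemisimpleRing A]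
    (h : IsMirabolicSystem n q T E) (hgen : IsGeneratedBy k n T E)
    (hT : ∀ i, i + 1 < n → T i * symmetrizer T 0 n = q • symmetrizer T 0 n)
    (hE : ∀ x, E n * x = x * E n) (hn : qFac q n = 0) : symmetrizer T 0 n * E n = 0 := by
  set X := symmetrizer T 0 n * E n with hX
  have h1 : ∀ i, i + 1 < n → T i * X = q • X := fun i hi => by
    rw [hX, ← mul_assoc, hT i hi, smul_mul_assoc]
  have h2 : ∀ l, l ≤ n → E l * X = X := fun l hl => by
    rw [hX, ← hE, ← mul_assoc, h.E_mul l n hl le_rfl]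
  have hXX : X * X = 0 := by
    have := symmetrizer_mul (T := T) (y := X) 0 n fun j _ hj => h1 j (by omega)
    rw [hn, zero_smul] at this
    conv_lhs => enter [1]; rw [hX]
    rw [mul_assoc, h2 n le_rfl, this]
  let S : Subring A :=
    { carrier := {a | ∃ c : k, a * X = c • X}
      mul_mem' := by
        rintro a b ⟨c, hc⟩ ⟨d, hd⟩
        exact ⟨d * c, by rw [mul_assoc, hd, mul_smul_comm, hc, smul_smul]⟩
      one_mem' := ⟨1, by rw [one_mul, one_smul]⟩
      add_mem' := by
        rintro a b ⟨c, hc⟩ ⟨d, hd⟩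
        exact ⟨c + d, by rw [add_mul, hc, hd, add_smul]⟩
      zero_mem' := ⟨0, by rw [zero_mul, zero_smul]⟩
      neg_mem' := by
        rintro a ⟨c, hc⟩
        exact ⟨-c, by rw [neg_mul, hc, neg_smul]⟩ }
  have hS : S = ⊤ := hgen S (fun i hi => ⟨q, h1 i hi⟩)
    (fun l hl => ⟨1, by rw [h2 l hl, one_smul]⟩) fun c => ⟨c, (Algebra.smul_def c X).symm⟩
  obtain ⟨e, he, hI⟩ := IsSemisimpleRing.ideal_eq_span_idempotent (Ideal.span {X})
  obtain ⟨a, ha⟩ := Ideal.mem_span_singleton'.mp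
    (hI ▸ Ideal.mem_span_singleton_self e : e ∈ Ideal.span {X})
  obtain ⟨b, hb⟩ := Ideal.mem_span_singleton'.mp
    (hI ▸ Ideal.mem_span_singleton_self X : X ∈ Ideal.span {e})
  have ha' : a ∈ S := hS ▸ trivial
  obtain ⟨c, hc⟩ := ha'
  calc X = b * e := hb.symm
    _ = b * e * e := by rw [mul_assoc, he.eq]
    _ = X * (a * X) := by rw [hb, ha]
    _ = 0 := by rw [hc, mul_smul_comm, hXX, smul_zero]

end Criterion

/-! ### The specialized mirabolic Hecke algebra -/

section Specialization

variable {n : ℕ}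

/-- The elements `familyStep n i` of the mirabolic Hecke algebra. -/
noncomputable def heckeStep (n i : ℕ) : HeckeAlgebra n := ⟨familyStep n i, familyStep_mem n i⟩

/-- The elements `familyLevel n l` of the mirabolic Hecke algebra. -/
noncomputable def heckeLevel (n l : ℕ) : HeckeAlgebra n := ⟨familyLevel n l, familyLevel_mem n l⟩

theorem isMirabolicSystem_hecke :
    IsMirabolicSystem n (LaurentPolynomial.T 1 : ℂ[T;T⁻¹]) (heckeStep n) (heckeLevel n) :=
  IsMirabolicSystem.of_injective (HeckeAlgebra n).val.toRingHom Subtype.val_injective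
    (fun _ => rfl) isMirabolicSystem_family

theorem adjoin_hecke : Algebra.adjoin ℂ[T;T⁻¹]
    ({x | (∃ i, i + 1 < n ∧ heckeStep n i = x) ∨ ∃ l, l ≤ n ∧ heckeLevel n l = x} :
      Set (HeckeAlgebra n)) = ⊤ := by
  refine Subalgebra.map_injective (f := (HeckeAlgebra n).val) Subtype.val_injective ?_
  rw [AlgHom.map_adjoin, Algebra.map_top, Subalgebra.range_val]
  conv_rhs => rw [heckeAlgebra_eq_adjoin]
  congr 1
  ext x
  constructor
  · rintro ⟨_, ⟨i, hi, rfl⟩ | ⟨l, hl, rfl⟩, rfl⟩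
    · exact Or.inl ⟨i, hi, rfl⟩
    · exact Or.inr ⟨l, hl, rfl⟩
  · rintro (⟨i, hi, rfl⟩ | ⟨l, hl, rfl⟩)
    · exact ⟨_, Or.inl ⟨i, hi, rfl⟩, rfl⟩
    · exact ⟨_, Or.inr ⟨l, hl, rfl⟩, rfl⟩

theorem heckeStep_mul_symmetrizer {i : ℕ} (hi : i + 1 < n) :
    heckeStep n i * symmetrizer (heckeStep n) 0 n =
      (LaurentPolynomial.T 1 : ℂ[T;T⁻¹]) • symmetrizer (heckeStep n) 0 n := by
  refine Subtype.ext (Family.ext_eval fun s => ?_)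
  change Family.eval n s ((HeckeAlgebra n).val.toRingHom
      (heckeStep n i * symmetrizer (heckeStep n) 0 n)) =
    Family.eval n s ((LaurentPolynomial.T 1 : ℂ[T;T⁻¹]) •
      (HeckeAlgebra n).val.toRingHom (symmetrizer (heckeStep n) 0 n))
  rw [map_mul, map_symmetrizer, Family.eval_T_smul, map_mul, map_symmetrizer]
  exact stepMat_mul_symmetrizer hi

theorem heckeLevel_last_comm (x : HeckeAlgebra n) : heckeLevel n n * x = x * heckeLevel n n :=
  Subtype.ext (familyLevel_last_comm _)

/-- The complex algebra structure of the specialized mirabolic Hecke algebra. -/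
noncomputable instance (n : ℕ) (q : ℂ) : Algebra ℂ (SpecializedHeckeAlgebra n q) :=
  Algebra.compHom _ (LaurentPolynomial.C : ℂ →+* ℂ[T;T⁻¹])

/-- The projection to the specialization. -/
noncomputable def specialize (n : ℕ) (q : ℂ) :
    HeckeAlgebra n →ₐ[ℂ[T;T⁻¹]] SpecializedHeckeAlgebra n q where
  toRingHom := (specializationIdeal n q).ringCon.mk'
  commutes' _ := rfl

theorem specialize_surjective (q : ℂ) : Function.Surjective (specialize n q) :=
  RingCon.mk'_surjective _

theorem specialize_eq_zero_iff (q : ℂ) (x : HeckeAlgebra n) :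
    specialize n q x = 0 ↔ x ∈ specializationIdeal n q := by
  rw [TwoSidedIdeal.mem_iff]
  exact RingCon.eq _

/-- Since 𝐪 is central, the multiples of 𝐪 - q already form a two-sided ideal. -/
theorem mem_specializationIdeal {q : ℂ} {x : HeckeAlgebra n} (hx : x ∈ specializationIdeal n q) :
    ∃ y, x = (LaurentPolynomial.T 1 - LaurentPolynomial.C q : ℂ[T;T⁻¹]) • y := by
  have h : specializationIdeal n q ≤ TwoSidedIdeal.mk'
      {x | ∃ y, x = (LaurentPolynomial.T 1 - LaurentPolynomial.C q : ℂ[T;T⁻¹]) • y}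
      ⟨0, (smul_zero _).symm⟩
      (by rintro _ _ ⟨y, rfl⟩ ⟨z, rfl⟩; exact ⟨y + z, (smul_add _ _ _).symm⟩)
      (by rintro _ ⟨y, rfl⟩; exact ⟨-y, (smul_neg _ _).symm⟩)
      (by rintro x _ ⟨y, rfl⟩; exact ⟨x * y, mul_smul_comm _ _ _⟩)
      (by rintro _ x ⟨y, rfl⟩; exact ⟨y * x, smul_mul_assoc _ _ _⟩) := by
    rw [specializationIdeal, TwoSidedIdeal.span_le, Set.singleton_subset_iff, SetLike.mem_coe,
      TwoSidedIdeal.mem_mk']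
    exact ⟨1, Algebra.algebraMap_eq_smul_one _⟩
  have := h hx
  rwa [TwoSidedIdeal.mem_mk'] at this

/-- In the quotient 𝐪 becomes q, so Laurent polynomials act through evaluation; it suffices to
compare constants and 𝐪. -/
theorem algebraMap_specialized (q : ℂˣ) (f : ℂ[T;T⁻¹]) :
    algebraMap ℂ[T;T⁻¹] (SpecializedHeckeAlgebra n q) f =
      algebraMap ℂ (SpecializedHeckeAlgebra n q)
        (LaurentPolynomial.eval₂ (RingHom.id ℂ) q f) := by
  have hC : ∀ c : ℂ, algebraMap ℂ (SpecializedHeckeAlgebra n q) c =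
      algebraMap ℂ[T;T⁻¹] (SpecializedHeckeAlgebra n q) (LaurentPolynomial.C c) := fun _ => rfl
  have h : algebraMap ℂ[T;T⁻¹] (SpecializedHeckeAlgebra n q) =
      (algebraMap ℂ (SpecializedHeckeAlgebra n q)).comp
        (LaurentPolynomial.eval₂ (RingHom.id ℂ) q) := by
    refine IsLocalization.ringHom_ext (Submonoid.powers (Polynomial.X : Polynomial ℂ))
      (Polynomial.ringHom_ext (fun c => ?_) ?_)
    · rw [RingHom.comp_apply, RingHom.comp_apply, RingHom.comp_apply,
        LaurentPolynomial.algebraMap_eq_toLaurent, Polynomial.toLaurent_C,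
        LaurentPolynomial.eval₂_C, hC, RingHom.id_apply]
    · rw [RingHom.comp_apply, RingHom.comp_apply, RingHom.comp_apply,
        LaurentPolynomial.algebraMap_eq_toLaurent, Polynomial.toLaurent_X,
        LaurentPolynomial.eval₂_T, zpow_one, hC,
        ← sub_eq_zero, ← map_sub, ← AlgHom.commutes (specialize n q), specialize_eq_zero_iff]
      exact TwoSidedIdeal.subset_span rfl
  exact RingHom.congr_fun h f

theorem specialize_T_smul (q : ℂˣ) (x : HeckeAlgebra n) :
    specialize n q ((LaurentPolynomial.T 1 : ℂ[T;T⁻¹]) • x) = (q : ℂ) • specialize n q x := by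
  rw [map_smul, Algebra.smul_def, algebraMap_specialized, LaurentPolynomial.eval₂_T, zpow_one,
    ← Algebra.smul_def]

theorem isMirabolicSystem_specialized (q : ℂˣ) : IsMirabolicSystem n (q : ℂ)
    (fun i => specialize n q (heckeStep n i)) fun l => specialize n q (heckeLevel n l) :=
  isMirabolicSystem_hecke.map (specialize n q).toRingHom (specialize_T_smul q)

theorem isGeneratedBy_specialized (q : ℂˣ) : IsGeneratedBy ℂ n
    (fun i => specialize n q (heckeStep n i)) fun l => specialize n q (heckeLevel n l) := by
  intro S hT hE hC
  let B : Subalgebra ℂ[T;T⁻¹] (SpecializedHeckeAlgebra n q) :=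
    { S with
      algebraMap_mem' := fun f => by
        rw [algebraMap_specialized]
        exact hC _ }
  have hB : ⊤ ≤ B.comap (specialize n (q : ℂ)) := by
    rw [← adjoin_hecke]
    refine Algebra.adjoin_le ?_
    rintro _ (⟨i, hi, rfl⟩ | ⟨l, hl, rfl⟩)
    · exact hT i hi
    · exact hE l hl
  rw [eq_top_iff]
  intro a _
  obtain ⟨x, rfl⟩ := specialize_surjective (n := n) (q : ℂ) a
  exact hB (Algebra.mem_top (x := x))

/-- A Laurent polynomial which vanishes at all prime powers vanishes everywhere. -/
theorem eval₂_eq_zero_of_forall_size {f : ℂ[T;T⁻¹]}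
    (h : ∀ s : PrimePower, LaurentPolynomial.eval₂ (RingHom.id ℂ) s.size f = 0) (q : ℂˣ) :
    LaurentPolynomial.eval₂ (RingHom.id ℂ) q f = 0 := by
  obtain ⟨N, p, hp⟩ := f.exists_T_pow
  have key : ∀ x : ℂˣ, p.eval (x : ℂ) =
      LaurentPolynomial.eval₂ (RingHom.id ℂ) x f * (x : ℂ) ^ N := by
    intro x
    rw [← LaurentPolynomial.eval₂_T_n (RingHom.id ℂ) x, ← map_mul, ← hp,
      LaurentPolynomial.eval₂_toLaurent]
    rfl
  have h0 : p = 0 := by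
    refine Polynomial.eq_zero_of_infinite_isRoot p (Set.Infinite.mono ?_
      (Set.infinite_range_of_injective (f := fun k : ℕ => (2 : ℂ) ^ (k + 1)) ?_))
    · rintro _ ⟨k, rfl⟩
      have := key (PrimePower.size ⟨2, k + 1, Nat.prime_two, Nat.succ_ne_zero k⟩)
      rw [h, zero_mul] at this
      simpa [PrimePower.size] using this
    · intro a b hab
      have h1 : (2 : ℕ) ^ (a + 1) = 2 ^ (b + 1) := by
        have hab : (2 : ℂ) ^ (a + 1) = 2 ^ (b + 1) := hab
        exact_mod_cast hab
      have := Nat.pow_right_injective le_rfl h1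
      omega
  have := key q
  rw [h0, Polynomial.eval_zero] at this
  exact (mul_eq_zero.mp this.symm).resolve_right (pow_ne_zero _ q.ne_zero)

theorem specialize_symmetrizer_ne_zero (q : ℂˣ) :
    specialize n q (symmetrizer (heckeStep n) 0 n * heckeLevel n n) ≠ 0 := by
  intro h
  obtain ⟨y, hy⟩ := mem_specializationIdeal ((specialize_eq_zero_iff _ _).mp h)
  -- Multiplying by the idempotent `familyLevel n n` costs nothing on the left and puts the cofactor
  -- `y` into `lastSpan`, where its diagonal is governed by one Laurent polynomial.
  obtain ⟨c, hc⟩ := exists_diagonal_of_mem_lastSpan (mul_familyLevel_last_mem y.2)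
  have h1 : symmetrizer (familyStep n) 0 n * familyLevel n n =
      (LaurentPolynomial.T 1 - LaurentPolynomial.C (q : ℂ) : ℂ[T;T⁻¹]) •
        ((y : Family n) * familyLevel n n) := by
    have h2 : (HeckeAlgebra n).val.toRingHom
          (symmetrizer (heckeStep n) 0 n * heckeLevel n n * heckeLevel n n) =
        (HeckeAlgebra n).val.toRingHom ((LaurentPolynomial.T 1 - LaurentPolynomial.C (q : ℂ) :
          ℂ[T;T⁻¹]) • y * heckeLevel n n) := by rw [hy]
    rw [mul_assoc, isMirabolicSystem_hecke.E_mul n n le_rfl le_rfl, map_mul, map_symmetrizer,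
      smul_mul_assoc] at h2
    exact h2
  -- The symmetrizer has diagonal entries 1, so comparing a diagonal entry over each field gives (s
  -- - q) c(s) = 1.
  have h3 : ∀ s : PrimePower, LaurentPolynomial.eval₂ (RingHom.id ℂ) s.size
      ((LaurentPolynomial.T 1 - LaurentPolynomial.C (q : ℂ)) * c - 1) = 0 := by
    intro s
    let F : CompleteFlag s.Fq n := flag (Pi.basisFun s.Fq (Fin n))
    have h4 : Family.eval n s (symmetrizer (familyStep n) 0 n * familyLevel n n) F F =
        levelIdem s.Fq n n F F := by
      rw [map_mul, map_symmetrizer]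
      change (symmetrizer (stepMat s.Fq n) 0 n * levelIdem s.Fq n n) F F = _
      rw [levelIdem, mul_smul_comm, Matrix.smul_apply, Matrix.smul_apply, levelMat,
        Matrix.mul_diagonal, symmetrizer_apply_self 0 n (by omega), one_mul,
        Matrix.diagonal_apply_eq]
    rw [h1, Family.eval_apply, Family.smul_apply, Matrix.smul_apply, hc, smul_smul, ← map_mul] at h4
    have h5 : (levelIdem s.Fq n n F F).coeff 0 ≠ 0 := by
      classical
      rw [levelIdem, Matrix.smul_apply, levelMat, Matrix.diagonal_apply_eq,
        AddMonoidAlgebra.coeff_smul, Finsupp.smul_apply, coeff_subSum,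
        if_pos (Submodule.zero_mem _), smul_eq_mul, mul_one]
      exact inv_ne_zero (pow_ne_zero _ (Nat.cast_ne_zero.mpr Nat.card_pos.ne'))
    have h6 := congrArg (fun x => x.coeff 0) h4
    simp only [AddMonoidAlgebra.coeff_smul, Finsupp.smul_apply, smul_eq_mul] at h6
    rw [map_sub, map_one, sub_eq_zero]
    exact mul_right_cancel₀ h5 (h6.trans (one_mul _).symm)
  have h7 := eval₂_eq_zero_of_forall_size h3 q
  rw [map_sub, map_mul, map_sub, LaurentPolynomial.eval₂_T, LaurentPolynomial.eval₂_C, zpow_one,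
    RingHom.id_apply, sub_self, zero_mul, map_one, zero_sub, neg_eq_zero] at h7
  exact one_ne_zero h7

theorem qFactorial_eq_qFac (q : ℂ) (n : ℕ) : qFactorial q n = qFac q n := by
  rw [qFactorial, qFac, Finset.range_eq_Ico, Finset.prod_Ico_add' (fun m => qNum q m) 0 n 1]
  rfl

theorem isSemisimpleRing_specialized_iff (n : ℕ) (q : ℂˣ) :
    IsSemisimpleRing (SpecializedHeckeAlgebra n q) ↔ qFactorial q n ≠ 0 := by
  rw [qFactorial_eq_qFac]
  constructor
  · intro hA hn
    refine specialize_symmetrizer_ne_zero (n := n) q ?_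
    have hs : ∀ x, specialize n q x = (specialize n q).toRingHom x := fun _ => rfl
    rw [map_mul, hs (symmetrizer _ _ _), map_symmetrizer]
    refine (isMirabolicSystem_specialized q).symmetrizer_mul_eq_zero
      (isGeneratedBy_specialized q) (fun i hi => ?_) (fun x => ?_) hn
    · have h := congrArg (specialize n q) (heckeStep_mul_symmetrizer hi)
      rw [specialize_T_smul, map_mul, hs (symmetrizer _ _ _), map_symmetrizer] at h
      exact h
    · obtain ⟨x, rfl⟩ := specialize_surjective (n := n) (q : ℂ) x
      rw [← map_mul, heckeLevel_last_comm, map_mul]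
  · intro hn
    refine (isMirabolicSystem_specialized q).isSemisimpleRing (isGeneratedBy_specialized q) ?_
      q.ne_zero ?_
    · rw [show heckeLevel n 0 = 1 from Subtype.ext familyLevel_zero, map_one]
    · intro m hm
      exact Finset.prod_ne_zero_iff.mp hn m (Finset.mem_range.mpr hm)

end Specialization

end Mirabolic

theorem mainTheorem9 (n : ℕ) (q : ℂ) (hq : q ≠ 0) :
    IsSemisimpleRing (Mirabolic.SpecializedHeckeAlgebra n q) ↔ Mirabolic.qFactorial q n ≠ 0 :=
  Mirabolic.isSemisimpleRing_specialized_iff n (Units.mk0 q hq)
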